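/- Let $M$ be a connected smooth manifold (Hausdorff, second countable, without boundary) of dimension $n+p$ with $n,p\ge 1$, let $g=\langle\cdot,\cdot\rangle$ be a smooth pseudo-Riemannian metric on $M$ with Levi-Civita connection $\nabla$ and volume density $d\mathrm{vol}_g$, and let $\widetilde{\mathcal D}\subset TM$ be a smooth $n$-dimensional distribution on which $g$ is nondegenerate, with orthogonal complement $\mathcal D$ of rank $p$. Write $X=X^\top+X^\perp$ for the decomposition of vectors along $TM=\widetilde{\mathcal D}\oplus\mathcal D$. Let $\{E_a,\mathcal E_i\}$ be an adapted orthonormal frame ($E_a\in\widetilde{\mathcal D}$, $\mathcal E_i\in\mathcal D$), with $\varepsilon_a=\langle E_a,E_a\rangle=\pm1$, $\varepsilon_i=\langle\mathcal E_i,\mathcal E_i\rangle=\pm1$, and let $\{e_\lambda\}=\{E_a\}\cup\{\mathcal E_i\}$. Let $$H=\sum_a\varepsilon_a(\nabla_{E_a}E_a)^\perp,\qquad \widetilde H=\sum_i\varepsilon_i(\nabla_{\mathcal E_i}\mathcal E_i)^\top$$ be the mean curvature vector fields of $\widetilde{\mathcal D}$ and $\mathcal D$, i.e. the traces of their second fundamental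 forms. For a $(1,2)$-tensor field $\mathfrak T$ put $\bar\nabla=\nabla+\mathfrak T$, $\bar R_{X,Y}=[\bar\nabla_Y,\bar\nabla_X]+\bar\nabla_{[X,Y]}$ and $$\bar{\mathrm S}_{\rm mix}=\frac12\sum_{a,i}\varepsilon_a\varepsilon_i\big(\langle\bar R_{E_a,\mathcal E_i}E_a,\mathcal E_i\rangle+\langle\bar R_{\mathcal E_i,E_a}\mathcal E_i,E_a\rangle\big).$$ Let $\mathfrak a\neq0$ and $\Lambda$ be real constants, and let the Lagrangian $\mathcal L$ be a smooth function of $x\in M$ and of the value $\mathfrak T_x$. The mixed Einstein–Hilbert action with fixed $g$ over a relatively compact open set $\Omega\subset M$ is $$\bar J_\Omega(\mathfrak T)=\int_\Omega\Big\{\frac1{2\mathfrak a}\big(\bar{\mathrm S}_{\rm mix}-2\Lambda\big)+\mathcal L\Big\}\,d\mathrm{vol}_g .$$ The spin tensor is $s=2\,\partial\mathcal L/\partial\mathfrak T$, that is, $\langle s(X,Y),Z\rangle=2\,\frac{d}{dt}\big|_{t=0}\mathcal L(\mathfrak T+t\,X^\flat\otimes Y^\flat\otimes Z)$, and $s(\cdot,\cdot)$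 denotes its contraction $$\langle s(\cdot,\cdot),W\rangle=\sum_\lambda\varepsilon_\lambda\big(\langle s(e_\lambda,e_\lambda),W\rangle-\langle s(e_\lambda,W),e_\lambda\rangle\big),$$ with components $s^\top=(s(\cdot,\cdot))^\top$ and $s^\perp=(s(\cdot,\cdot))^\perp$. A smooth vector field $U$ defines the semi-symmetric connection $\bar\nabla_XY=\nabla_XY+\langle U,Y\rangle X-\langle X,Y\rangle U$, with contorsion $\mathfrak T^U_XY=\langle U,Y\rangle X-\langle X,Y\rangle U$. It is called critical for the action with fixed $g$ among all semi-symmetric connections if $\frac{d}{dt}\big|_{t=0}\bar J_\Omega(\mathfrak T^{U_t})=0$ for every relatively compact open $\Omega\subset M$ and every smooth family of vector fields $U_t$, $|t|<\varepsilon$, with $U_0=U$ that coincides with $U$ outside a compact subset of $\Omega$. **Proposition.** The semi-symmetric connection given by a smooth vector field $U$ is critical for the mixed Einstein–Hilbert action with fixed $g$ among all semi-symmetric connections if and only if, everywhere on $M$, $$2p(n-1)\,U^\top-(n-p)\,\widetilde H=-\mathfrak a\,s^\top,\qquad 2n(p-1)\,U^\perp-(p-n)\,H=-\mathfrak a\,s^\perp,$$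 where $s$ is taken at $\mathfrak T=\mathfrak T^U$. In particular, if $n=p=1$ and $s=0$ (no spin) along $\mathfrak T^U$, then the semi-symmetric connection given by $U$ is critical; so without spin every semi-symmetric connection is critical among all such connections. -/

import Mathlib

open Bundle Set Filter Topology MeasureTheory
open scoped Manifold ContDiff

noncomputable section

namespace MixedEH

/-! ### Linear algebra -/

/-- A symmetric nondegenerate bilinear form admits an orthonormal basis in the pseudo-Euclidean
sense. -/
theorem exists_orthonormal {W : Type*} [AddCommGroup W] [Module ℝ W] [FiniteDimensional ℝ W]
    (B : LinearMap.BilinForm ℝ W) (hs : ∀ v w, B v w = B w v)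
    (hn : ∀ v, (∀ w, B v w = 0) → v = 0) {k : ℕ} (hk : Module.finrank ℝ W = k) :
    ∃ e : Fin k → W, (∀ i, B (e i) (e i) = 1 ∨ B (e i) (e i) = -1) ∧
      ∀ i j, i ≠ j → B (e i) (e j) = 0 := by
  subst hk
  have : Invertible (2 : ℝ) := invertibleOfNonzero two_ne_zero
  obtain ⟨v, hv⟩ := LinearMap.BilinForm.exists_orthogonal_basis (B := B)
    (by constructor; intro x y; simpa using hs x y)
  have hv' : ∀ i j, i ≠ j → B (v i) (v j) = 0 := fun i j h ↦ hv h
  have hne : ∀ i, B (v i) (v i) ≠ 0 := by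
    intro i hi
    refine v.ne_zero i (hn _ fun w ↦ ?_)
    have : B (v i) = 0 := v.ext fun j ↦ by
      by_cases h : i = j
      · subst h; simpa using hi
      · simpa using hv' i j h
    simp [this]
  refine ⟨fun i ↦ (Real.sqrt |B (v i) (v i)|)⁻¹ • v i, fun i ↦ ?_, fun i j h ↦ ?_⟩
  · have h0 : 0 < |B (v i) (v i)| := abs_pos.mpr (hne i)
    have h3 : ∀ c : ℝ, 0 < c → B ((Real.sqrt c)⁻¹ • v i) ((Real.sqrt c)⁻¹ • v i)
        = B (v i) (v i) / c := by
      intro c hc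
      obtain ⟨r, hr, rfl⟩ : ∃ r : ℝ, 0 < r ∧ r * r = c :=
        ⟨Real.sqrt c, Real.sqrt_pos.mpr hc, Real.mul_self_sqrt hc.le⟩
      rw [Real.sqrt_mul_self hr.le]
      simp only [map_smul, LinearMap.smul_apply, smul_eq_mul]
      field_simp
    rw [h3 _ h0]
    rcases lt_or_gt_of_ne (hne i) with h | h
    · right; rw [abs_of_neg h, div_neg, div_self (hne i)]
    · left; rw [abs_of_pos h, div_self (hne i)]
  · simp [hv' i j h]

/-! ### Metrics, the Levi-Civita connection and the volume -/

section Metric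

variable {m : ℕ} {M : Type*} [TopologicalSpace M] [ChartedSpace (EuclideanSpace ℝ (Fin m)) M]

instance instFiniteDimensionalTangentSpace (x : M) :
    FiniteDimensional ℝ (TangentSpace (𝓡 m) x) :=
  inferInstanceAs (FiniteDimensional ℝ (EuclideanSpace ℝ (Fin m)))

instance instT2SpaceTangentSpace (x : M) : T2Space (TangentSpace (𝓡 m) x) :=
  inferInstanceAs (T2Space (EuclideanSpace ℝ (Fin m)))

theorem finrank_tangentSpace (x : M) : Module.finrank ℝ (TangentSpace (𝓡 m) x) = m :=
  finrank_euclideanSpace_fin (𝕜 := ℝ) (n := m)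

variable [IsManifold (𝓡 m) ∞ M]

/-- A smooth pseudo-Riemannian metric on the `m`-dimensional manifold `M` (on a connected manifold
its index is automatically constant). -/
structure PseudoRiemannianMetric (m : ℕ) (M : Type*) [TopologicalSpace M]
    [ChartedSpace (EuclideanSpace ℝ (Fin m)) M] [IsManifold (𝓡 m) ∞ M] where
  val : ∀ x : M, TangentSpace (𝓡 m) x →L[ℝ] TangentSpace (𝓡 m) x →L[ℝ] ℝ
  symm : ∀ (x : M) (v w : TangentSpace (𝓡 m) x), val x v w = val x w v
  nondegenerate : ∀ (x : M) (v : TangentSpace (𝓡 m) x), (∀ w, val x v w = 0) → v = 0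
  contMDiff : ContMDiff (𝓡 m)
    ((𝓡 m).prod 𝓘(ℝ, EuclideanSpace ℝ (Fin m) →L[ℝ] EuclideanSpace ℝ (Fin m) →L[ℝ] ℝ)) ∞
    (fun x ↦ TotalSpace.mk' (EuclideanSpace ℝ (Fin m) →L[ℝ] EuclideanSpace ℝ (Fin m) →L[ℝ] ℝ)
      x (val x))

variable (g : PseudoRiemannianMetric m M)

/-- The musical isomorphism `♭ : T_x M → T_x^* M`. -/
def flat (x : M) : TangentSpace (𝓡 m) x ≃ₗ[ℝ] Module.Dual ℝ (TangentSpace (𝓡 m) x) :=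
  LinearMap.linearEquivOfInjective
    (LinearMap.mk₂ ℝ (fun v w ↦ g.val x v w) (by simp) (by simp) (by simp) (by simp))
    ((injective_iff_map_eq_zero _).mpr fun v hv ↦
      g.nondegenerate x v fun w ↦ by simpa using LinearMap.congr_fun hv w)
    Subspace.dual_finrank_eq.symm

/-- The components of tangent vectors at `y` in the chart at `x`, for `y` in the domain of that
chart. -/
def inChart (x y : M) : TangentSpace (𝓡 m) y →L[ℝ] EuclideanSpace ℝ (Fin m) :=
  (trivializationAt (EuclideanSpace ℝ (Fin m)) (TangentSpace (𝓡 m)) x).continuousLinearMapAt ℝ y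

/-- The tangent vector at `y` with given components in the chart at `x`. -/
def ofChart (x y : M) : EuclideanSpace ℝ (Fin m) →L[ℝ] TangentSpace (𝓡 m) y :=
  (trivializationAt (EuclideanSpace ℝ (Fin m)) (TangentSpace (𝓡 m)) x).symmL ℝ y

theorem ofChart_inChart_self (x : M) (v : TangentSpace (𝓡 m) x) :
    ofChart x x (inChart x x v) = v :=
  Trivialization.symmL_continuousLinearMapAt _
    (FiberBundle.mem_baseSet_trivializationAt' x) v

/-- The components `g_{kl}` of the metric in the chart at `x`, as a function of the base point. -/
def metricInChart (x y : M) :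
    EuclideanSpace ℝ (Fin m) →L[ℝ] EuclideanSpace ℝ (Fin m) →L[ℝ] ℝ :=
  (LinearMap.mk₂ ℝ (fun u v ↦ g.val y (ofChart x y u) (ofChart x y v))
    (by simp) (by simp) (by simp) (by simp)).toContinuousBilinearMap

/-- The derivative `(∂_u g)(v, w)` at `x` of the components of the metric in the chart at `x`. -/
def dMetric (x : M) (u v w : TangentSpace (𝓡 m) x) : ℝ :=
  mvfderiv (𝓡 m) (metricInChart g x) x u (inChart x x v) (inChart x x w)

/-- The Christoffel symbols of the first kind,
`Γ(v, u; w) = (1/2) (∂_u g(v, w) + ∂_v g(u, w) - ∂_w g(u, v))`. -/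
def christoffelFirst (x : M) (v u w : TangentSpace (𝓡 m) x) : ℝ :=
  (1 / 2) * (dMetric g x u v w + dMetric g x v u w - dMetric g x w u v)

theorem dMetric_add₁ (x : M) (u u' v w : TangentSpace (𝓡 m) x) :
    dMetric g x (u + u') v w = dMetric g x u v w + dMetric g x u' v w := by
  unfold dMetric
  rw [(mvfderiv (𝓡 m) (metricInChart g x) x).map_add]
  rfl

theorem dMetric_smul₁ (x : M) (c : ℝ) (u v w : TangentSpace (𝓡 m) x) :
    dMetric g x (c • u) v w = c * dMetric g x u v w := by
  unfold dMetric
  rw [(mvfderiv (𝓡 m) (metricInChart g x) x).map_smul]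
  rfl

theorem dMetric_add₂ (x : M) (u v v' w : TangentSpace (𝓡 m) x) :
    dMetric g x u (v + v') w = dMetric g x u v w + dMetric g x u v' w := by
  unfold dMetric
  generalize mvfderiv (𝓡 m) (metricInChart g x) x u = A
  simp

theorem dMetric_smul₂ (x : M) (c : ℝ) (u v w : TangentSpace (𝓡 m) x) :
    dMetric g x u (c • v) w = c * dMetric g x u v w := by
  unfold dMetric
  generalize mvfderiv (𝓡 m) (metricInChart g x) x u = A
  simp

theorem dMetric_add₃ (x : M) (u v w w' : TangentSpace (𝓡 m) x) :
    dMetric g x u v (w + w') = dMetric g x u v w + dMetric g x u v w' := by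
  unfold dMetric
  generalize mvfderiv (𝓡 m) (metricInChart g x) x u = A
  simp

theorem dMetric_smul₃ (x : M) (c : ℝ) (u v w : TangentSpace (𝓡 m) x) :
    dMetric g x u v (c • w) = c * dMetric g x u v w := by
  unfold dMetric
  generalize mvfderiv (𝓡 m) (metricInChart g x) x u = A
  simp

/-- The Christoffel symbols of the first kind as a linear form in the last argument. -/
def christoffelForm (x : M) (v u : TangentSpace (𝓡 m) x) :
    Module.Dual ℝ (TangentSpace (𝓡 m) x) where
  toFun w := christoffelFirst g x v u w
  map_add' w w' := by
    simp only [christoffelFirst, dMetric_add₁, dMetric_add₃]; ring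
  map_smul' c w := by
    simp only [christoffelFirst, dMetric_smul₁, dMetric_smul₃, RingHom.id_apply, smul_eq_mul]; ring

/-- The Christoffel symbols `Γ(v, u)` at `x` in the chart at `x`. -/
def christoffel (x : M) :
    TangentSpace (𝓡 m) x →L[ℝ] TangentSpace (𝓡 m) x →L[ℝ] TangentSpace (𝓡 m) x :=
  (LinearMap.mk₂ ℝ (fun v u ↦ (flat g x).symm (christoffelForm g x v u))
    (fun v v' u ↦ by
      rw [← map_add]; congr 1; ext w
      simp only [christoffelForm, christoffelFirst, dMetric_add₁, dMetric_add₂, dMetric_add₃,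
        LinearMap.coe_mk, AddHom.coe_mk, LinearMap.add_apply]
      ring)
    (fun c v u ↦ by
      rw [← map_smul]; congr 1; ext w
      simp only [christoffelForm, christoffelFirst, dMetric_smul₁, dMetric_smul₂, dMetric_smul₃,
        LinearMap.coe_mk, AddHom.coe_mk, LinearMap.smul_apply, smul_eq_mul]
      ring)
    (fun v u u' ↦ by
      rw [← map_add]; congr 1; ext w
      simp only [christoffelForm, christoffelFirst, dMetric_add₁, dMetric_add₂,
        LinearMap.coe_mk, AddHom.coe_mk, LinearMap.add_apply]
      ring)
    (fun c v u ↦ by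
      rw [← map_smul]; congr 1; ext w
      simp only [christoffelForm, christoffelFirst, dMetric_smul₁, dMetric_smul₂,
        LinearMap.coe_mk, AddHom.coe_mk, LinearMap.smul_apply, smul_eq_mul]
      ring)).toContinuousBilinearMap

theorem mdifferentiableAt_inChart {σ : Π y : M, TangentSpace (𝓡 m) y} {x : M}
    (hσ : MDifferentiableAt (𝓡 m) ((𝓡 m).prod (𝓡 m))
      (fun y ↦ TotalSpace.mk' (EuclideanSpace ℝ (Fin m)) y (σ y)) x) :
    MDifferentiableAt (𝓡 m) (𝓡 m) (fun y ↦ inChart x y (σ y)) x := by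
  refine ((mdifferentiableAt_section _ σ).mp hσ).congr_of_eventuallyEq ?_
  filter_upwards [(trivializationAt (EuclideanSpace ℝ (Fin m)) (TangentSpace (𝓡 m))
    x).open_baseSet.mem_nhds (FiberBundle.mem_baseSet_trivializationAt' x)] with y hy
  exact Trivialization.continuousLinearMapAt_apply_of_mem (R := ℝ) _ hy _

/-- The Levi-Civita connection, given in the chart at `x` by `∇_u σ = ∂_u σ + Γ(σ, u)` at `x`. -/
def leviCivita :
    CovariantDerivative (𝓡 m) (EuclideanSpace ℝ (Fin m)) (TangentSpace (𝓡 m) : M → Type _) where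
  toFun σ x := ofChart x x ∘L mvfderiv (𝓡 m) (fun y ↦ inChart x y (σ y)) x +
    christoffel g x (σ x)
  isCovariantDerivativeOnUniv :=
    { add := fun {σ σ' x} hσ hσ' _ ↦ by
        have h := mvfderiv_fun_add (mdifferentiableAt_inChart hσ) (mdifferentiableAt_inChart hσ')
        ext1 u
        simp [h]
        abel
      leibniz := fun {σ f x} hσ hf _ ↦ by
        have h := mvfderiv_fun_smul hf (mdifferentiableAt_inChart hσ)
        ext1 u
        simp [h, ofChart_inChart_self]
        module }

/-- The Riemannian density `|det g_{kl}|^{1/2}` at `y` in the chart at `x`. -/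
def density (x y : M) : ℝ :=
  Real.sqrt |(Matrix.of fun k l : Fin m ↦ metricInChart g x y
    (EuclideanSpace.single k 1) (EuclideanSpace.single l 1)).det|

/-- The measure `|det g_{kl}|^{1/2} dx¹ ⋯ dxᵐ` on the domain of the chart at `x`. -/
def chartVolume [MeasurableSpace M] (x : M) : Measure M :=
  ((volume.restrict (chartAt (EuclideanSpace ℝ (Fin m)) x).target).withDensity fun z ↦
    ENNReal.ofReal (density g x ((chartAt (EuclideanSpace ℝ (Fin m)) x).symm z))).map
      (chartAt (EuclideanSpace ℝ (Fin m)) x).symm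

theorem exists_chart_cover (m : ℕ) (M : Type*) [TopologicalSpace M]
    [ChartedSpace (EuclideanSpace ℝ (Fin m)) M] [SecondCountableTopology M] [Nonempty M] :
    ∃ u : ℕ → M, ⋃ k, (chartAt (EuclideanSpace ℝ (Fin m)) (u k)).source = univ := by
  obtain ⟨s, hs, hu⟩ := TopologicalSpace.countable_cover_nhds
    (f := fun x : M ↦ (chartAt (EuclideanSpace ℝ (Fin m)) x).source)
    (fun x ↦ (chartAt _ x).open_source.mem_nhds (mem_chart_source _ x))
  have hne : s.Nonempty := by
    by_contra h
    rw [not_nonempty_iff_eq_empty] at h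
    subst h
    exact (univ_nonempty (α := M)).ne_empty (by simpa using hu.symm)
  obtain ⟨u, rfl⟩ := hs.exists_eq_range hne
  exact ⟨u, by simpa using hu⟩

/-- The volume measure `d vol_g` of the metric `g`: the domains of countably many charts that
cover `M` are made disjoint, and on each piece the measure is
`|det g_{kl}|^{1/2} dx¹ ⋯ dxᵐ`. (By the change of variables formula the result does not depend on
the choice of the charts.) -/
def volumeMeasure [SecondCountableTopology M] [Nonempty M] [MeasurableSpace M] : Measure M :=
  let u : ℕ → M := (exists_chart_cover m M).choose
  Measure.sum fun k ↦ (chartVolume g (u k)).restrict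
    (disjointed (fun j ↦ (chartAt (EuclideanSpace ℝ (Fin m)) (u j)).source) k)

end Metric

/-! ### Curvature and contorsion -/

section Connection

variable {m : ℕ} {M : Type*} [TopologicalSpace M] [ChartedSpace (EuclideanSpace ℝ (Fin m)) M]
  [IsManifold (𝓡 m) ∞ M]

/-- A vector field that is smooth near `x` and extends the tangent vector `v` at `x`. -/
def localExt {x : M} (v : TangentSpace (𝓡 m) x) (y : M) : TangentSpace (𝓡 m) y :=
  FiberBundle.extend (EuclideanSpace ℝ (Fin m)) v y

/-- The curvature tensor `R_{X,Y} Z = ∇_Y ∇_X Z - ∇_X ∇_Y Z + ∇_{[X,Y]} Z` of an affine connection,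
at tangent vectors at `x`. With `cov`, `∇_X Z` at `y` is written `cov Z y (X y)`. -/
def curvature
    (cov : CovariantDerivative (𝓡 m) (EuclideanSpace ℝ (Fin m)) (TangentSpace (𝓡 m) : M → Type _))
    (x : M) (u v w : TangentSpace (𝓡 m) x) : TangentSpace (𝓡 m) x :=
  cov (fun y ↦ cov (localExt w) y (localExt u y)) x v - cov (fun y ↦ cov (localExt w) y (localExt v y)) x u +
    cov (localExt w) x (VectorField.mlieBracket (𝓡 m) (localExt u) (localExt v) x)

/-- The value at `x` of a (1,2)-tensor field, `T X Y` being written `𝔗_X Y` on paper. -/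
abbrev Tensor12 (x : M) : Type :=
  TangentSpace (𝓡 m) x →L[ℝ] TangentSpace (𝓡 m) x →L[ℝ] TangentSpace (𝓡 m) x

/-- The connection `∇ + 𝔗` with contorsion tensor `𝔗`, where `∇` is the Levi-Civita connection:
`X, Y ↦ ∇_X Y + 𝔗_X Y`. -/
def connectionOf (g : PseudoRiemannianMetric m M) (T : Π x : M, Tensor12 (m := m) x) :
    CovariantDerivative (𝓡 m) (EuclideanSpace ℝ (Fin m)) (TangentSpace (𝓡 m) : M → Type _) :=
  (leviCivita g).addOneForm fun x ↦
    (LinearMap.mk₂ ℝ (fun Y X ↦ T x X Y)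
      (fun Y Y' X ↦ (T x X).map_add Y Y') (fun c Y X ↦ (T x X).map_smul c Y)
      (fun Y X X' ↦ by rw [(T x).map_add]; rfl)
      (fun c Y X ↦ by rw [(T x).map_smul]; rfl)).toContinuousBilinearMap

/-- The contorsion tensor `𝔗_X Y = ⟨U, Y⟩ X - ⟨X, Y⟩ U` of the semi-symmetric connection
given by the vector field `U`. -/
def semiSymmetricContorsion (g : PseudoRiemannianMetric m M) (U : Π x : M, TangentSpace (𝓡 m) x)
    (x : M) : Tensor12 (m := m) x :=
  (LinearMap.mk₂ ℝ (fun X Y ↦ g.val x (U x) Y • X - g.val x X Y • U x)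
    (by intros; simp; module) (by intros; simp; module) (by intros; simp; module)
    (by intros; simp; module)).toContinuousBilinearMap

/-- The total space of the bundle of (1,2)-tensors on `M`. -/
abbrev Tensor12Bundle (m : ℕ) (M : Type*) [TopologicalSpace M]
    [ChartedSpace (EuclideanSpace ℝ (Fin m)) M] : Type _ :=
  TotalSpace (EuclideanSpace ℝ (Fin m) →L[ℝ] EuclideanSpace ℝ (Fin m) →L[ℝ]
    EuclideanSpace ℝ (Fin m)) (fun x : M ↦ Tensor12 (m := m) x)

/-- A matter Lagrangian (for a fixed metric): a smooth function of a point and of the value of the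
contorsion tensor at that point. -/
def IsLagrangian (L : Tensor12Bundle m M → ℝ) : Prop :=
  ContMDiff ((𝓡 m).prod 𝓘(ℝ, EuclideanSpace ℝ (Fin m) →L[ℝ] EuclideanSpace ℝ (Fin m) →L[ℝ]
    EuclideanSpace ℝ (Fin m))) 𝓘(ℝ, ℝ) ∞ L

end Connection

/-! ### Distributions -/

section Distribution

variable {n p : ℕ} {M : Type*} [TopologicalSpace M]
  [ChartedSpace (EuclideanSpace ℝ (Fin (n + p))) M] [IsManifold (𝓡 (n + p)) ∞ M]

/-- A smooth distribution of rank `n` on the pseudo-Riemannian manifold `(M, g)` of dimension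
`n + p`, on which `g` is nondegenerate. -/
structure NondegenerateDistribution (g : PseudoRiemannianMetric (n + p) M) where
  space : ∀ x : M, Submodule ℝ (TangentSpace (𝓡 (n + p)) x)
  finrank_space : ∀ x, Module.finrank ℝ (space x) = n
  smooth : ∀ x : M, ∃ (V : Set M) (X : Fin n → Π y : M, TangentSpace (𝓡 (n + p)) y),
    IsOpen V ∧ x ∈ V ∧
    (∀ a, ContMDiffOn (𝓡 (n + p)) (𝓡 (n + p)).tangent ∞
      (fun y ↦ TotalSpace.mk' (EuclideanSpace ℝ (Fin (n + p))) y (X a y)) V) ∧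
    ∀ y ∈ V, space y = Submodule.span ℝ (range fun a ↦ X a y)
  nondegenerate : ∀ x, ∀ v ∈ space x, (∀ w ∈ space x, g.val x v w = 0) → v = 0

variable {g : PseudoRiemannianMetric (n + p) M} (D : NondegenerateDistribution g)

/-- The metric at `x` as a bilinear form. -/
def bilinForm (g : PseudoRiemannianMetric (n + p) M) (x : M) :
    LinearMap.BilinForm ℝ (TangentSpace (𝓡 (n + p)) x) :=
  LinearMap.mk₂ ℝ (fun v w ↦ g.val x v w) (by simp) (by simp) (by simp) (by simp)

namespace NondegenerateDistribution

/-- The `g`-orthogonal complement of the distribution. -/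
def perp (x : M) : Submodule ℝ (TangentSpace (𝓡 (n + p)) x) :=
  (bilinForm g x).orthogonal (D.space x)

theorem mem_perp {x : M} {v : TangentSpace (𝓡 (n + p)) x} :
    v ∈ D.perp x ↔ ∀ w ∈ D.space x, g.val x w v = 0 := Iff.rfl

theorem isCompl (x : M) : IsCompl (D.space x) (D.perp x) := by
  refine LinearMap.BilinForm.isCompl_orthogonal_of_restrict_nondegenerate
    (fun v w h ↦ by simpa [bilinForm, g.symm x w v] using h) ?_
  refine ⟨fun v hv ↦ Subtype.ext (D.nondegenerate x v v.2 fun w hw ↦ hv ⟨w, hw⟩),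
    fun v hv ↦ Subtype.ext (D.nondegenerate x v v.2 fun w hw ↦ ?_)⟩
  exact (g.symm x v w).trans (hv ⟨w, hw⟩)

theorem perp_nondegenerate (x : M) (v : TangentSpace (𝓡 (n + p)) x) (hv : v ∈ D.perp x)
    (h : ∀ w ∈ D.perp x, g.val x v w = 0) : v = 0 := by
  refine g.nondegenerate x v fun w ↦ ?_
  obtain ⟨a, ha, b, hb, rfl⟩ := Submodule.mem_sup.mp
    ((D.isCompl x).sup_eq_top ▸ Submodule.mem_top : w ∈ D.space x ⊔ D.perp x)
  rw [map_add, h b hb, g.symm, D.mem_perp.mp hv a ha, add_zero]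

theorem finrank_perp (x : M) : Module.finrank ℝ (D.perp x) = p := by
  have h := Submodule.finrank_add_eq_of_isCompl (D.isCompl x)
  rw [D.finrank_space, finrank_tangentSpace] at h
  omega

/-- The projection `X ↦ X^⊤` onto the distribution along its orthogonal complement. -/
def top (x : M) : TangentSpace (𝓡 (n + p)) x →ₗ[ℝ] TangentSpace (𝓡 (n + p)) x :=
  Submodule.projection (D.space x) (D.perp x) (D.isCompl x)

/-- The projection `X ↦ X^⊥` onto the orthogonal complement of the distribution. -/
def bot (x : M) : TangentSpace (𝓡 (n + p)) x →ₗ[ℝ] TangentSpace (𝓡 (n + p)) x :=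
  Submodule.projection (D.perp x) (D.space x) (D.isCompl x).symm

end NondegenerateDistribution

/-- An adapted orthonormal frame `{E_a, 𝓔_i}` at `x`: `E_a` is `vec (Sum.inl a)`, `𝓔_i` is
`vec (Sum.inr i)`. -/
structure AdaptedFrame (D : NondegenerateDistribution g) (x : M) where
  vec : Fin n ⊕ Fin p → TangentSpace (𝓡 (n + p)) x
  vec_inl_mem : ∀ a, vec (Sum.inl a) ∈ D.space x
  vec_inr_mem : ∀ i, vec (Sum.inr i) ∈ D.perp x
  sign : ∀ l, g.val x (vec l) (vec l) = 1 ∨ g.val x (vec l) (vec l) = -1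
  orthogonal : ∀ k l, k ≠ l → g.val x (vec k) (vec l) = 0

theorem nonempty_adaptedFrame (x : M) : Nonempty (AdaptedFrame D x) := by
  obtain ⟨e, he, he'⟩ := exists_orthonormal ((bilinForm g x).restrict (D.space x))
    (fun v w ↦ g.symm x v w)
    (fun v hv ↦ Subtype.ext (D.nondegenerate x v v.2 fun w hw ↦ hv ⟨w, hw⟩)) (D.finrank_space x)
  obtain ⟨f, hf, hf'⟩ := exists_orthonormal ((bilinForm g x).restrict (D.perp x))
    (fun v w ↦ g.symm x v w)
    (fun v hv ↦ Subtype.ext (D.perp_nondegenerate x v v.2 fun w hw ↦ hv ⟨w, hw⟩))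
    (D.finrank_perp x)
  refine ⟨⟨Sum.elim (fun a ↦ (e a : TangentSpace (𝓡 (n + p)) x)) (fun i ↦ f i),
    fun a ↦ (e a).2, fun i ↦ (f i).2, ?_, ?_⟩⟩
  · rintro (a | i)
    · exact he a
    · exact hf i
  · rintro (a | i) (b | j) h
    · exact he' a b fun h' ↦ h (by rw [h'])
    · exact D.mem_perp.mp (f j).2 _ (e a).2
    · exact (g.symm x _ _).trans (D.mem_perp.mp (f i).2 _ (e b).2)
    · exact hf' i j fun h' ↦ h (by rw [h'])

/-- A chosen adapted orthonormal frame at `x`; none of the quantities defined with it depends on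
the choice. -/
def frame (x : M) : AdaptedFrame D x := (nonempty_adaptedFrame D x).some

/-- The vectors `E_a` of the frame, spanning the distribution. -/
def frameTop (x : M) (a : Fin n) : TangentSpace (𝓡 (n + p)) x := (frame D x).vec (Sum.inl a)

/-- The vectors `𝓔_i` of the frame, spanning the orthogonal complement. -/
def frameBot (x : M) (i : Fin p) : TangentSpace (𝓡 (n + p)) x := (frame D x).vec (Sum.inr i)

/-- The sign `⟨v, v⟩` of a vector of an orthonormal frame. -/
def eps (g : PseudoRiemannianMetric (n + p) M) {x : M} (v : TangentSpace (𝓡 (n + p)) x) : ℝ :=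
  g.val x v v

/-- The mixed scalar curvature of the connection `cov`,
`(1/2) ∑_{a,i} ε_a ε_i (⟨R_{E_a,𝓔_i} E_a, 𝓔_i⟩ + ⟨R_{𝓔_i,E_a} 𝓔_i, E_a⟩)`. -/
def mixedScalarCurvature (cov : CovariantDerivative (𝓡 (n + p)) (EuclideanSpace ℝ (Fin (n + p)))
    (TangentSpace (𝓡 (n + p)) : M → Type _)) (x : M) : ℝ :=
  (1 / 2) * ∑ a, ∑ i, eps g (frameTop D x a) * eps g (frameBot D x i) *
    (g.val x (curvature cov x (frameTop D x a) (frameBot D x i) (frameTop D x a)) (frameBot D x i) +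
      g.val x (curvature cov x (frameBot D x i) (frameTop D x a) (frameBot D x i))
        (frameTop D x a))

/-- The second fundamental form `h(X, Y) = (1/2) (∇_X Y + ∇_Y X)^⊥` of the distribution, at the
`⊤`-components of tangent vectors at `x` (`∇` is the Levi-Civita connection). -/
def secondFundamentalForm (x : M) (u v : TangentSpace (𝓡 (n + p)) x) :
    TangentSpace (𝓡 (n + p)) x :=
  (1 / 2 : ℝ) • D.bot x (leviCivita g (fun y ↦ D.top y (localExt v y)) x (D.top x u) +
    leviCivita g (fun y ↦ D.top y (localExt u y)) x (D.top x v))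

/-- The second fundamental form `h̃(X, Y) = (1/2) (∇_X Y + ∇_Y X)^⊤` of the orthogonal complement of
the distribution, at the `⊥`-components of tangent vectors at `x`. -/
def secondFundamentalFormPerp (x : M) (u v : TangentSpace (𝓡 (n + p)) x) :
    TangentSpace (𝓡 (n + p)) x :=
  (1 / 2 : ℝ) • D.top x (leviCivita g (fun y ↦ D.bot y (localExt v y)) x (D.bot x u) +
    leviCivita g (fun y ↦ D.bot y (localExt u y)) x (D.bot x v))

/-- The mean curvature vector `H = ∑_a ε_a h(E_a, E_a)` of the distribution. -/
def meanCurvature (x : M) : TangentSpace (𝓡 (n + p)) x :=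
  ∑ a, eps g (frameTop D x a) • secondFundamentalForm D x (frameTop D x a) (frameTop D x a)

/-- The mean curvature vector `H̃ = ∑_i ε_i h̃(𝓔_i, 𝓔_i)` of the orthogonal complement of the
distribution. -/
def meanCurvaturePerp (x : M) : TangentSpace (𝓡 (n + p)) x :=
  ∑ i, eps g (frameBot D x i) • secondFundamentalFormPerp D x (frameBot D x i) (frameBot D x i)

/-! ### The spin tensor -/

/-- The decomposable (1,2)-tensor `ξ, η ↦ ⟨X, ξ⟩ ⟨Y, η⟩ Z`. -/
def elementaryTensor (g : PseudoRiemannianMetric (n + p) M) {x : M}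
    (X Y Z : TangentSpace (𝓡 (n + p)) x) : Tensor12 (m := n + p) x :=
  (g.val x X).smulRight ((g.val x Y).smulRight Z)

/-- The spin tensor `s = 2 ∂𝓛/∂𝔗` at `x`, characterised by
`⟨s(X, Y), Z⟩ = 2 d/dt|₀ 𝓛(𝔗 + t X^♭ ⊗ Y^♭ ⊗ Z)` and expanded in the adapted frame. -/
def spinTensor (L : Tensor12Bundle (n + p) M → ℝ) (T : Π x : M, Tensor12 (m := n + p) x) (x : M)
    (X Y : TangentSpace (𝓡 (n + p)) x) : TangentSpace (𝓡 (n + p)) x :=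
  ∑ l, (eps g ((frame D x).vec l) *
    (2 * deriv (fun t : ℝ ↦ L ⟨x, T x + t • elementaryTensor g X Y ((frame D x).vec l)⟩) 0)) •
      (frame D x).vec l

/-- The contraction `s(·,·)` of the spin tensor that pairs with semi-symmetric variations of the
contorsion: `⟨s(·,·), W⟩ = ∑_l ε_l (⟨s(e_l, e_l), W⟩ - ⟨s(e_l, W), e_l⟩)`. -/
def spinVector (L : Tensor12Bundle (n + p) M → ℝ) (T : Π x : M, Tensor12 (m := n + p) x) (x : M) :
    TangentSpace (𝓡 (n + p)) x :=
  ∑ l, eps g ((frame D x).vec l) •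
    (spinTensor D L T x ((frame D x).vec l) ((frame D x).vec l) -
      ∑ k, (eps g ((frame D x).vec k) *
        g.val x (spinTensor D L T x ((frame D x).vec l) ((frame D x).vec k)) ((frame D x).vec l)) •
          (frame D x).vec k)

/-! ### The action and its critical points -/

variable [SecondCountableTopology M] [Nonempty M] [MeasurableSpace M]

/-- The mixed Einstein-Hilbert action over `Ω`,
`∫_Ω ((1 / 2𝔞) (S̄_mix - 2Λ) + 𝓛) d vol_g`, as a function of the contorsion tensor. -/
def mixedAction (a Λ : ℝ) (L : Tensor12Bundle (n + p) M → ℝ) (Ω : Set M)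
    (T : Π x : M, Tensor12 (m := n + p) x) : ℝ :=
  ∫ x in Ω, (1 / (2 * a) * (mixedScalarCurvature D (connectionOf g T) x - 2 * Λ) + L ⟨x, T x⟩)
    ∂(volumeMeasure g)

/-- The semi-symmetric connection given by `U` is critical for the mixed Einstein-Hilbert action
with fixed metric among all semi-symmetric connections: for every relatively compact open set `Ω`
and every smooth family `U_t`, `|t| < ε`, with `U_0 = U`, that equals `U` outside a compact subset
of `Ω`, the action over `Ω` has derivative zero at `t = 0`. -/
def IsCriticalAmongSemiSymmetric (a Λ : ℝ) (L : Tensor12Bundle (n + p) M → ℝ)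
    (U : Π x : M, TangentSpace (𝓡 (n + p)) x) : Prop :=
  ∀ (Ω : Set M) (ε : ℝ) (W : ℝ → Π x : M, TangentSpace (𝓡 (n + p)) x),
    IsOpen Ω → IsCompact (closure Ω) → 0 < ε →
    ContMDiffOn (𝓘(ℝ, ℝ).prod (𝓡 (n + p))) (𝓡 (n + p)).tangent ∞
      (fun q : ℝ × M ↦ TotalSpace.mk' (EuclideanSpace ℝ (Fin (n + p))) q.2 (W q.1 q.2))
      (Ioo (-ε) ε ×ˢ univ) →
    W 0 = U →
    (∃ K ⊆ Ω, IsCompact K ∧ ∀ t ∈ Ioo (-ε) ε, ∀ x ∉ K, W t x = U x) →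
    HasDerivAt (fun t ↦ mixedAction D a Λ L Ω (semiSymmetricContorsion g (W t))) 0 0

end Distribution

end MixedEH

end

noncomputable section

set_option synthInstance.maxHeartbeats 400000

namespace MixedEH

/-! ### Smooth vector fields along maps -/

/-! For a semi-symmetric contorsion the curvature is explicit: it is the Levi-Civita curvature plus
terms that are linear in `∇U` or quadratic in `U` (`curvature_semiSymmetric`). Contracting over an
adapted frame, the mixed scalar curvature drops by `p tr_⊤ ∇U + n tr_⊥ ∇U + p(n-1)⟨U^⊤,U^⊤⟩ +
n(p-1)⟨U^⊥,U^⊥⟩` (`mixedScalarCurvature_semiSymmetric`). Differentiating the orthogonality of the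
two distributions gives `tr_⊤ ∇(V^⊥) = -⟨H,V⟩` and `tr_⊥ ∇(V^⊤) = -⟨H̃,V⟩`, so the weighted trace of
`∇U` equals `div(pU^⊤ + nU^⊥) + (p-n)⟨H̃ - H, U⟩` (`traceTop_traceBot_leviCivita`).

The integrand of the action is therefore a term independent of `U`, a multiple of a divergence, and
a function `potential` of the value of `U` alone (`integrand_eq`). Replacing `U` by a field equal to
it off a compact subset of `Ω` changes the divergence term by the divergence of a compactly
supported field, which integrates to zero (`integral_divergence_eq_zero`). What is left involves no
derivative of `U`, so it can be differentiated under the integral sign. The derivative of `𝓛` in the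
direction of the semi-symmetric tensor of `V` is `-(1/2)⟨s(·,·),V⟩` (`val_spinVector`), and the
first variation becomes `-(1/2𝔞) ∫ ⟨E,V⟩` with `V` the velocity of the family and `E = eulerField`
(`hasDerivAt_mixedAction`). The `⊤`- and `⊥`-components of `E = 0` are the two stated equations
(`eulerField_eq_zero_iff`).

If `E = 0` the variation vanishes. For the converse the metric is indefinite, so `⟨E, ρE⟩` need not
have a sign; the test field is `ρ ∑ ⟨E,∂_k⟩ ∂_k`, whose product with `E` is `ρ` times a sum of
squares (`eulerField_eq_zero_of_isCritical`). For `n = p = 1` all geometric coefficients vanish and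
only the spin remains.

The supporting work is of two kinds. The connection, the frames and the curvature are defined point
by point, with charts, frames and extensions chosen at each point. Their smooth dependence on the
point is recovered from the Koszul formula, from contractions with coordinate fields and their
duals, and from tensoriality. The divergence theorem rests on the coordinate formula for the
divergence and on the independence of the Riemannian density from the chart. -/

/-- The domain of the chart at `x`. -/
abbrev dom (m : ℕ) {M : Type*} [TopologicalSpace M] [ChartedSpace (EuclideanSpace ℝ (Fin m)) M]
    (x : M) : Set M := (chartAt (EuclideanSpace ℝ (Fin m)) x).source

theorem dom_mem_nhds {m : ℕ} {M : Type*} [TopologicalSpace M]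
    [ChartedSpace (EuclideanSpace ℝ (Fin m)) M] {x y : M} (hy : y ∈ dom m x) : dom m x ∈ 𝓝 y :=
  (chartAt (EuclideanSpace ℝ (Fin m)) x).open_source.mem_nhds hy


section Along

variable {m : ℕ} {M : Type*} [TopologicalSpace M] [ChartedSpace (EuclideanSpace ℝ (Fin m)) M]
  [IsManifold (𝓡 m) ∞ M]
  {EN : Type*} [NormedAddCommGroup EN] [NormedSpace ℝ EN] {HN : Type*} [TopologicalSpace HN]
  (J : ModelWithCorners ℝ EN HN) {N : Type*} [TopologicalSpace N] [ChartedSpace HN N]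

/-- Smoothness at a point of a vector field along a map `b : N → M`. -/
abbrev SmoothAlong (b : N → M) (v : Π q : N, TangentSpace (𝓡 m) (b q)) (q : N) : Prop :=
  ContMDiffAt J (𝓡 m).tangent ∞
    (fun q ↦ TotalSpace.mk' (EuclideanSpace ℝ (Fin m)) (b q) (v q)) q

/-- Smoothness of a vector field at a point. -/
abbrev SmoothAt (X : Π y : M, TangentSpace (𝓡 m) y) (x : M) : Prop :=
  ContMDiffAt (𝓡 m) (𝓡 m).tangent ∞
    (fun y ↦ TotalSpace.mk' (EuclideanSpace ℝ (Fin m)) y (X y)) x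

/-- Differentiability of a vector field at a point. -/
abbrev DiffAt (X : Π y : M, TangentSpace (𝓡 m) y) (x : M) : Prop :=
  MDifferentiableAt (𝓡 m) (𝓡 m).tangent
    (fun y ↦ TotalSpace.mk' (EuclideanSpace ℝ (Fin m)) y (X y)) x

theorem ofChart_inChart {x y : M} (hy : y ∈ dom m x) (v : TangentSpace (𝓡 m) y) :
    ofChart x y (inChart x y v) = v :=
  Trivialization.symmL_continuousLinearMapAt _ hy v

theorem inChart_ofChart {x y : M} (hy : y ∈ dom m x) (u : EuclideanSpace ℝ (Fin m)) :
    inChart x y (ofChart x y u) = u :=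
  Trivialization.continuousLinearMapAt_symmL _ hy u

variable {J}

/-- The trivialization over any chart whose domain contains `b q₀` detects smoothness. This turns a
statement about a section into one about a map to a fixed vector space, where sums and products are
immediate. -/
theorem smoothAlong_iff {b : N → M} {v : Π q : N, TangentSpace (𝓡 m) (b q)} {q₀ : N} {x : M}
    (hx : b q₀ ∈ dom m x) :
    SmoothAlong J b v q₀ ↔ ContMDiffAt J (𝓡 m) ∞ b q₀ ∧
      ContMDiffAt J (𝓡 m) ∞ (fun q ↦ inChart x (b q) (v q)) q₀ := by
  unfold SmoothAlong
  have h := (trivializationAt (EuclideanSpace ℝ (Fin m))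
    (TangentSpace (𝓡 m)) x).contMDiffAt_iff (IM := J) (IB := 𝓡 m) (n := ∞)
    (f := fun q ↦ TotalSpace.mk' (EuclideanSpace ℝ (Fin m)) (b q) (v q)) (x₀ := q₀)
    ((Trivialization.mem_source _).mpr hx)
  rw [ModelWithCorners.tangent, h]
  refine and_congr_right fun hb ↦ Filter.EventuallyEq.contMDiffAt_iff ?_
  filter_upwards [hb.continuousAt.preimage_mem_nhds (dom_mem_nhds hx)] with q hq
  exact (Trivialization.continuousLinearMapAt_apply_of_mem (R := ℝ) _ hq _).symm

theorem SmoothAlong.base {b : N → M} {v : Π q : N, TangentSpace (𝓡 m) (b q)} {q₀ : N}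
    (h : SmoothAlong J b v q₀) : ContMDiffAt J (𝓡 m) ∞ b q₀ :=
  ((smoothAlong_iff (mem_chart_source _ (b q₀))).mp h).1

theorem SmoothAlong.inChart {b : N → M} {v : Π q : N, TangentSpace (𝓡 m) (b q)} {q₀ : N}
    (h : SmoothAlong J b v q₀) {x : M} (hx : b q₀ ∈ dom m x) :
    ContMDiffAt J (𝓡 m) ∞ (fun q ↦ inChart x (b q) (v q)) q₀ :=
  ((smoothAlong_iff hx).mp h).2

theorem smoothAlong_ofChart {b : N → M} {u : N → EuclideanSpace ℝ (Fin m)} {q₀ : N} {x : M}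
    (hx : b q₀ ∈ dom m x) (hb : ContMDiffAt J (𝓡 m) ∞ b q₀) (hu : ContMDiffAt J (𝓡 m) ∞ u q₀) :
    SmoothAlong J b (fun q ↦ ofChart x (b q) (u q)) q₀ := by
  refine (smoothAlong_iff hx).mpr ⟨hb, hu.congr_of_eventuallyEq ?_⟩
  filter_upwards [hb.continuousAt.preimage_mem_nhds (dom_mem_nhds hx)] with q hq
  exact inChart_ofChart hq _

theorem SmoothAlong.add {b : N → M} {v w : Π q : N, TangentSpace (𝓡 m) (b q)} {q₀ : N}
    (hv : SmoothAlong J b v q₀) (hw : SmoothAlong J b w q₀) :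
    SmoothAlong J b (fun q ↦ v q + w q) q₀ := by
  have h := mem_chart_source (EuclideanSpace ℝ (Fin m)) (b q₀)
  refine (smoothAlong_iff h).mpr ⟨hv.base, ?_⟩
  simpa using! (hv.inChart h).add (hw.inChart h)

theorem SmoothAlong.smul {b : N → M} {f : N → ℝ} {v : Π q : N, TangentSpace (𝓡 m) (b q)} {q₀ : N}
    (hf : ContMDiffAt J 𝓘(ℝ, ℝ) ∞ f q₀) (hv : SmoothAlong J b v q₀) :
    SmoothAlong J b (fun q ↦ f q • v q) q₀ := by
  have h := mem_chart_source (EuclideanSpace ℝ (Fin m)) (b q₀)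
  refine (smoothAlong_iff h).mpr ⟨hv.base, ?_⟩
  simpa using! hf.smul (hv.inChart h)

theorem SmoothAlong.const_smul {b : N → M} (c : ℝ) {v : Π q : N, TangentSpace (𝓡 m) (b q)} {q₀ : N}
    (hv : SmoothAlong J b v q₀) : SmoothAlong J b (fun q ↦ c • v q) q₀ :=
  SmoothAlong.smul contMDiffAt_const hv

theorem SmoothAlong.sub {b : N → M} {v w : Π q : N, TangentSpace (𝓡 m) (b q)} {q₀ : N}
    (hv : SmoothAlong J b v q₀) (hw : SmoothAlong J b w q₀) :
    SmoothAlong J b (fun q ↦ v q - w q) q₀ := by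
  have h := mem_chart_source (EuclideanSpace ℝ (Fin m)) (b q₀)
  refine (smoothAlong_iff h).mpr ⟨hv.base, ?_⟩
  simpa using! (hv.inChart h).sub (hw.inChart h)

theorem smoothAlong_sum {ι : Type*} (s : Finset ι) {b : N → M}
    {v : ι → Π q : N, TangentSpace (𝓡 m) (b q)} {q₀ : N} (hb : ContMDiffAt J (𝓡 m) ∞ b q₀)
    (hv : ∀ i ∈ s, SmoothAlong J b (v i) q₀) : SmoothAlong J b (fun q ↦ ∑ i ∈ s, v i q) q₀ := by
  have h := mem_chart_source (EuclideanSpace ℝ (Fin m)) (b q₀)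
  refine (smoothAlong_iff h).mpr ⟨hb, ?_⟩
  simp only [map_sum]
  exact contMDiffAt_finsetSum fun i hi ↦ (hv i hi).inChart h

theorem SmoothAt.comp {X : Π y : M, TangentSpace (𝓡 m) y} {b : N → M} {q₀ : N}
    (hX : SmoothAt X (b q₀)) (hb : ContMDiffAt J (𝓡 m) ∞ b q₀) :
    SmoothAlong J b (fun q ↦ X (b q)) q₀ :=
  ContMDiffAt.comp q₀ hX hb

theorem SmoothAt.diffAt {X : Π y : M, TangentSpace (𝓡 m) y} {x : M} (hX : SmoothAt X x) :
    DiffAt X x :=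
  hX.mdifferentiableAt (by simp)

/-- Finite-order differentiability at a point spreads to a neighbourhood, so one passes to order 1
first. Iterated covariant derivatives need the inner one to obey the calculus rules near `x`, not
only at `x`. -/
theorem SmoothAt.eventually_diffAt {X : Π y : M, TangentSpace (𝓡 m) y} {x : M}
    (hX : SmoothAt X x) : ∀ᶠ y in 𝓝 x, DiffAt X y := by
  have h : ContMDiffAt (𝓡 m) (𝓡 m).tangent 1
    (fun y ↦ TotalSpace.mk' (EuclideanSpace ℝ (Fin m)) y (X y)) x := hX.of_le (by simp)
  filter_upwards [(contMDiffAt_iff_contMDiffAt_nhds (by simp)).mp h] with y hy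
  exact hy.mdifferentiableAt (by simp)

theorem smoothAt_ofChart {x y : M} (hy : y ∈ dom m x) (u : EuclideanSpace ℝ (Fin m)) :
    SmoothAt (fun z ↦ ofChart x z u) y :=
  smoothAlong_ofChart hy contMDiffAt_id contMDiffAt_const

/-- In the chart at `x` the chosen extension has constant components, so such extensions commute
under the Lie bracket. -/
theorem localExt_apply {x y : M} (hy : y ∈ dom m x) (v : TangentSpace (𝓡 m) x) :
    localExt v y = ofChart x y (inChart x x v) := by
  simp only [localExt, FiberBundle.extend, ofChart, inChart]
  rw [Trivialization.continuousLinearMapAt_apply_of_mem (R := ℝ) _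
    (FiberBundle.mem_baseSet_trivializationAt' x)]
  exact (Trivialization.symmL_apply _ hy _).symm

theorem smoothAt_localExt {x : M} (v : TangentSpace (𝓡 m) x) : SmoothAt (localExt v) x :=
  FiberBundle.contMDiffAt_extend (𝓡 m) (EuclideanSpace ℝ (Fin m)) v

@[simp]
theorem localExt_self {x : M} (v : TangentSpace (𝓡 m) x) : localExt v x = v :=
  FiberBundle.extend_apply_self (EuclideanSpace ℝ (Fin m)) v

/-- The derivative of a smooth function in the direction of a smooth vector field is smooth. -/
theorem contMDiffAt_mvfderiv_apply {f : M → ℝ} {X : Π y : M, TangentSpace (𝓡 m) y} {x : M}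
    (hf : ContMDiffAt (𝓡 m) 𝓘(ℝ, ℝ) ∞ f x) (hX : SmoothAt X x) :
    ContMDiffAt (𝓡 m) 𝓘(ℝ, ℝ) ∞ (fun y ↦ mvfderiv (𝓡 m) f y (X y)) x := by
  have : IsManifold (𝓡 m) 1 M := inferInstance
  have h := ContMDiffAt.mfderiv_const (m := ∞) hf (by simp)
  have h2 := ContMDiffAt.clm_apply_of_inCoordinates (b₁ := id) (b₂ := f) (n := ∞) h hX hf
  rw [contMDiffAt_totalSpace] at h2
  simpa [mvfderiv] using! h2.2

end Along

/-! ### The Levi-Civita connection -/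

section LeviCivita

variable {m : ℕ} {M : Type*} [TopologicalSpace M] [ChartedSpace (EuclideanSpace ℝ (Fin m)) M]
  [IsManifold (𝓡 m) ∞ M]
  {EN : Type*} [NormedAddCommGroup EN] [NormedSpace ℝ EN] {HN : Type*} [TopologicalSpace HN]
  {J : ModelWithCorners ℝ EN HN} {N : Type*} [TopologicalSpace N] [ChartedSpace HN N]
  (g : PseudoRiemannianMetric m M)

theorem contMDiffAt_metric {b : N → M} {v w : Π q : N, TangentSpace (𝓡 m) (b q)} {q₀ : N}
    (hv : SmoothAlong J b v q₀) (hw : SmoothAlong J b w q₀) :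
    ContMDiffAt J 𝓘(ℝ, ℝ) ∞ (fun q ↦ g.val (b q) (v q) (w q)) q₀ := by
  have hg := ContMDiffAt.comp q₀ (g.contMDiff (b q₀)) hv.base
  have h := ContMDiffAt.clm_bundle_apply₂ (F₁ := EuclideanSpace ℝ (Fin m))
    (F₂ := EuclideanSpace ℝ (Fin m)) (F₃ := ℝ) (E₁ := (TangentSpace (𝓡 m) : M → Type _))
    (E₂ := (TangentSpace (𝓡 m) : M → Type _)) (E₃ := fun _ ↦ ℝ) (IB := 𝓡 m)
    (b := b) (ψ := fun q ↦ g.val (b q)) (v := v) (w := w) hg hv hw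
  rw [contMDiffAt_totalSpace] at h
  exact h.2

theorem mdifferentiableAt_metric {v w : Π y : M, TangentSpace (𝓡 m) y} {x : M}
    (hv : DiffAt v x) (hw : DiffAt w x) :
    MDifferentiableAt (𝓡 m) 𝓘(ℝ, ℝ) (fun y ↦ g.val y (v y) (w y)) x := by
  have hg := (g.contMDiff x).mdifferentiableAt (by simp)
  have h := MDifferentiableAt.clm_bundle_apply₂ (F₁ := EuclideanSpace ℝ (Fin m))
    (F₂ := EuclideanSpace ℝ (Fin m)) (F₃ := ℝ) (E₁ := (TangentSpace (𝓡 m) : M → Type _))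
    (E₂ := (TangentSpace (𝓡 m) : M → Type _)) (E₃ := fun _ ↦ ℝ) (IB := 𝓡 m)
    (b := id) (ψ := fun q ↦ g.val q) (v := v) (w := w) hg hv hw
  rw [mdifferentiableAt_totalSpace] at h
  exact h.2

theorem metricInChart_apply (x y : M) (u v : EuclideanSpace ℝ (Fin m)) :
    metricInChart g x y u v = g.val y (ofChart x y u) (ofChart x y v) := rfl

theorem metricInChart_inChart {x y : M} (hy : y ∈ dom m x) (v w : TangentSpace (𝓡 m) y) :
    metricInChart g x y (inChart x y v) (inChart x y w) = g.val y v w := by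
  rw [metricInChart_apply, ofChart_inChart hy, ofChart_inChart hy]

theorem metricInChart_symm (x y : M) (u v : EuclideanSpace ℝ (Fin m)) :
    metricInChart g x y u v = metricInChart g x y v u := g.symm _ _ _

/-- Reduces smoothness of a form-valued map to smoothness of its finitely many matrix entries. -/
theorem bilin_eq_sum (A : EuclideanSpace ℝ (Fin m) →L[ℝ] EuclideanSpace ℝ (Fin m) →L[ℝ] ℝ) :
    A = ∑ k, ∑ l, A (EuclideanSpace.single k 1) (EuclideanSpace.single l 1) •
      (EuclideanSpace.proj k : EuclideanSpace ℝ (Fin m) →L[ℝ] ℝ).smulRight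
        (EuclideanSpace.proj l : EuclideanSpace ℝ (Fin m) →L[ℝ] ℝ) := by
  ext u v
  conv_lhs => rw [← (EuclideanSpace.basisFun (Fin m) ℝ).sum_repr u,
    ← (EuclideanSpace.basisFun (Fin m) ℝ).sum_repr v]
  simp only [EuclideanSpace.basisFun_apply, EuclideanSpace.basisFun_repr, map_sum, map_smul,
    _root_.sum_apply, _root_.smul_apply, smul_eq_mul, Finset.mul_sum]
  rw [Finset.sum_comm]
  refine Finset.sum_congr rfl fun k _ ↦ Finset.sum_congr rfl fun l _ ↦ ?_
  simp
  ring

theorem contMDiffAt_metricInChart {x y : M} (hy : y ∈ dom m x) :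
    ContMDiffAt (𝓡 m) 𝓘(ℝ, EuclideanSpace ℝ (Fin m) →L[ℝ] EuclideanSpace ℝ (Fin m) →L[ℝ] ℝ) ∞
      (metricInChart g x) y := by
  rw [funext fun z ↦ bilin_eq_sum (metricInChart g x z)]
  refine contMDiffAt_finsetSum fun k _ ↦ contMDiffAt_finsetSum fun l _ ↦ ?_
  exact (contMDiffAt_metric g (smoothAt_ofChart hy _) (smoothAt_ofChart hy _)).smul
    contMDiffAt_const

-- In the chart centred at `x` the tangent space at `x` is literally the model space, so the
-- manifold derivative at `x` is the Fréchet derivative of the function read in that chart.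
omit [IsManifold (𝓡 m) ∞ M] in
theorem hasFDerivAt_mvfderiv {F : Type*} [NormedAddCommGroup F] [NormedSpace ℝ F] {f : M → F}
    {x : M} (hf : MDifferentiableAt (𝓡 m) 𝓘(ℝ, F) f x) :
    HasFDerivAt (f ∘ (extChartAt (𝓡 m) x).symm)
      (mvfderiv (𝓡 m) f x : EuclideanSpace ℝ (Fin m) →L[ℝ] F) (extChartAt (𝓡 m) x x) := by
  have h := hf.differentiableWithinAt_writtenInExtChartAt
  have h2 := hf.mvfderiv
  simp only [ModelWithCorners.range_eq_univ, differentiableWithinAt_univ, fderivWithin_univ] at h h2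
  rw [h2]
  exact h.hasFDerivAt

theorem hasFDerivAt_metricInChart (x : M) :
    HasFDerivAt (fun z ↦ metricInChart g x ((extChartAt (𝓡 m) x).symm z))
      (mvfderiv (𝓡 m) (metricInChart g x) x : EuclideanSpace ℝ (Fin m) →L[ℝ]
        EuclideanSpace ℝ (Fin m) →L[ℝ] EuclideanSpace ℝ (Fin m) →L[ℝ] ℝ)
      (extChartAt (𝓡 m) x x) :=
  hasFDerivAt_mvfderiv
    ((contMDiffAt_metricInChart g (mem_chart_source _ x)).mdifferentiableAt (by simp))

theorem dMetric_symm (x : M) (u v w : TangentSpace (𝓡 m) x) :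
    dMetric g x u v w = dMetric g x u w v := by
  have key : ∀ a b : EuclideanSpace ℝ (Fin m),
      HasFDerivAt (fun z ↦ metricInChart g x ((extChartAt (𝓡 m) x).symm z) a b) _ _ :=
    fun a b ↦ ((hasFDerivAt_metricInChart g x).clm_apply (hasFDerivAt_const a _)).clm_apply
      (hasFDerivAt_const b _)
  have h1 := key (inChart x x v) (inChart x x w)
  have h2 := key (inChart x x w) (inChart x x v)
  simp only [metricInChart_symm g x _ (inChart x x v) (inChart x x w)] at h1
  have h := DFunLike.congr_fun (h1.unique h2) u
  simpa [dMetric] using! h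

theorem flat_symm_apply (x : M) (f : Module.Dual ℝ (TangentSpace (𝓡 m) x))
    (w : TangentSpace (𝓡 m) x) : g.val x ((flat g x).symm f) w = f w := by
  conv_rhs => rw [← (flat g x).apply_symm_apply f]
  rfl

theorem metric_christoffel (x : M) (v u w : TangentSpace (𝓡 m) x) :
    g.val x (christoffel g x v u) w = christoffelFirst g x v u w :=
  flat_symm_apply g x _ w

theorem leviCivita_apply (σ : Π y : M, TangentSpace (𝓡 m) y) (x : M) (u : TangentSpace (𝓡 m) x) :
    leviCivita g σ x u = ofChart x x (mvfderiv (𝓡 m) (fun y ↦ inChart x y (σ y)) x u) +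
      christoffel g x (σ x) u := rfl

/-- The product rule for `g(a, b)` with all three factors varying. The identity defining `f` is
needed only near the point, because components of vectors make sense only inside the chart. -/
theorem fderiv_bilin_apply {E F : Type*} [NormedAddCommGroup E] [NormedSpace ℝ E]
    [NormedAddCommGroup F] [NormedSpace ℝ F] {G : E → F →L[ℝ] F →L[ℝ] ℝ} {a b : E → F}
    {f : E → ℝ} {z : E} {G' : E →L[ℝ] F →L[ℝ] F →L[ℝ] ℝ} {a' b' : E →L[ℝ] F} {f' : E →L[ℝ] ℝ}
    (hf : HasFDerivAt f f' z) (hG : HasFDerivAt G G' z) (ha : HasFDerivAt a a' z)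
    (hb : HasFDerivAt b b' z) (h : f =ᶠ[𝓝 z] fun z ↦ G z (a z) (b z)) (v : E) :
    f' v = G' v (a z) (b z) + G z (a' v) (b z) + G z (a z) (b' v) := by
  rw [hf.unique (((hG.clm_apply ha).clm_apply hb).congr_of_eventuallyEq h)]
  simp
  ring

theorem leviCivita_metric_aux {X Y : Π y : M, TangentSpace (𝓡 m) y} {x : M} (hX : DiffAt X x)
    (hY : DiffAt Y x) (u : TangentSpace (𝓡 m) x) :
    mvfderiv (𝓡 m) (fun y ↦ g.val y (X y) (Y y)) x u = dMetric g x u (X x) (Y x) +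
      metricInChart g x x (mvfderiv (𝓡 m) (fun y ↦ inChart x y (X y)) x u) (inChart x x (Y x)) +
      metricInChart g x x (inChart x x (X x)) (mvfderiv (𝓡 m) (fun y ↦ inChart x y (Y y)) x u) := by
  have hc : ContinuousAt (extChartAt (𝓡 m) x).symm (extChartAt (𝓡 m) x x) :=
    continuousAt_extChartAt_symm x
  have hd := hc.preimage_mem_nhds (t := dom m x) (by
    rw [extChartAt_to_inv]; exact dom_mem_nhds (mem_chart_source _ x))
  have h := fderiv_bilin_apply (hasFDerivAt_mvfderiv (mdifferentiableAt_metric g hX hY))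
    (hasFDerivAt_metricInChart g x) (hasFDerivAt_mvfderiv (mdifferentiableAt_inChart hX))
    (hasFDerivAt_mvfderiv (mdifferentiableAt_inChart hY)) (by
      filter_upwards [hd] with z hz
      exact (metricInChart_inChart g hz _ _).symm) u
  have hs : ∀ Z : Π y : M, TangentSpace (𝓡 m) y,
      ((fun y ↦ inChart x y (Z y)) ∘ (extChartAt (𝓡 m) x).symm) (extChartAt (𝓡 m) x x) =
        inChart x x (Z x) := fun Z ↦
    congrArg (fun y ↦ inChart x y (Z y)) (extChartAt_to_inv (I := 𝓡 m) x)
  rw [hs, hs, extChartAt_to_inv] at h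
  exact h

/-- The Levi-Civita connection is compatible with the metric. -/
theorem leviCivita_metric {X Y : Π y : M, TangentSpace (𝓡 m) y} {x : M} (hX : DiffAt X x)
    (hY : DiffAt Y x) (u : TangentSpace (𝓡 m) x) :
    mvfderiv (𝓡 m) (fun y ↦ g.val y (X y) (Y y)) x u =
      g.val x (leviCivita g X x u) (Y x) + g.val x (X x) (leviCivita g Y x u) := by
  rw [leviCivita_metric_aux g hX hY, leviCivita_apply, leviCivita_apply, g.symm x (X x)]
  simp only [map_add, _root_.add_apply, metric_christoffel, christoffelFirst, metricInChart_apply,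
    ofChart_inChart_self]
  -- In `Γ(X,u;Y) + Γ(Y,u;X)` the terms `∂_X g(u,Y)` and `∂_Y g(u,X)` cancel by symmetry of the
  -- metric, leaving `∂_u g(X,Y)`.
  rw [dMetric_symm g x (Y x) u (X x), dMetric_symm g x (X x) u (Y x),
    dMetric_symm g x u (Y x) (X x), g.symm x (X x)]
  ring

theorem christoffel_symm (x : M) (v u : TangentSpace (𝓡 m) x) :
    christoffel g x v u = christoffel g x u v := by
  refine sub_eq_zero.mp (g.nondegenerate x _ fun w ↦ ?_)
  simp only [map_sub, _root_.sub_apply, metric_christoffel, christoffelFirst]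
  rw [dMetric_symm g x w]
  ring

/-- Coordinate vector fields commute. -/
theorem mlieBracket_ofChart {x y : M} (hy : y ∈ dom m x) (u v : EuclideanSpace ℝ (Fin m)) :
    VectorField.mlieBracket (𝓡 m) (fun z ↦ ofChart x z u) (fun z ↦ ofChart x z v) y = 0 := by
  have i1 : IsManifold (𝓡 m) 1 M := inferInstance
  have i2 : IsManifold (𝓡 m) (minSmoothness ℝ 2) M := by
    rw [minSmoothness_of_isRCLikeNormedField]; infer_instance
  set c := extChartAt (𝓡 m) x
  have hyc : y ∈ c.source := by rw [extChartAt_source]; exact hy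
  have hc : c.symm (c y) = y := c.left_inv hyc
  have hmem : c.target ∈ 𝓝 (c y) := extChartAt_target_mem_nhds' (c.map_source hyc)
  have hcs : ContMDiffAt 𝓘(ℝ, EuclideanSpace ℝ (Fin m)) (𝓡 m) ∞ c.symm (c y) :=
    (contMDiffOn_extChartAt_symm x).contMDiffAt hmem
  -- Pulling back by the inverse chart turns coordinate fields into constant fields on Euclidean
  -- space. Their bracket vanishes, and the bracket commutes with pullback.
  have key : ∀ w : EuclideanSpace ℝ (Fin m),
      VectorField.mpullback 𝓘(ℝ, EuclideanSpace ℝ (Fin m)) (𝓡 m) c.symm (fun z ↦ ofChart x z w)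
        =ᶠ[𝓝 (c y)] fun _ ↦ w := by
    intro w
    filter_upwards [hmem] with z hz
    have hz' : c.symm z ∈ dom m x := by simpa [c] using c.map_target hz
    have h1 := TangentBundle.symmL_trivializationAt (I := 𝓡 m) hz'
    rw [ModelWithCorners.range_eq_univ, mfderivWithin_univ] at h1
    have h2 : c (c.symm z) = z := c.right_inv hz
    have h3 := isInvertible_mfderivWithin_extChartAt_symm (I := 𝓡 m) hz
    rw [ModelWithCorners.range_eq_univ, mfderivWithin_univ] at h3
    change (mfderiv _ _ c.symm z).inverse (ofChart x (c.symm z) w) = w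
    change ofChart x (c.symm z) = mfderiv _ _ c.symm (c (c.symm z)) at h1
    rw [h2] at h1
    rw [h1]
    exact DFunLike.congr_fun h3.inverse_comp_self w
  have h := VectorField.mpullback_mlieBracket (n := ∞) (f := c.symm) (x₀ := c y)
    (V := fun z ↦ ofChart x z u) (W := fun z ↦ ofChart x z v)
    (by rw [hc]; exact (smoothAt_ofChart hy u).diffAt)
    (by rw [hc]; exact (smoothAt_ofChart hy v).diffAt) hcs (by
      rw [minSmoothness_of_isRCLikeNormedField]; exact WithTop.coe_le_coe.mpr le_top)
  have hconst : VectorField.mlieBracket 𝓘(ℝ, EuclideanSpace ℝ (Fin m))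
      (fun _ : EuclideanSpace ℝ (Fin m) ↦ u) (fun _ ↦ v) (c y) = 0 := by
    refine (congrFun (VectorField.mlieBracketWithin_eq_lieBracketWithin
      (V := fun _ : EuclideanSpace ℝ (Fin m) ↦ u) (W := fun _ ↦ v) (s := univ)) (c y)).trans ?_
    have h0 : VectorField.lieBracketWithin ℝ (fun _ : EuclideanSpace ℝ (Fin m) ↦ u) (fun _ ↦ v)
      univ (c y) = 0 := by simp [VectorField.lieBracketWithin]
    exact h0
  have h4 := h.trans (((key u).mlieBracket_vectorField_eq (key v)).trans hconst)
  -- The differential of the inverse chart is invertible, so the vanishing of the pulled-back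
  -- bracket gives that of the bracket itself.
  have h3 := isInvertible_mfderivWithin_extChartAt_symm (I := 𝓡 m) (c.map_source hyc)
  rw [ModelWithCorners.range_eq_univ, mfderivWithin_univ] at h3
  rw [VectorField.mpullback_apply, h3.inverse_apply_eq, map_zero] at h4
  rwa [hc] at h4

/-- The Levi-Civita connection is torsion free. -/
theorem leviCivita_torsion {X Y : Π y : M, TangentSpace (𝓡 m) y} {x : M} (hX : DiffAt X x)
    (hY : DiffAt Y x) : leviCivita g Y x (X x) - leviCivita g X x (Y x) =
      VectorField.mlieBracket (𝓡 m) X Y x := by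
  have i2 : IsManifold (𝓡 m) 2 M := inferInstance
  have h := (leviCivita g).torsion_apply hX hY
  -- Torsion is tensorial, so it may be computed on the constant-component extensions. There the
  -- bracket is zero and the connection reduces to the Christoffel symbols, which are symmetric.
  rw [CovariantDerivative.torsion_apply_eq_extend] at h
  have hx := dom_mem_nhds (mem_chart_source (EuclideanSpace ℝ (Fin m)) x)
  have he : ∀ v : TangentSpace (𝓡 m) x, ∀ᶠ y in 𝓝 x,
      (FiberBundle.extend (EuclideanSpace ℝ (Fin m)) v y : TangentSpace (𝓡 m) y) =
        ofChart x y (inChart x x v) := fun v ↦ by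
    filter_upwards [hx] with y hy using localExt_apply hy v
  have h1 : ∀ v w : TangentSpace (𝓡 m) x,
      leviCivita g (FiberBundle.extend (EuclideanSpace ℝ (Fin m)) v) x w =
        christoffel g x v w := by
    intro v w
    rw [leviCivita_apply, FiberBundle.extend_apply_self]
    have : (fun y ↦ inChart x y (FiberBundle.extend (EuclideanSpace ℝ (Fin m)) v y)) =ᶠ[𝓝 x]
        fun _ ↦ inChart x x v := by
      filter_upwards [hx, he v] with y hy h
      rw [h]
      exact inChart_ofChart hy _
    have h0 : mvfderiv (𝓡 m)
        (fun y ↦ inChart x y (FiberBundle.extend (EuclideanSpace ℝ (Fin m)) v y)) x = 0 := by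
      rw [mvfderiv, this.mfderiv_eq, mfderiv_const]
      rfl
    rw [h0]
    simp
  rw [h1, h1, FiberBundle.extend_apply_self, FiberBundle.extend_apply_self, christoffel_symm,
    sub_self, Filter.EventuallyEq.mlieBracket_vectorField_eq (he _) (he _),
    mlieBracket_ofChart (mem_chart_source _ x), sub_zero] at h
  exact (sub_eq_zero.mp h.symm)

end LeviCivita

/-! ### Gram matrices and dual families -/

section Matrix

variable {EN : Type*} [NormedAddCommGroup EN] [NormedSpace ℝ EN] {HN : Type*} [TopologicalSpace HN]
  {J : ModelWithCorners ℝ EN HN} {N : Type*} [TopologicalSpace N] [ChartedSpace HN N]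
  {ι : Type*} [Fintype ι] [DecidableEq ι]

theorem contMDiffAt_matrix_det {A : N → Matrix ι ι ℝ} {q₀ : N}
    (hA : ∀ i j, ContMDiffAt J 𝓘(ℝ, ℝ) ∞ (fun q ↦ A q i j) q₀) :
    ContMDiffAt J 𝓘(ℝ, ℝ) ∞ (fun q ↦ (A q).det) q₀ := by
  simp only [Matrix.det_apply']
  refine contMDiffAt_finsetSum fun σ _ ↦ ?_
  exact contMDiffAt_const.mul (contMDiffAt_finsetProd fun i _ ↦ hA _ _)

/-- Cramer's rule: each entry of the inverse is a determinant with one row replaced by a constant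
row, divided by the nonzero determinant. -/
theorem contMDiffAt_matrix_inv {A : N → Matrix ι ι ℝ} {q₀ : N}
    (hA : ∀ i j, ContMDiffAt J 𝓘(ℝ, ℝ) ∞ (fun q ↦ A q i j) q₀) (h : (A q₀).det ≠ 0) (i j : ι) :
    ContMDiffAt J 𝓘(ℝ, ℝ) ∞ (fun q ↦ (A q)⁻¹ i j) q₀ := by
  simp only [Matrix.inv_def, Ring.inverse_eq_inv', Matrix.smul_apply, Matrix.adjugate_apply,
    smul_eq_mul]
  refine ContMDiffAt.mul ((contMDiffAt_matrix_det hA).inv₀ h) (contMDiffAt_matrix_det fun k l ↦ ?_)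
  by_cases hk : k = j
  · subst hk; simpa using contMDiffAt_const
  · simpa [Matrix.updateRow_apply, hk] using hA k l

end Matrix

/-! ### Dual families with respect to the metric and coordinate frames -/

section Gram

variable {m : ℕ} {M : Type*} [TopologicalSpace M] [ChartedSpace (EuclideanSpace ℝ (Fin m)) M]
  [IsManifold (𝓡 m) ∞ M]
  {EN : Type*} [NormedAddCommGroup EN] [NormedSpace ℝ EN] {HN : Type*} [TopologicalSpace HN]
  {J : ModelWithCorners ℝ EN HN} {N : Type*} [TopologicalSpace N] [ChartedSpace HN N]
  {ι : Type*} [Fintype ι] [DecidableEq ι] (g : PseudoRiemannianMetric m M)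

/-- The Gram matrix of a family of tangent vectors. -/
def gram {x : M} (X : ι → TangentSpace (𝓡 m) x) : Matrix ι ι ℝ :=
  Matrix.of fun k l ↦ g.val x (X k) (X l)

/-- The dual family, in the span of a family with invertible Gram matrix. -/
def dualFamily {x : M} (X : ι → TangentSpace (𝓡 m) x) (k : ι) : TangentSpace (𝓡 m) x :=
  ∑ l, (gram g X)⁻¹ k l • X l

variable {g}

theorem val_dualFamily {x : M} {X : ι → TangentSpace (𝓡 m) x} (h : (gram g X).det ≠ 0) (k l : ι) :
    g.val x (dualFamily g X k) (X l) = if k = l then 1 else 0 := by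
  have h1 : ((gram g X)⁻¹ * gram g X) k l = (1 : Matrix ι ι ℝ) k l := by
    rw [Matrix.nonsing_inv_mul _ (isUnit_iff_ne_zero.mpr h)]
  rw [Matrix.one_apply, Matrix.mul_apply] at h1
  rw [← h1]
  simp [dualFamily, gram]

theorem sum_val_dualFamily_smul {x : M} {X : ι → TangentSpace (𝓡 m) x} (h : (gram g X).det ≠ 0)
    {v : TangentSpace (𝓡 m) x} (hv : v ∈ Submodule.span ℝ (range X)) :
    ∑ k, g.val x v (dualFamily g X k) • X k = v := by
  obtain ⟨c, rfl⟩ := (Submodule.mem_span_range_iff_exists_fun ℝ).mp hv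
  refine Finset.sum_congr rfl fun k _ ↦ ?_
  rw [g.symm]
  simp [map_sum, val_dualFamily h]

theorem sum_val_smul_dualFamily {x : M} {X : ι → TangentSpace (𝓡 m) x} (h : (gram g X).det ≠ 0)
    {v : TangentSpace (𝓡 m) x} (hv : v ∈ Submodule.span ℝ (range X)) :
    ∑ k, g.val x v (X k) • dualFamily g X k = v := by
  have h1 : ∀ l, ∑ k, g.val x (X l) (X k) • dualFamily g X k = X l := by
    intro l
    simp only [dualFamily, Finset.smul_sum, smul_smul]
    rw [Finset.sum_comm]
    simp only [← Finset.sum_smul]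
    have : ∀ j, ∑ k, g.val x (X l) (X k) * (gram g X)⁻¹ k j = if l = j then 1 else 0 := by
      intro j
      rw [← Matrix.one_apply, ← Matrix.mul_nonsing_inv _ (isUnit_iff_ne_zero.mpr h),
        Matrix.mul_apply]
      rfl
    simp [this]
  obtain ⟨c, rfl⟩ := (Submodule.mem_span_range_iff_exists_fun ℝ).mp hv
  simp only [map_sum, map_smul, _root_.sum_apply, _root_.smul_apply, smul_eq_mul, Finset.sum_smul]
  rw [Finset.sum_comm]
  refine Finset.sum_congr rfl fun l _ ↦ ?_
  conv_rhs => rw [← h1 l]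
  simp only [Finset.smul_sum, smul_smul]

/-- A left null vector of the Gram matrix gives a combination orthogonal to the whole span;
nondegeneracy kills the combination and independence kills its coefficients. -/
theorem gram_det_ne_zero {x : M} {X : ι → TangentSpace (𝓡 m) x} (hX : LinearIndependent ℝ X)
    (hn : ∀ v ∈ Submodule.span ℝ (range X), (∀ w ∈ Submodule.span ℝ (range X), g.val x v w = 0) →
      v = 0) : (gram g X).det ≠ 0 := by
  intro h
  obtain ⟨c, hc, hc'⟩ := Matrix.exists_vecMul_eq_zero_iff.mpr h
  have hv : ∑ k, c k • X k ∈ Submodule.span ℝ (range X) :=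
    Submodule.sum_mem _ fun k _ ↦ Submodule.smul_mem _ _ (Submodule.subset_span ⟨k, rfl⟩)
  have h0 := hn _ hv fun w hw ↦ by
    obtain ⟨d, rfl⟩ := (Submodule.mem_span_range_iff_exists_fun ℝ).mp hw
    have h1 : ∀ l, g.val x (∑ k, c k • X k) (X l) = 0 := by
      intro l
      have := congrFun hc' l
      simpa [Matrix.vecMul, dotProduct, gram] using this
    simp only [map_sum, map_smul] at h1 ⊢
    simp [h1]
  exact hc (funext (Fintype.linearIndependent_iff.mp hX c h0))

theorem smoothAlong_dualFamily {b : N → M} {X : ι → Π q : N, TangentSpace (𝓡 m) (b q)} {q₀ : N}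
    (hb : ContMDiffAt J (𝓡 m) ∞ b q₀) (hX : ∀ k, SmoothAlong J b (X k) q₀)
    (h : (gram g fun k ↦ X k q₀).det ≠ 0) (k : ι) :
    SmoothAlong J b (fun q ↦ dualFamily g (fun k ↦ X k q) k) q₀ :=
  smoothAlong_sum _ hb fun l _ ↦ SmoothAlong.smul
    (contMDiffAt_matrix_inv (A := fun q ↦ gram g fun k ↦ X k q)
      (fun i j ↦ contMDiffAt_metric g (hX i) (hX j)) h k l) (hX l)

/-- The coordinate vector fields of the chart at `x`. -/
def coordField (m : ℕ) {M : Type*} [TopologicalSpace M] [ChartedSpace (EuclideanSpace ℝ (Fin m)) M]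
    [IsManifold (𝓡 m) ∞ M] (x : M) (k : Fin m) (y : M) : TangentSpace (𝓡 m) y :=
  ofChart x y (EuclideanSpace.single k 1)

theorem sum_coordField {x y : M} (hy : y ∈ dom m x) (v : TangentSpace (𝓡 m) y) :
    ∑ k, inChart x y v k • coordField m x k y = v := by
  conv_rhs => rw [← ofChart_inChart hy v, ← (EuclideanSpace.basisFun (Fin m) ℝ).sum_repr
    (inChart x y v)]
  simp [coordField]

theorem span_coordField {x y : M} (hy : y ∈ dom m x) :
    Submodule.span ℝ (range fun k ↦ coordField m x k y) = ⊤ :=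
  eq_top_iff.mpr fun v _ ↦ (Submodule.mem_span_range_iff_exists_fun ℝ).mpr
    ⟨_, sum_coordField hy v⟩

theorem linearIndependent_coordField {x y : M} (hy : y ∈ dom m x) :
    LinearIndependent ℝ fun k ↦ coordField m x k y :=
  linearIndependent_of_top_le_span_of_card_eq_finrank (span_coordField hy).ge
    (by rw [finrank_tangentSpace, Fintype.card_fin])

theorem gram_coordField_det_ne_zero {x y : M} (hy : y ∈ dom m x) :
    (gram g fun k ↦ coordField m x k y).det ≠ 0 :=
  gram_det_ne_zero (linearIndependent_coordField hy) fun v _ h ↦ g.nondegenerate y v fun w ↦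
    h w (by rw [span_coordField hy]; trivial)

theorem smoothAt_coordField {x y : M} (hy : y ∈ dom m x) (k : Fin m) :
    SmoothAt (coordField m x k) y := smoothAt_ofChart hy _

variable (g)

/-- The vector fields dual to the coordinate vector fields of the chart at `x`. -/
def dualCoordField (x : M) (k : Fin m) (y : M) : TangentSpace (𝓡 m) y :=
  dualFamily g (fun k ↦ coordField m x k y) k

theorem smoothAt_dualCoordField {x y : M} (hy : y ∈ dom m x) (k : Fin m) :
    SmoothAt (dualCoordField g x k) y :=
  smoothAlong_dualFamily contMDiffAt_id (fun k ↦ smoothAt_coordField hy k)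
    (gram_coordField_det_ne_zero hy) k

theorem sum_val_smul_dualCoordField {x y : M} (hy : y ∈ dom m x) (v : TangentSpace (𝓡 m) y) :
    ∑ k, g.val y v (coordField m x k y) • dualCoordField g x k y = v :=
  sum_val_smul_dualFamily (gram_coordField_det_ne_zero hy) (by rw [span_coordField hy]; trivial)

theorem sum_val_dualCoordField_smul {x y : M} (hy : y ∈ dom m x) (v : TangentSpace (𝓡 m) y) :
    ∑ k, g.val y v (dualCoordField g x k y) • coordField m x k y = v :=
  sum_val_dualFamily_smul (gram_coordField_det_ne_zero hy) (by rw [span_coordField hy]; trivial)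

/-- A vector field is smooth if its inner products with the coordinate fields are. -/
theorem smoothAt_of_val {Y : Π y : M, TangentSpace (𝓡 m) y} {x : M}
    (h : ∀ k, ContMDiffAt (𝓡 m) 𝓘(ℝ, ℝ) ∞ (fun y ↦ g.val y (Y y) (coordField m x k y)) x) :
    SmoothAt Y x := by
  have hx := mem_chart_source (EuclideanSpace ℝ (Fin m)) x
  have h1 : SmoothAt
      (fun y ↦ ∑ k, g.val y (Y y) (coordField m x k y) • dualCoordField g x k y) x :=
    smoothAlong_sum _ contMDiffAt_id fun k _ ↦ SmoothAlong.smul (h k)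
      (smoothAt_dualCoordField g hx k)
  refine h1.congr_of_eventuallyEq ?_
  filter_upwards [dom_mem_nhds hx] with y hy
  rw [sum_val_smul_dualCoordField g hy]

/-! ### Smoothness of the Levi-Civita connection -/

theorem smoothAt_mlieBracket {X Y : Π y : M, TangentSpace (𝓡 m) y} {x : M}
    (hX : SmoothAt X x) (hY : SmoothAt Y x) :
    SmoothAt (fun y ↦ VectorField.mlieBracket (𝓡 m) X Y y) x := by
  have i2 : IsManifold (𝓡 m) (minSmoothness ℝ 2) M := by
    rw [minSmoothness_of_isRCLikeNormedField]; infer_instance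
  have i3 : IsManifold (𝓡 m) (((⊤ : ℕ∞) : WithTop ℕ∞) + 1) M := by
    have : (((⊤ : ℕ∞) : WithTop ℕ∞) + 1) = ∞ := rfl
    rw [this]; infer_instance
  exact ContMDiffAt.mlieBracket_vectorField (m := ⊤) (n := ⊤) hX hY (by
    rw [minSmoothness_of_isRCLikeNormedField]; rfl)

/-- Metric compatibility expands the three derivatives and vanishing torsion the three brackets;
everything but `∇_X Y` cancels. The right side no longer mentions the chart at the base point. -/
theorem koszul {X Y Z : Π y : M, TangentSpace (𝓡 m) y} {x : M} (hX : DiffAt X x) (hY : DiffAt Y x)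
    (hZ : DiffAt Z x) :
    g.val x (leviCivita g Y x (X x)) (Z x) = (1 / 2) *
      (mvfderiv (𝓡 m) (fun y ↦ g.val y (Y y) (Z y)) x (X x) +
        mvfderiv (𝓡 m) (fun y ↦ g.val y (Z y) (X y)) x (Y x) -
        mvfderiv (𝓡 m) (fun y ↦ g.val y (X y) (Y y)) x (Z x) +
        g.val x (VectorField.mlieBracket (𝓡 m) X Y x) (Z x) -
        g.val x (VectorField.mlieBracket (𝓡 m) X Z x) (Y x) -
        g.val x (VectorField.mlieBracket (𝓡 m) Y Z x) (X x)) := by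
  rw [leviCivita_metric g hY hZ, leviCivita_metric g hZ hX, leviCivita_metric g hX hY,
    ← leviCivita_torsion g hX hY, ← leviCivita_torsion g hX hZ, ← leviCivita_torsion g hY hZ]
  simp only [map_sub, _root_.sub_apply]
  rw [g.symm x (Y x), g.symm x (Z x), g.symm x (X x)]
  ring

/-- The definition uses the chart at each point separately, so smoothness in the point is not
visible from it. The Koszul formula against the coordinate fields of one fixed chart makes it
visible. -/
theorem smoothAt_leviCivita {X Y : Π y : M, TangentSpace (𝓡 m) y} {x : M}
    (hX : SmoothAt X x) (hY : SmoothAt Y x) : SmoothAt (fun y ↦ leviCivita g Y y (X y)) x := by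
  refine smoothAt_of_val g fun k ↦ ?_
  have hZ := smoothAt_coordField (m := m) (mem_chart_source _ x) k
  have h : ContMDiffAt (𝓡 m) 𝓘(ℝ, ℝ) ∞ (fun x' ↦ (1 / 2) *
      (mvfderiv (𝓡 m) (fun y ↦ g.val y (Y y) (coordField m x k y)) x' (X x') +
        mvfderiv (𝓡 m) (fun y ↦ g.val y (coordField m x k y) (X y)) x' (Y x') -
        mvfderiv (𝓡 m) (fun y ↦ g.val y (X y) (Y y)) x' (coordField m x k x') +
        g.val x' (VectorField.mlieBracket (𝓡 m) X Y x') (coordField m x k x') -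
        g.val x' (VectorField.mlieBracket (𝓡 m) X (coordField m x k) x') (Y x') -
        g.val x' (VectorField.mlieBracket (𝓡 m) Y (coordField m x k) x') (X x'))) x := by
    refine contMDiffAt_const.mul ?_
    refine (((((?_ : ContMDiffAt _ _ _ _ _).add ?_).sub ?_).add ?_).sub ?_).sub ?_
    · exact contMDiffAt_mvfderiv_apply (contMDiffAt_metric g hY hZ) hX
    · exact contMDiffAt_mvfderiv_apply (contMDiffAt_metric g hZ hX) hY
    · exact contMDiffAt_mvfderiv_apply (contMDiffAt_metric g hX hY) hZ
    · exact contMDiffAt_metric g (smoothAt_mlieBracket hX hY) hZ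
    · exact contMDiffAt_metric g (smoothAt_mlieBracket hX hZ) hY
    · exact contMDiffAt_metric g (smoothAt_mlieBracket hY hZ) hX
  refine h.congr_of_eventuallyEq ?_
  filter_upwards [hX.eventually_diffAt, hY.eventually_diffAt, hZ.eventually_diffAt] with y h1 h2 h3
  exact koszul g h1 h2 h3

end Gram

/-! ### Projections, frames and traces -/

section Projections

variable {n p : ℕ} {M : Type*} [TopologicalSpace M]
  [ChartedSpace (EuclideanSpace ℝ (Fin (n + p))) M] [IsManifold (𝓡 (n + p)) ∞ M]
  {EN : Type*} [NormedAddCommGroup EN] [NormedSpace ℝ EN] {HN : Type*} [TopologicalSpace HN]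
  {J : ModelWithCorners ℝ EN HN} {N : Type*} [TopologicalSpace N] [ChartedSpace HN N]
  {g : PseudoRiemannianMetric (n + p) M} (D : NondegenerateDistribution g)

namespace NondegenerateDistribution

theorem top_mem {x : M} (v : TangentSpace (𝓡 (n + p)) x) : D.top x v ∈ D.space x :=
  Submodule.projection_apply_mem _ _

theorem bot_mem {x : M} (v : TangentSpace (𝓡 (n + p)) x) : D.bot x v ∈ D.perp x :=
  Submodule.projection_apply_mem _ _

theorem top_add_bot {x : M} (v : TangentSpace (𝓡 (n + p)) x) : D.top x v + D.bot x v = v :=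
  Submodule.projection_add_projection_eq_self _ _

theorem top_of_mem {x : M} {v : TangentSpace (𝓡 (n + p)) x} (h : v ∈ D.space x) : D.top x v = v :=
  Submodule.projection_apply_of_mem_left _ h

theorem bot_of_mem {x : M} {v : TangentSpace (𝓡 (n + p)) x} (h : v ∈ D.perp x) : D.bot x v = v :=
  Submodule.projection_apply_of_mem_left _ h

theorem top_of_mem_perp {x : M} {v : TangentSpace (𝓡 (n + p)) x} (h : v ∈ D.perp x) :
    D.top x v = 0 :=
  (Submodule.projection_apply_eq_zero_iff _).mpr h

theorem bot_of_mem_space {x : M} {v : TangentSpace (𝓡 (n + p)) x} (h : v ∈ D.space x) :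
    D.bot x v = 0 :=
  (Submodule.projection_apply_eq_zero_iff _).mpr h

theorem bot_eq_sub {x : M} (v : TangentSpace (𝓡 (n + p)) x) : D.bot x v = v - D.top x v :=
  eq_sub_of_add_eq' (D.top_add_bot v)

theorem val_of_mem {x : M} {v w : TangentSpace (𝓡 (n + p)) x} (hv : v ∈ D.space x)
    (hw : w ∈ D.perp x) : g.val x v w = 0 :=
  D.mem_perp.mp hw v hv

theorem val_of_mem' {x : M} {v w : TangentSpace (𝓡 (n + p)) x} (hv : v ∈ D.perp x)
    (hw : w ∈ D.space x) : g.val x v w = 0 :=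
  (g.symm x v w).trans (D.mem_perp.mp hv w hw)

theorem val_top_left {x : M} (v w : TangentSpace (𝓡 (n + p)) x) :
    g.val x (D.top x v) w = g.val x (D.top x v) (D.top x w) := by
  conv_lhs => rw [← D.top_add_bot w]
  rw [map_add, D.val_of_mem (D.top_mem v) (D.bot_mem w), add_zero]

theorem val_bot_left {x : M} (v w : TangentSpace (𝓡 (n + p)) x) :
    g.val x (D.bot x v) w = g.val x (D.bot x v) (D.bot x w) := by
  conv_lhs => rw [← D.top_add_bot w]
  rw [map_add, D.val_of_mem' (D.bot_mem v) (D.top_mem w), zero_add]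

theorem val_top_comm {x : M} (v w : TangentSpace (𝓡 (n + p)) x) :
    g.val x (D.top x v) w = g.val x v (D.top x w) := by
  rw [D.val_top_left, g.symm x v, D.val_top_left w v, g.symm]

theorem val_bot_comm {x : M} (v w : TangentSpace (𝓡 (n + p)) x) :
    g.val x (D.bot x v) w = g.val x v (D.bot x w) := by
  rw [D.val_bot_left, g.symm x v, D.val_bot_left w v, g.symm]

/-- With a local smooth spanning family `X_a` and its dual family `X^a` inside the distribution,
`v^⊤ = ∑ ⟨v, X_a⟩ X^a`, and every ingredient is smooth. The rank condition makes the family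
independent, so its Gram matrix is invertible. -/
theorem smoothAlong_top {b : N → M} {v : Π q : N, TangentSpace (𝓡 (n + p)) (b q)} {q₀ : N}
    (hv : SmoothAlong J b v q₀) : SmoothAlong J b (fun q ↦ D.top (b q) (v q)) q₀ := by
  obtain ⟨V, X, hV, hx, hX, hspan⟩ := D.smooth (b q₀)
  have hb := hv.base
  have hXs : ∀ a, ∀ y ∈ V, SmoothAt (X a) y := fun a y hy ↦ (hX a).contMDiffAt (hV.mem_nhds hy)
  have hind : ∀ y ∈ V, LinearIndependent ℝ fun a ↦ X a y := fun y hy ↦ by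
    rw [linearIndependent_iff_card_eq_finrank_span, Set.finrank, ← hspan y hy, D.finrank_space,
      Fintype.card_fin]
  have hdet : ∀ y ∈ V, (gram g fun a ↦ X a y).det ≠ 0 := fun y hy ↦
    gram_det_ne_zero (hind y hy) (by rw [← hspan y hy]; exact D.nondegenerate y)
  have h1 : SmoothAlong J b
      (fun q ↦ ∑ a, g.val (b q) (v q) (X a (b q)) • dualFamily g (fun a ↦ X a (b q)) a) q₀ :=
    smoothAlong_sum _ hb fun a _ ↦ SmoothAlong.smul
      (contMDiffAt_metric g hv ((hXs a _ hx).comp hb))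
      (smoothAlong_dualFamily (X := fun a q ↦ X a (b q)) hb (fun a ↦ (hXs a _ hx).comp hb)
        (hdet _ hx) a)
  refine h1.congr_of_eventuallyEq ?_
  filter_upwards [hb.continuousAt.preimage_mem_nhds (hV.mem_nhds hx)] with q hq
  congr 1
  rw [← sum_val_smul_dualFamily (hdet _ hq) (v := D.top (b q) (v q))
    (by rw [← hspan _ hq]; exact D.top_mem _)]
  refine Finset.sum_congr rfl fun a _ ↦ ?_
  rw [D.val_top_comm, D.top_of_mem (hspan _ hq ▸ Submodule.subset_span ⟨a, rfl⟩)]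

theorem smoothAlong_bot {b : N → M} {v : Π q : N, TangentSpace (𝓡 (n + p)) (b q)} {q₀ : N}
    (hv : SmoothAlong J b v q₀) : SmoothAlong J b (fun q ↦ D.bot (b q) (v q)) q₀ := by
  simp only [bot_eq_sub]
  exact hv.sub (D.smoothAlong_top hv)

theorem smoothAt_top {X : Π y : M, TangentSpace (𝓡 (n + p)) y} {x : M} (hX : SmoothAt X x) :
    SmoothAt (fun y ↦ D.top y (X y)) x := D.smoothAlong_top hX

theorem smoothAt_bot {X : Π y : M, TangentSpace (𝓡 (n + p)) y} {x : M} (hX : SmoothAt X x) :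
    SmoothAt (fun y ↦ D.bot y (X y)) x := D.smoothAlong_bot hX

end NondegenerateDistribution

variable {D}

theorem AdaptedFrame.eps_mul_eps {x : M} (F : AdaptedFrame D x) (l : Fin n ⊕ Fin p) :
    eps g (F.vec l) * eps g (F.vec l) = 1 := by
  unfold eps
  rcases F.sign l with h | h <;> rw [h] <;> norm_num

theorem AdaptedFrame.linearIndependent {x : M} (F : AdaptedFrame D x) :
    LinearIndependent ℝ F.vec := by
  refine Fintype.linearIndependent_iff.mpr fun c hc l ↦ ?_
  have h : g.val x (F.vec l) (∑ k, c k • F.vec k) = 0 := by rw [hc, map_zero]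
  simp only [map_sum, map_smul, smul_eq_mul] at h
  rw [Finset.sum_eq_single l (fun k _ hk ↦ by rw [F.orthogonal l k hk.symm, mul_zero]) (by simp)]
    at h
  rcases F.sign l with h' | h' <;> rw [h'] at h <;> linarith

theorem AdaptedFrame.span_eq_top {x : M} (F : AdaptedFrame D x) :
    Submodule.span ℝ (range F.vec) = ⊤ :=
  F.linearIndependent.span_eq_top_of_card_eq_finrank' (by
    rw [finrank_tangentSpace, Fintype.card_sum, Fintype.card_fin, Fintype.card_fin])

theorem AdaptedFrame.expand {x : M} (F : AdaptedFrame D x) (v : TangentSpace (𝓡 (n + p)) x) :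
    ∑ l, (eps g (F.vec l) * g.val x v (F.vec l)) • F.vec l = v := by
  obtain ⟨c, rfl⟩ := (Submodule.mem_span_range_iff_exists_fun ℝ).mp
    (F.span_eq_top ▸ Submodule.mem_top : v ∈ _)
  refine Finset.sum_congr rfl fun l _ ↦ ?_
  congr 1
  rw [g.symm]
  simp only [map_sum, map_smul, smul_eq_mul]
  rw [Finset.sum_eq_single l (fun k _ hk ↦ by rw [F.orthogonal l k hk.symm, mul_zero]) (by simp)]
  calc _ = c l * (eps g (F.vec l) * eps g (F.vec l)) := by unfold eps; ring
    _ = _ := by rw [F.eps_mul_eps, mul_one]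

/-- The contraction of a bilinear form in an orthonormal frame is its contraction with any basis
and the dual basis. -/
theorem AdaptedFrame.sum_eq {x y : M} (hy : y ∈ dom (n + p) x) (F : AdaptedFrame D y)
    (B : LinearMap.BilinForm ℝ (TangentSpace (𝓡 (n + p)) y)) :
    ∑ l, eps g (F.vec l) * B (F.vec l) (F.vec l) =
      ∑ k, B (coordField (n + p) x k y) (dualCoordField g x k y) := by
  have h1 : ∀ l, B (F.vec l) (F.vec l) =
      ∑ k, g.val y (F.vec l) (coordField (n + p) x k y) *
        B (F.vec l) (dualCoordField g x k y) := fun l ↦ by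
    conv_lhs => enter [2]; rw [← sum_val_smul_dualCoordField g hy (F.vec l)]
    simp only [map_sum, map_smul, smul_eq_mul]
  have h2 : ∀ k, B (coordField (n + p) x k y) (dualCoordField g x k y) =
      ∑ l, eps g (F.vec l) * g.val y (coordField (n + p) x k y) (F.vec l) *
        B (F.vec l) (dualCoordField g x k y) := fun k ↦ by
    conv_lhs => enter [1, 2]; rw [← F.expand (coordField (n + p) x k y)]
    simp only [map_sum, map_smul, LinearMap.sum_apply, LinearMap.smul_apply, smul_eq_mul]
  simp only [h1, h2, Finset.mul_sum]
  rw [Finset.sum_comm]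
  refine Finset.sum_congr rfl fun k _ ↦ Finset.sum_congr rfl fun l _ ↦ ?_
  rw [g.symm y (F.vec l)]
  ring

/-- Composing the form with the projection in both slots annihilates the `⊥` part of the frame, so
the full contraction formula applies. The orthonormal frames are chosen with no regularity in the
point; this rewrites partial traces through smooth fields. -/
theorem AdaptedFrame.sum_top_eq {x y : M} (hy : y ∈ dom (n + p) x) (F : AdaptedFrame D y)
    (B : LinearMap.BilinForm ℝ (TangentSpace (𝓡 (n + p)) y)) :
    ∑ a, eps g (F.vec (Sum.inl a)) * B (F.vec (Sum.inl a)) (F.vec (Sum.inl a)) =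
      ∑ k, B (D.top y (coordField (n + p) x k y)) (D.top y (dualCoordField g x k y)) := by
  have h := F.sum_eq hy (B.compl₁₂ (D.top y) (D.top y))
  simp only [LinearMap.compl₁₂_apply, Fintype.sum_sum_type, D.top_of_mem (F.vec_inl_mem _),
    D.top_of_mem_perp (F.vec_inr_mem _), map_zero, mul_zero, Finset.sum_const_zero, add_zero] at h
  exact h

theorem AdaptedFrame.sum_bot_eq {x y : M} (hy : y ∈ dom (n + p) x) (F : AdaptedFrame D y)
    (B : LinearMap.BilinForm ℝ (TangentSpace (𝓡 (n + p)) y)) :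
    ∑ i, eps g (F.vec (Sum.inr i)) * B (F.vec (Sum.inr i)) (F.vec (Sum.inr i)) =
      ∑ k, B (D.bot y (coordField (n + p) x k y)) (D.bot y (dualCoordField g x k y)) := by
  have h := F.sum_eq hy (B.compl₁₂ (D.bot y) (D.bot y))
  simp only [LinearMap.compl₁₂_apply, Fintype.sum_sum_type, D.bot_of_mem (F.vec_inr_mem _),
    D.bot_of_mem_space (F.vec_inl_mem _), map_zero, mul_zero, Finset.sum_const_zero, zero_add] at h
  exact h

/-- The metric trace of an endomorphism is its trace. -/
theorem AdaptedFrame.trace_eq {x : M} (F : AdaptedFrame D x)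
    (A : TangentSpace (𝓡 (n + p)) x →ₗ[ℝ] TangentSpace (𝓡 (n + p)) x) :
    ∑ l, eps g (F.vec l) * g.val x (A (F.vec l)) (F.vec l) = LinearMap.trace ℝ _ A := by
  let b := Module.Basis.mk F.linearIndependent F.span_eq_top.ge
  have hb : ∀ l, b l = F.vec l := fun l ↦ Module.Basis.mk_apply _ _ l
  rw [LinearMap.trace_eq_matrix_trace ℝ b, Matrix.trace]
  refine Finset.sum_congr rfl fun l _ ↦ ?_
  rw [Matrix.diag_apply, LinearMap.toMatrix_apply, hb]
  conv_rhs => rw [← F.expand (A (F.vec l))]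
  simp only [← hb, map_sum, map_smul, Module.Basis.repr_self, Finsupp.coe_finsetSum,
    Finset.sum_apply, Finsupp.smul_apply, Finsupp.single_apply, smul_eq_mul]
  rw [Finset.sum_eq_single l (fun k _ hk ↦ by rw [if_neg hk, mul_zero]) (by simp), if_pos rfl,
    mul_one]

variable (D)

/-- The trace `∑_a ε_a ⟨A E_a, E_a⟩` over the distribution. -/
def traceTop (x : M) (A : TangentSpace (𝓡 (n + p)) x →L[ℝ] TangentSpace (𝓡 (n + p)) x) : ℝ :=
  ∑ a, eps g (frameTop D x a) * g.val x (A (frameTop D x a)) (frameTop D x a)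

/-- The trace `∑_i ε_i ⟨A 𝓔_i, 𝓔_i⟩` over the orthogonal complement of the distribution. -/
def traceBot (x : M) (A : TangentSpace (𝓡 (n + p)) x →L[ℝ] TangentSpace (𝓡 (n + p)) x) : ℝ :=
  ∑ i, eps g (frameBot D x i) * g.val x (A (frameBot D x i)) (frameBot D x i)

/-- The bilinear form `v, w ↦ ⟨A v, w⟩`. -/
def valForm (g : PseudoRiemannianMetric (n + p) M) {x : M}
    (A : TangentSpace (𝓡 (n + p)) x →L[ℝ] TangentSpace (𝓡 (n + p)) x) :
    LinearMap.BilinForm ℝ (TangentSpace (𝓡 (n + p)) x) :=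
  LinearMap.mk₂ ℝ (fun v w ↦ g.val x (A v) w) (by simp) (by simp) (by simp) (by simp)

theorem traceTop_add (x : M)
    (A B : TangentSpace (𝓡 (n + p)) x →L[ℝ] TangentSpace (𝓡 (n + p)) x) :
    traceTop D x (A + B) = traceTop D x A + traceTop D x B := by
  simp [traceTop, mul_add, Finset.sum_add_distrib]

theorem traceBot_add (x : M)
    (A B : TangentSpace (𝓡 (n + p)) x →L[ℝ] TangentSpace (𝓡 (n + p)) x) :
    traceBot D x (A + B) = traceBot D x A + traceBot D x B := by
  simp [traceBot, mul_add, Finset.sum_add_distrib]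

theorem traceTop_add_traceBot (x : M)
    (A : TangentSpace (𝓡 (n + p)) x →L[ℝ] TangentSpace (𝓡 (n + p)) x) :
    traceTop D x A + traceBot D x A = LinearMap.trace ℝ _ A.toLinearMap := by
  rw [← (frame D x).trace_eq, Fintype.sum_sum_type]
  rfl

theorem traceTop_eq {x y : M} (hy : y ∈ dom (n + p) x)
    (A : TangentSpace (𝓡 (n + p)) y →L[ℝ] TangentSpace (𝓡 (n + p)) y) :
    traceTop D y A = ∑ k, g.val y (A (D.top y (coordField (n + p) x k y)))
      (D.top y (dualCoordField g x k y)) :=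
  (frame D y).sum_top_eq hy (valForm g A)

theorem traceBot_eq {x y : M} (hy : y ∈ dom (n + p) x)
    (A : TangentSpace (𝓡 (n + p)) y →L[ℝ] TangentSpace (𝓡 (n + p)) y) :
    traceBot D y A = ∑ k, g.val y (A (D.bot y (coordField (n + p) x k y)))
      (D.bot y (dualCoordField g x k y)) :=
  (frame D y).sum_bot_eq hy (valForm g A)

theorem contMDiffAt_traceTop_leviCivita {Z : Π y : M, TangentSpace (𝓡 (n + p)) y} {x : M}
    (hZ : SmoothAt Z x) :
    ContMDiffAt (𝓡 (n + p)) 𝓘(ℝ, ℝ) ∞ (fun y ↦ traceTop D y (leviCivita g Z y)) x := by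
  have hx := mem_chart_source (EuclideanSpace ℝ (Fin (n + p))) x
  have h : ContMDiffAt (𝓡 (n + p)) 𝓘(ℝ, ℝ) ∞ (fun y ↦ ∑ k, g.val y
      (leviCivita g Z y (D.top y (coordField (n + p) x k y)))
      (D.top y (dualCoordField g x k y))) x :=
    contMDiffAt_finsetSum fun k _ ↦ contMDiffAt_metric g
      (smoothAt_leviCivita g (D.smoothAt_top (smoothAt_coordField hx k)) hZ)
      (D.smoothAt_top (smoothAt_dualCoordField g hx k))
  refine h.congr_of_eventuallyEq ?_
  filter_upwards [dom_mem_nhds hx] with y hy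
  exact traceTop_eq D hy _

theorem contMDiffAt_traceBot_leviCivita {Z : Π y : M, TangentSpace (𝓡 (n + p)) y} {x : M}
    (hZ : SmoothAt Z x) :
    ContMDiffAt (𝓡 (n + p)) 𝓘(ℝ, ℝ) ∞ (fun y ↦ traceBot D y (leviCivita g Z y)) x := by
  have hx := mem_chart_source (EuclideanSpace ℝ (Fin (n + p))) x
  have h : ContMDiffAt (𝓡 (n + p)) 𝓘(ℝ, ℝ) ∞ (fun y ↦ ∑ k, g.val y
      (leviCivita g Z y (D.bot y (coordField (n + p) x k y)))
      (D.bot y (dualCoordField g x k y))) x :=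
    contMDiffAt_finsetSum fun k _ ↦ contMDiffAt_metric g
      (smoothAt_leviCivita g (D.smoothAt_bot (smoothAt_coordField hx k)) hZ)
      (D.smoothAt_bot (smoothAt_dualCoordField g hx k))
  refine h.congr_of_eventuallyEq ?_
  filter_upwards [dom_mem_nhds hx] with y hy
  exact traceBot_eq D hy _

/-! ### The mean curvature vector fields -/

/-- For a local extension `Ẽ` of a frame vector `E` projected to the distribution, `⟨Ẽ, V^⊥⟩` is
identically zero. Differentiating along `E` trades `⟨∇_E Ẽ, V^⊥⟩` for `-⟨E, ∇_E V^⊥⟩`. -/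
theorem val_meanCurvature {V : Π y : M, TangentSpace (𝓡 (n + p)) y} {x : M} (hV : SmoothAt V x) :
    g.val x (meanCurvature D x) (V x) =
      -traceTop D x (leviCivita g (fun y ↦ D.bot y (V y)) x) := by
  simp only [meanCurvature, traceTop, map_sum, map_smul, _root_.sum_apply, _root_.smul_apply,
    smul_eq_mul, ← Finset.sum_neg_distrib, ← mul_neg]
  refine Finset.sum_congr rfl fun a _ ↦ ?_
  congr 1
  set E := frameTop D x a
  have hE : D.top x E = E := D.top_of_mem ((frame D x).vec_inl_mem a)
  have h := leviCivita_metric g (D.smoothAt_top (smoothAt_localExt E)).diffAt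
    (D.smoothAt_bot hV).diffAt E
  have h0 : (fun y ↦ g.val y (D.top y (localExt E y)) (D.bot y (V y))) = fun _ ↦ (0 : ℝ) :=
    funext fun y ↦ D.val_of_mem (D.top_mem _) (D.bot_mem _)
  rw [h0, mvfderiv_const, localExt_self, hE] at h
  rw [secondFundamentalForm, hE, ← two_smul ℝ, map_smul (D.bot x), smul_smul,
    one_div_mul_cancel two_ne_zero, one_smul, D.val_bot_comm, g.symm x _ E]
  exact eq_neg_of_add_eq_zero_left h.symm

theorem val_meanCurvaturePerp {V : Π y : M, TangentSpace (𝓡 (n + p)) y} {x : M}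
    (hV : SmoothAt V x) :
    g.val x (meanCurvaturePerp D x) (V x) =
      -traceBot D x (leviCivita g (fun y ↦ D.top y (V y)) x) := by
  simp only [meanCurvaturePerp, traceBot, map_sum, map_smul, _root_.sum_apply, _root_.smul_apply,
    smul_eq_mul, ← Finset.sum_neg_distrib, ← mul_neg]
  refine Finset.sum_congr rfl fun a _ ↦ ?_
  congr 1
  set E := frameBot D x a
  have hE : D.bot x E = E := D.bot_of_mem ((frame D x).vec_inr_mem a)
  have h := leviCivita_metric g (D.smoothAt_bot (smoothAt_localExt E)).diffAt
    (D.smoothAt_top hV).diffAt E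
  have h0 : (fun y ↦ g.val y (D.bot y (localExt E y)) (D.top y (V y))) = fun _ ↦ (0 : ℝ) :=
    funext fun y ↦ D.val_of_mem' (D.bot_mem _) (D.top_mem _)
  rw [h0, mvfderiv_const, localExt_self, hE] at h
  rw [secondFundamentalFormPerp, hE, ← two_smul ℝ, map_smul (D.top x), smul_smul,
    one_div_mul_cancel two_ne_zero, one_smul, D.val_top_comm, g.symm x _ E]
  exact eq_neg_of_add_eq_zero_left h.symm

/-- Against each coordinate field, the mean curvature is minus a partial trace of a covariant
derivative, already known to be smooth. -/
theorem smoothAt_meanCurvature (x : M) : SmoothAt (meanCurvature D) x := by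
  have hx := mem_chart_source (EuclideanSpace ℝ (Fin (n + p))) x
  refine smoothAt_of_val g fun k ↦ ?_
  refine (contMDiffAt_traceTop_leviCivita D
    (D.smoothAt_bot (smoothAt_coordField hx k))).neg.congr_of_eventuallyEq ?_
  filter_upwards [dom_mem_nhds hx] with y hy
  exact val_meanCurvature D (smoothAt_coordField hy k)

theorem smoothAt_meanCurvaturePerp (x : M) : SmoothAt (meanCurvaturePerp D) x := by
  have hx := mem_chart_source (EuclideanSpace ℝ (Fin (n + p))) x
  refine smoothAt_of_val g fun k ↦ ?_
  refine (contMDiffAt_traceBot_leviCivita D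
    (D.smoothAt_top (smoothAt_coordField hx k))).neg.congr_of_eventuallyEq ?_
  filter_upwards [dom_mem_nhds hx] with y hy
  exact val_meanCurvaturePerp D (smoothAt_coordField hy k)

theorem meanCurvature_mem (x : M) : meanCurvature D x ∈ D.perp x :=
  Submodule.sum_mem _ fun _ _ ↦ Submodule.smul_mem _ _ <| Submodule.smul_mem _ _ (D.bot_mem _)

theorem meanCurvaturePerp_mem (x : M) : meanCurvaturePerp D x ∈ D.space x :=
  Submodule.sum_mem _ fun _ _ ↦ Submodule.smul_mem _ _ <| Submodule.smul_mem _ _ (D.top_mem _)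

/-- The weighted trace of `∇V` is a divergence up to a zeroth order term. -/
theorem traceTop_traceBot_leviCivita {V : Π y : M, TangentSpace (𝓡 (n + p)) y} {x : M}
    (hV : SmoothAt V x) (c d : ℝ) :
    c * traceTop D x (leviCivita g V x) + d * traceBot D x (leviCivita g V x) =
      LinearMap.trace ℝ _
        (leviCivita g (fun y ↦ c • D.top y (V y) + d • D.bot y (V y)) x).toLinearMap +
      (c - d) * (g.val x (meanCurvaturePerp D x) (V x) - g.val x (meanCurvature D x) (V x)) := by
  have ht := D.smoothAt_top hV
  have hb := D.smoothAt_bot hV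
  have h1 : leviCivita g V x = leviCivita g (fun y ↦ D.top y (V y)) x +
      leviCivita g (fun y ↦ D.bot y (V y)) x := by
    rw [← (leviCivita g).isCovariantDerivativeOnUniv.add ht.diffAt hb.diffAt]
    congr 1
    funext y
    exact (D.top_add_bot (V y)).symm
  have h2 : leviCivita g (fun y ↦ c • D.top y (V y) + d • D.bot y (V y)) x =
      c • leviCivita g (fun y ↦ D.top y (V y)) x + d • leviCivita g (fun y ↦ D.bot y (V y)) x := by
    rw [← (leviCivita g).isCovariantDerivativeOnUniv.smul_const c ht.diffAt, ← (leviCivita g).isCovariantDerivativeOnUniv.smul_const d hb.diffAt]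
    exact (leviCivita g).isCovariantDerivativeOnUniv.add (SmoothAt.diffAt (SmoothAlong.const_smul c ht))
      (SmoothAt.diffAt (SmoothAlong.const_smul d hb))
  -- The full trace weights `∇(V^⊤)` by `c` and `∇(V^⊥)` by `d`, whereas the left side weights by
  -- the subspace traced over. They differ only in the cross terms `tr_⊤ ∇(V^⊥)` and `tr_⊥ ∇(V^⊤)`,
  -- which are the mean curvature terms.
  rw [val_meanCurvature D hV, val_meanCurvaturePerp D hV, h2, h1, traceTop_add, traceBot_add]
  simp only [ContinuousLinearMap.toLinearMap_add, ContinuousLinearMap.toLinearMap_smul, map_add,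
    map_smul, ← traceTop_add_traceBot D, smul_eq_mul]
  ring

end Projections

/-! ### The curvature tensor -/

section Curvature

variable {m : ℕ} {M : Type*} [TopologicalSpace M] [ChartedSpace (EuclideanSpace ℝ (Fin m)) M]
  [IsManifold (𝓡 m) ∞ M]

theorem cov_add
    (cov : CovariantDerivative (𝓡 m) (EuclideanSpace ℝ (Fin m)) (TangentSpace (𝓡 m) : M → Type _))
    {X Y : Π y : M, TangentSpace (𝓡 m) y} {x : M} (hX : DiffAt X x) (hY : DiffAt Y x)
    (u : TangentSpace (𝓡 m) x) : cov (fun y ↦ X y + Y y) x u = cov X x u + cov Y x u :=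
  DFunLike.congr_fun (cov.isCovariantDerivativeOnUniv.add hX hY) u

theorem cov_smul
    (cov : CovariantDerivative (𝓡 m) (EuclideanSpace ℝ (Fin m)) (TangentSpace (𝓡 m) : M → Type _))
    {f : M → ℝ} {X : Π y : M, TangentSpace (𝓡 m) y} {x : M}
    (hf : MDifferentiableAt (𝓡 m) 𝓘(ℝ, ℝ) f x) (hX : DiffAt X x) (u : TangentSpace (𝓡 m) x) :
    cov (fun y ↦ f y • X y) x u = f x • cov X x u + mvfderiv (𝓡 m) f x u • X x := by
  have h := DFunLike.congr_fun (cov.isCovariantDerivativeOnUniv.leibniz hX hf) u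
  simpa using! h

theorem cov_sub
    (cov : CovariantDerivative (𝓡 m) (EuclideanSpace ℝ (Fin m)) (TangentSpace (𝓡 m) : M → Type _))
    {X Y : Π y : M, TangentSpace (𝓡 m) y} {x : M} (hX : SmoothAt X x) (hY : SmoothAt Y x)
    (u : TangentSpace (𝓡 m) x) : cov (fun y ↦ X y - Y y) x u = cov X x u - cov Y x u := by
  have h := cov_add cov (SmoothAt.diffAt (SmoothAlong.sub hX hY)) hY.diffAt u
  simp only [sub_add_cancel] at h
  exact eq_sub_of_add_eq h.symm

theorem cov_congr
    (cov : CovariantDerivative (𝓡 m) (EuclideanSpace ℝ (Fin m)) (TangentSpace (𝓡 m) : M → Type _))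
    {X Y : Π y : M, TangentSpace (𝓡 m) y} {x : M} (hX : DiffAt X x)
    (h : ∀ᶠ y in 𝓝 x, X y = Y y) : cov X x = cov Y x := by
  refine cov.isCovariantDerivativeOnUniv.congr_of_eventuallyEq hX ?_ univ_mem h
  refine MDifferentiableAt.congr_of_eventuallyEq hX ?_
  filter_upwards [h] with y hy
  rw [hy]

/-- The commutator formula for the Lie bracket acting on functions. -/
theorem mvfderiv_mlieBracket_smul {X Y Z : Π y : M, TangentSpace (𝓡 m) y} {x : M} {f : M → ℝ}
    (hX : SmoothAt X x) (hY : SmoothAt Y x) (hZ : SmoothAt Z x)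
    (hf : ContMDiffAt (𝓡 m) 𝓘(ℝ, ℝ) ∞ f x) :
    mvfderiv (𝓡 m) f x (VectorField.mlieBracket (𝓡 m) X Y x) • Z x =
      mvfderiv (𝓡 m) (fun y ↦ mvfderiv (𝓡 m) f y (Y y)) x (X x) • Z x -
      mvfderiv (𝓡 m) (fun y ↦ mvfderiv (𝓡 m) f y (X y)) x (Y x) • Z x := by
  have i2 : IsManifold (𝓡 m) 2 M := inferInstance
  have i3 : IsManifold (𝓡 m) (minSmoothness ℝ 3) M := by
    rw [minSmoothness_of_isRCLikeNormedField]; infer_instance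
  -- The formula is read off from the Jacobi identity for `X`, `Y`, `fZ`: expanding by the Leibniz
  -- rule and removing `f` times the identity for `X`, `Y`, `Z` leaves only multiples of `Z`. This
  -- is why the conclusion carries the factor `Z x`.
  have key : ∀ {X Y : Π y : M, TangentSpace (𝓡 m) y}, SmoothAt X x → SmoothAt Y x →
      VectorField.mlieBracket (𝓡 m) X (VectorField.mlieBracket (𝓡 m) Y (f • Z)) x =
        (mvfderiv (𝓡 m) f x (X x) • VectorField.mlieBracket (𝓡 m) Y Z x +
          f x • VectorField.mlieBracket (𝓡 m) X (VectorField.mlieBracket (𝓡 m) Y Z) x) +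
        (mvfderiv (𝓡 m) (fun y ↦ mvfderiv (𝓡 m) f y (Y y)) x (X x) • Z x +
          mvfderiv (𝓡 m) f x (Y x) • VectorField.mlieBracket (𝓡 m) X Z x) := by
    intro X Y hX hY
    have hYf := contMDiffAt_mvfderiv_apply hf hY
    have e : VectorField.mlieBracket (𝓡 m) Y (f • Z) =ᶠ[𝓝 x]
        (f • VectorField.mlieBracket (𝓡 m) Y Z) + (fun y ↦ mvfderiv (𝓡 m) f y (Y y)) • Z := by
      have hf1 : ContMDiffAt (𝓡 m) 𝓘(ℝ, ℝ) 1 f x := hf.of_le (by simp)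
      filter_upwards [hZ.eventually_diffAt, (contMDiffAt_iff_contMDiffAt_nhds (by simp)).mp hf1]
        with y hy hy'
      rw [VectorField.mlieBracket_smul_right (hy'.mdifferentiableAt (by simp)) hy]
      exact add_comm _ _
    have hB := smoothAt_mlieBracket hY hZ
    have e' : VectorField.mlieBracket (𝓡 m) X (VectorField.mlieBracket (𝓡 m) Y (f • Z)) x =
        VectorField.mlieBracket (𝓡 m) X ((f • VectorField.mlieBracket (𝓡 m) Y Z) +
          (fun y ↦ mvfderiv (𝓡 m) f y (Y y)) • Z) x :=
      Filter.EventuallyEq.mlieBracket_vectorField_eq (EventuallyEq.refl _ X) e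
    rw [e', VectorField.mlieBracket_add_right (W := f • VectorField.mlieBracket (𝓡 m) Y Z)
        (W₁ := (fun y ↦ mvfderiv (𝓡 m) f y (Y y)) • Z) (SmoothAt.diffAt (SmoothAlong.smul hf hB))
        (SmoothAt.diffAt (SmoothAlong.smul hYf hZ)),
      VectorField.mlieBracket_smul_right (hf.mdifferentiableAt (by simp)) hB.diffAt,
      VectorField.mlieBracket_smul_right (hYf.mdifferentiableAt (by simp)) hZ.diffAt]
  have hle : minSmoothness ℝ 2 ≤ (∞ : WithTop ℕ∞) := by
    rw [minSmoothness_of_isRCLikeNormedField]; exact ENat.LEInfty.out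
  have h := VectorField.leibniz_identity_mlieBracket_apply (I := 𝓡 m) (U := X) (V := Y) (W := f • Z)
    (hX.of_le hle) (hY.of_le hle) (ContMDiffAt.of_le (SmoothAlong.smul hf hZ) hle)
  have h' := VectorField.leibniz_identity_mlieBracket_apply (I := 𝓡 m) (U := X) (V := Y) (W := Z)
    (hX.of_le hle) (hY.of_le hle) (hZ.of_le hle)
  rw [key hX hY, key hY hX, VectorField.mlieBracket_smul_right (hf.mdifferentiableAt (by simp))
    hZ.diffAt, h'] at h
  rw [smul_add] at h
  rw [eq_sub_iff_add_eq]
  have h2 := sub_eq_zero.mpr h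
  rw [← sub_eq_zero, ← neg_eq_zero, ← h2]
  abel

/-- The curvature of the Levi-Civita connection on vector fields. -/
def curvatureField (g : PseudoRiemannianMetric m M) (X Y Z : Π y : M, TangentSpace (𝓡 m) y)
    (x : M) : TangentSpace (𝓡 m) x :=
  leviCivita g (fun y ↦ leviCivita g Z y (X y)) x (Y x) -
    leviCivita g (fun y ↦ leviCivita g Z y (Y y)) x (X x) +
    leviCivita g Z x (VectorField.mlieBracket (𝓡 m) X Y x)

variable (g : PseudoRiemannianMetric m M)

theorem smoothAt_curvatureField {X Y Z : Π y : M, TangentSpace (𝓡 m) y} {x : M}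
    (hX : SmoothAt X x) (hY : SmoothAt Y x) (hZ : SmoothAt Z x) :
    SmoothAt (curvatureField g X Y Z) x :=
  SmoothAlong.add (SmoothAlong.sub (smoothAt_leviCivita g hY (smoothAt_leviCivita g hX hZ))
    (smoothAt_leviCivita g hX (smoothAt_leviCivita g hY hZ)))
    (smoothAt_leviCivita g (smoothAt_mlieBracket hX hY) hZ)

theorem curvatureField_swap (X Y Z : Π y : M, TangentSpace (𝓡 m) y) (x : M) :
    curvatureField g X Y Z x = -curvatureField g Y X Z x := by
  unfold curvatureField
  rw [VectorField.mlieBracket_swap_apply, map_neg]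
  abel

/-- A map on vector fields that is local and linear over the smooth functions depends on
the value at the point only. -/
theorem tensorial_congr {A : Type*} [AddCommGroup A] [Module ℝ A] {x : M}
    (Φ : (Π y : M, TangentSpace (𝓡 m) y) → A)
    (hadd : ∀ X Y, SmoothAt X x → SmoothAt Y x → Φ (fun y ↦ X y + Y y) = Φ X + Φ Y)
    (hsmul : ∀ (f : M → ℝ) X, ContMDiffAt (𝓡 m) 𝓘(ℝ, ℝ) ∞ f x → SmoothAt X x →
      Φ (fun y ↦ f y • X y) = f x • Φ X)
    (hloc : ∀ X Y, SmoothAt X x → (∀ᶠ y in 𝓝 x, X y = Y y) → Φ X = Φ Y)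
    {X Y : Π y : M, TangentSpace (𝓡 m) y} (hX : SmoothAt X x) (hY : SmoothAt Y x)
    (h : X x = Y x) : Φ X = Φ Y := by
  have hx := mem_chart_source (EuclideanSpace ℝ (Fin m)) x
  have hsum : ∀ (s : Finset (Fin m)) (Z : Fin m → Π y : M, TangentSpace (𝓡 m) y),
      (∀ k, SmoothAt (Z k) x) → Φ (fun y ↦ ∑ k ∈ s, Z k y) = ∑ k ∈ s, Φ (Z k) := by
    classical
    intro s Z hZ
    induction s using Finset.induction_on with
    -- Zero is the multiple of a smooth field by the zero function, so no separate hypothesis on `Φ`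
    -- is needed.
    | empty =>
      have h0 := hsmul (fun _ ↦ 0) X contMDiffAt_const hX
      simpa using h0
    | insert a s ha ih =>
      simp only [Finset.sum_insert ha, ← ih]
      exact hadd _ _ (hZ a) (smoothAlong_sum s contMDiffAt_id fun k _ ↦ hZ k)
  -- Near `x` a smooth field is a combination of coordinate fields with smooth coefficients, and `Φ`
  -- sees only the values of these coefficients at `x`.
  have key : ∀ {Z : Π y : M, TangentSpace (𝓡 m) y}, SmoothAt Z x →
      Φ Z = ∑ k, inChart x x (Z x) k • Φ (coordField m x k) := by
    intro Z hZ
    have hc : ∀ k, ContMDiffAt (𝓡 m) 𝓘(ℝ, ℝ) ∞ (fun y ↦ inChart x y (Z y) k) x := fun k ↦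
      (EuclideanSpace.proj k : EuclideanSpace ℝ (Fin m) →L[ℝ] ℝ).contMDiff.contMDiffAt.comp x
        (SmoothAlong.inChart hZ hx)
    rw [hloc Z (fun y ↦ ∑ k, inChart x y (Z y) k • coordField m x k y) hZ (by
      filter_upwards [dom_mem_nhds hx] with y hy
      rw [sum_coordField hy])]
    rw [hsum _ (fun k y ↦ inChart x y (Z y) k • coordField m x k y)
      fun k ↦ SmoothAlong.smul (hc k) (smoothAt_coordField hx k)]
    exact Finset.sum_congr rfl fun k _ ↦ hsmul _ _ (hc k) (smoothAt_coordField hx k)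
  rw [key hX, key hY, h]

theorem curvatureField_add_left {X X' Y Z : Π y : M, TangentSpace (𝓡 m) y} {x : M}
    (hX : SmoothAt X x) (hX' : SmoothAt X' x) (hZ : SmoothAt Z x) :
    curvatureField g (fun y ↦ X y + X' y) Y Z x =
      curvatureField g X Y Z x + curvatureField g X' Y Z x := by
  have i2 : IsManifold (𝓡 m) 2 M := inferInstance
  have h := cov_add (leviCivita g) (smoothAt_leviCivita g hX hZ).diffAt
    (smoothAt_leviCivita g hX' hZ).diffAt (Y x)
  have hb : VectorField.mlieBracket (𝓡 m) (fun y ↦ X y + X' y) Y x =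
      VectorField.mlieBracket (𝓡 m) X Y x + VectorField.mlieBracket (𝓡 m) X' Y x :=
    VectorField.mlieBracket_add_left hX.diffAt hX'.diffAt
  simp only [curvatureField, hb, map_add, h]
  abel

theorem curvatureField_smul_left {f : M → ℝ} {X Y Z : Π y : M, TangentSpace (𝓡 m) y} {x : M}
    (hf : ContMDiffAt (𝓡 m) 𝓘(ℝ, ℝ) ∞ f x) (hX : SmoothAt X x) (hZ : SmoothAt Z x) :
    curvatureField g (fun y ↦ f y • X y) Y Z x = f x • curvatureField g X Y Z x := by
  have i2 : IsManifold (𝓡 m) 2 M := inferInstance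
  have h := cov_smul (leviCivita g) (hf.mdifferentiableAt (by simp))
    (smoothAt_leviCivita g hX hZ).diffAt (Y x)
  have hb : VectorField.mlieBracket (𝓡 m) (fun y ↦ f y • X y) Y x =
      -mvfderiv (𝓡 m) f x (Y x) • X x + f x • VectorField.mlieBracket (𝓡 m) X Y x :=
    VectorField.mlieBracket_smul_left (hf.mdifferentiableAt (by simp)) hX.diffAt
  simp only [curvatureField, hb, map_add, map_smul, h]
  module

theorem curvatureField_add_right {X Y Z Z' : Π y : M, TangentSpace (𝓡 m) y} {x : M}
    (hX : SmoothAt X x) (hY : SmoothAt Y x) (hZ : SmoothAt Z x) (hZ' : SmoothAt Z' x) :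
    curvatureField g X Y (fun y ↦ Z y + Z' y) x =
      curvatureField g X Y Z x + curvatureField g X Y Z' x := by
  have key : ∀ {X : Π y : M, TangentSpace (𝓡 m) y}, SmoothAt X x → ∀ u,
      leviCivita g (fun y ↦ leviCivita g (fun y ↦ Z y + Z' y) y (X y)) x u =
        leviCivita g (fun y ↦ leviCivita g Z y (X y)) x u +
          leviCivita g (fun y ↦ leviCivita g Z' y (X y)) x u := fun {X} hX u ↦ by
    rw [← cov_add (leviCivita g) (smoothAt_leviCivita g hX hZ).diffAt
      (smoothAt_leviCivita g hX hZ').diffAt]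
    refine DFunLike.congr_fun (cov_congr (leviCivita g)
      (smoothAt_leviCivita g hX (SmoothAlong.add hZ hZ')).diffAt ?_) u
    filter_upwards [hZ.eventually_diffAt, hZ'.eventually_diffAt] with y hy hy'
    exact cov_add _ hy hy' _
  simp only [curvatureField, key hX, key hY, cov_add (leviCivita g) hZ.diffAt hZ'.diffAt]
  abel

/-- The mixed first-derivative terms of `f` cancel in the commutator, and the second-derivative
terms are cancelled by the bracket term through `mvfderiv_mlieBracket_smul`. -/
theorem curvatureField_smul_right {f : M → ℝ} {X Y Z : Π y : M, TangentSpace (𝓡 m) y} {x : M}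
    (hf : ContMDiffAt (𝓡 m) 𝓘(ℝ, ℝ) ∞ f x) (hX : SmoothAt X x) (hY : SmoothAt Y x)
    (hZ : SmoothAt Z x) :
    curvatureField g X Y (fun y ↦ f y • Z y) x = f x • curvatureField g X Y Z x := by
  have hfd := hf.mdifferentiableAt (by simp)
  have key : ∀ {X : Π y : M, TangentSpace (𝓡 m) y}, SmoothAt X x → ∀ u,
      leviCivita g (fun y ↦ leviCivita g (fun y ↦ f y • Z y) y (X y)) x u =
        (f x • leviCivita g (fun y ↦ leviCivita g Z y (X y)) x u +
          mvfderiv (𝓡 m) f x u • leviCivita g Z x (X x)) +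
        (mvfderiv (𝓡 m) f x (X x) • leviCivita g Z x u +
          mvfderiv (𝓡 m) (fun y ↦ mvfderiv (𝓡 m) f y (X y)) x u • Z x) := fun {X} hX u ↦ by
    have hXf := contMDiffAt_mvfderiv_apply hf hX
    have hXZ := smoothAt_leviCivita g hX hZ
    rw [← cov_smul (leviCivita g) hfd hXZ.diffAt,
      ← cov_smul (leviCivita g) (hXf.mdifferentiableAt (by simp)) hZ.diffAt,
      ← cov_add (leviCivita g) (SmoothAt.diffAt (SmoothAlong.smul hf hXZ))
        (SmoothAt.diffAt (SmoothAlong.smul hXf hZ))]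
    refine DFunLike.congr_fun (cov_congr (leviCivita g)
      (smoothAt_leviCivita g hX (SmoothAlong.smul hf hZ)).diffAt ?_) u
    have hf1 : ContMDiffAt (𝓡 m) 𝓘(ℝ, ℝ) 1 f x := hf.of_le (by simp)
    filter_upwards [hZ.eventually_diffAt, (contMDiffAt_iff_contMDiffAt_nhds (by simp)).mp hf1]
      with y hy hy'
    exact cov_smul _ (hy'.mdifferentiableAt (by simp)) hy _
  simp only [curvatureField, key hX, key hY, cov_smul (leviCivita g) hfd hZ.diffAt,
    mvfderiv_mlieBracket_smul hX hY hZ hf]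
  module

/-- Tensoriality, one argument at a time; antisymmetry reduces the second argument to the first. -/
theorem curvatureField_congr {X X' Y Y' Z Z' : Π y : M, TangentSpace (𝓡 m) y} {x : M}
    (hX : SmoothAt X x) (hX' : SmoothAt X' x) (hY : SmoothAt Y x) (hY' : SmoothAt Y' x)
    (hZ : SmoothAt Z x) (hZ' : SmoothAt Z' x) (h1 : X x = X' x) (h2 : Y x = Y' x)
    (h3 : Z x = Z' x) : curvatureField g X Y Z x = curvatureField g X' Y' Z' x := by
  have left : ∀ {X X' Y : Π y : M, TangentSpace (𝓡 m) y}, SmoothAt X x → SmoothAt X' x →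
      X x = X' x → curvatureField g X Y Z x = curvatureField g X' Y Z x :=
    fun {X X' Y} hX hX' h ↦ tensorial_congr (fun X ↦ curvatureField g X Y Z x)
      (fun _ _ h h' ↦ curvatureField_add_left g h h' hZ)
      (fun _ _ hf h ↦ curvatureField_smul_left g hf h hZ) (fun V W hV h ↦ by
        have e : VectorField.mlieBracket (𝓡 m) V Y x = VectorField.mlieBracket (𝓡 m) W Y x :=
          Filter.EventuallyEq.mlieBracket_vectorField_eq h (EventuallyEq.refl _ Y)
        unfold curvatureField
        rw [e, h.self_of_nhds,
          cov_congr (leviCivita g) (smoothAt_leviCivita g hV hZ).diffAt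
            (Y := fun y ↦ leviCivita g Z y (W y)) (h.mono fun y hy ↦ by rw [hy])]) hX hX' h
  rw [left hX hX' h1, curvatureField_swap, left hY hY' h2, ← curvatureField_swap]
  refine tensorial_congr (fun Z ↦ curvatureField g X' Y' Z x)
    (fun _ _ h h' ↦ curvatureField_add_right g hX' hY' h h')
    (fun _ _ hf h ↦ curvatureField_smul_right g hf hX' hY' h) (fun V W hV h ↦ ?_) hZ hZ' h3
  have h' : ∀ᶠ y in 𝓝 x, leviCivita g V y = leviCivita g W y := by
    filter_upwards [hV.eventually_diffAt, h.eventually_nhds] with y hy hy'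
    exact cov_congr _ hy hy'
  unfold curvatureField
  rw [cov_congr (leviCivita g) (smoothAt_leviCivita g hX' hV).diffAt
      (Y := fun y ↦ leviCivita g W y (X' y)) (h'.mono fun y hy ↦ by rw [hy]),
    cov_congr (leviCivita g) (smoothAt_leviCivita g hY' hV).diffAt
      (Y := fun y ↦ leviCivita g W y (Y' y)) (h'.mono fun y hy ↦ by rw [hy]), h'.self_of_nhds]

/-- The curvature is defined with extensions that depend on the base point. Tensoriality frees it
from them, so one fixed triple of fields can be used on a whole neighbourhood. -/
theorem curvature_eq_curvatureField {X Y Z : Π y : M, TangentSpace (𝓡 m) y} {x : M}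
    (hX : SmoothAt X x) (hY : SmoothAt Y x) (hZ : SmoothAt Z x) :
    curvature (leviCivita g) x (X x) (Y x) (Z x) = curvatureField g X Y Z x := by
  have h : curvature (leviCivita g) x (X x) (Y x) (Z x) =
      curvatureField g (localExt (X x)) (localExt (Y x)) (localExt (Z x)) x := by
    simp only [curvature, curvatureField, localExt_self]
  rw [h]
  exact curvatureField_congr g (smoothAt_localExt _) hX (smoothAt_localExt _) hY
    (smoothAt_localExt _) hZ (localExt_self _) (localExt_self _) (localExt_self _)

theorem curvature_add_left {x : M} (u u' v w : TangentSpace (𝓡 m) x) :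
    curvature (leviCivita g) x (u + u') v w =
      curvature (leviCivita g) x u v w + curvature (leviCivita g) x u' v w := by
  have hs := fun v : TangentSpace (𝓡 m) x ↦ smoothAt_localExt v
  have h := curvature_eq_curvatureField g (SmoothAlong.add (hs u) (hs u')) (hs v) (hs w)
  rw [curvatureField_add_left g (hs u) (hs u') (hs w), ← curvature_eq_curvatureField g (hs _) (hs _) (hs _),
    ← curvature_eq_curvatureField g (hs _) (hs _) (hs _)] at h
  simpa using h

theorem curvature_smul_left {x : M} (c : ℝ) (u v w : TangentSpace (𝓡 m) x) :
    curvature (leviCivita g) x (c • u) v w = c • curvature (leviCivita g) x u v w := by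
  have hs := fun v : TangentSpace (𝓡 m) x ↦ smoothAt_localExt v
  have h := curvature_eq_curvatureField g (SmoothAlong.const_smul c (hs u)) (hs v) (hs w)
  rw [curvatureField_smul_left g contMDiffAt_const (hs u) (hs w),
    ← curvature_eq_curvatureField g (hs _) (hs _) (hs _)] at h
  simpa using h

theorem curvature_swap {x : M} (u v w : TangentSpace (𝓡 m) x) :
    curvature (leviCivita g) x u v w = -curvature (leviCivita g) x v u w := by
  unfold curvature
  rw [VectorField.mlieBracket_swap_apply, map_neg]
  abel

theorem curvature_add_right {x : M} (u v w w' : TangentSpace (𝓡 m) x) :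
    curvature (leviCivita g) x u v (w + w') =
      curvature (leviCivita g) x u v w + curvature (leviCivita g) x u v w' := by
  have hs := fun v : TangentSpace (𝓡 m) x ↦ smoothAt_localExt v
  have h := curvature_eq_curvatureField g (hs u) (hs v) (SmoothAlong.add (hs w) (hs w'))
  rw [curvatureField_add_right g (hs u) (hs v) (hs w) (hs w'),
    ← curvature_eq_curvatureField g (hs _) (hs _) (hs _),
    ← curvature_eq_curvatureField g (hs _) (hs _) (hs _)] at h
  simpa using h

theorem curvature_smul_right {x : M} (c : ℝ) (u v w : TangentSpace (𝓡 m) x) :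
    curvature (leviCivita g) x u v (c • w) = c • curvature (leviCivita g) x u v w := by
  have hs := fun v : TangentSpace (𝓡 m) x ↦ smoothAt_localExt v
  have h := curvature_eq_curvatureField g (hs u) (hs v) (SmoothAlong.const_smul c (hs w))
  rw [curvatureField_smul_right g contMDiffAt_const (hs u) (hs v) (hs w),
    ← curvature_eq_curvatureField g (hs _) (hs _) (hs _)] at h
  simpa using h

/-! ### The curvature of semi-symmetric connections -/

theorem connectionOf_semiSymmetric_apply (U Z : Π y : M, TangentSpace (𝓡 m) y) (x : M)
    (u : TangentSpace (𝓡 m) x) :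
    connectionOf g (semiSymmetricContorsion g U) Z x u =
      leviCivita g Z x u + (g.val x (U x) (Z x) • u - g.val x u (Z x) • U x) := rfl

/-- A direct computation on local extensions. Derivatives of the extension of `w` outside the
Levi-Civita curvature cancel by antisymmetry, and those of the extensions of `u` and `v` are
absorbed by the bracket because `∇` is torsion free. Only `U` and `∇U` survive. -/
theorem curvature_semiSymmetric {U : Π y : M, TangentSpace (𝓡 m) y} {x : M} (hU : SmoothAt U x)
    (u v w : TangentSpace (𝓡 m) x) :
    curvature (connectionOf g (semiSymmetricContorsion g U)) x u v w =
      curvature (leviCivita g) x u v w +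
      (g.val x (leviCivita g U x v) w - g.val x (U x) w * g.val x (U x) v +
        g.val x v w * g.val x (U x) (U x)) • u -
      (g.val x (leviCivita g U x u) w - g.val x (U x) w * g.val x (U x) u +
        g.val x u w * g.val x (U x) (U x)) • v -
      g.val x u w • leviCivita g U x v + g.val x v w • leviCivita g U x u +
      (g.val x u w * g.val x (U x) v - g.val x v w * g.val x (U x) u) • U x := by
  have hu := smoothAt_localExt u
  have hv := smoothAt_localExt v
  have hw := smoothAt_localExt w
  -- One second covariant derivative, with every function coefficient differentiated by the product
  -- rule; it is used twice, with the two directions exchanged.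
  have key : ∀ {X : Π y : M, TangentSpace (𝓡 m) y}, SmoothAt X x → ∀ z,
      connectionOf g (semiSymmetricContorsion g U) (fun y ↦
        connectionOf g (semiSymmetricContorsion g U) (localExt w) y (X y)) x z =
      (leviCivita g (fun y ↦ leviCivita g (localExt w) y (X y)) x z +
        ((g.val x (U x) w • leviCivita g X x z +
          (g.val x (leviCivita g U x z) w + g.val x (U x) (leviCivita g (localExt w) x z)) • X x) -
        (g.val x (X x) w • leviCivita g U x z + (g.val x (leviCivita g X x z) w +
          g.val x (X x) (leviCivita g (localExt w) x z)) • U x))) +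
      (g.val x (U x) (leviCivita g (localExt w) x (X x) + (g.val x (U x) w • X x -
          g.val x (X x) w • U x)) • z -
        g.val x z (leviCivita g (localExt w) x (X x) + (g.val x (U x) w • X x -
          g.val x (X x) w • U x)) • U x) := fun {X} hX z ↦ by
    have hP := smoothAt_leviCivita g hX hw
    have hUw := contMDiffAt_metric g hU hw
    have hXw := contMDiffAt_metric g hX hw
    have h1 : SmoothAt (fun y ↦ g.val y (U y) (localExt w y) • X y) x := SmoothAlong.smul hUw hX
    have h2 : SmoothAt (fun y ↦ g.val y (X y) (localExt w y) • U y) x := SmoothAlong.smul hXw hU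
    have h3 : SmoothAt (fun y ↦ g.val y (U y) (localExt w y) • X y -
      g.val y (X y) (localExt w y) • U y) x := SmoothAlong.sub h1 h2
    rw [connectionOf_semiSymmetric_apply]
    simp only [connectionOf_semiSymmetric_apply]
    rw [cov_add (leviCivita g) hP.diffAt h3.diffAt, cov_sub (leviCivita g) h1 h2,
      cov_smul (leviCivita g) (hUw.mdifferentiableAt (by simp)) hX.diffAt,
      cov_smul (leviCivita g) (hXw.mdifferentiableAt (by simp)) hU.diffAt,
      leviCivita_metric g hU.diffAt hw.diffAt, leviCivita_metric g hX.diffAt hw.diffAt]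
    simp only [localExt_self]
  have ht := leviCivita_torsion g hu.diffAt hv.diffAt
  simp only [localExt_self] at ht
  unfold curvature
  rw [key hu, key hv, ← ht, connectionOf_semiSymmetric_apply]
  simp only [localExt_self, map_add, map_sub, map_smul, _root_.sub_apply, smul_eq_mul]
  rw [g.symm x v (U x), g.symm x u (U x), g.symm x v u]
  module

end Curvature

/-! ### The mixed scalar curvature -/

section MixedScalarCurvature

variable {n p : ℕ} {M : Type*} [TopologicalSpace M]
  [ChartedSpace (EuclideanSpace ℝ (Fin (n + p))) M] [IsManifold (𝓡 (n + p)) ∞ M]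
  {g : PseudoRiemannianMetric (n + p) M} (D : NondegenerateDistribution g)

theorem curvature_add_mid {m : ℕ} {M : Type*} [TopologicalSpace M]
    [ChartedSpace (EuclideanSpace ℝ (Fin m)) M] [IsManifold (𝓡 m) ∞ M]
    (g : PseudoRiemannianMetric m M) {x : M} (u v v' w : TangentSpace (𝓡 m) x) :
    curvature (leviCivita g) x u (v + v') w =
      curvature (leviCivita g) x u v w + curvature (leviCivita g) x u v' w := by
  rw [curvature_swap, curvature_add_left, neg_add, ← curvature_swap, ← curvature_swap]

theorem curvature_smul_mid {m : ℕ} {M : Type*} [TopologicalSpace M]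
    [ChartedSpace (EuclideanSpace ℝ (Fin m)) M] [IsManifold (𝓡 m) ∞ M]
    (g : PseudoRiemannianMetric m M) {x : M} (c : ℝ) (u v w : TangentSpace (𝓡 m) x) :
    curvature (leviCivita g) x u (c • v) w = c • curvature (leviCivita g) x u v w := by
  rw [curvature_swap, curvature_smul_left, ← smul_neg, ← curvature_swap]

variable {D}

theorem sum_val_frameTop_sq (x : M) (v : TangentSpace (𝓡 (n + p)) x) :
    ∑ a, eps g (frameTop D x a) * (g.val x v (frameTop D x a) * g.val x v (frameTop D x a)) =
      g.val x (D.top x v) (D.top x v) := by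
  conv_rhs => enter [2]; rw [← (frame D x).expand (D.top x v)]
  have h : ∀ i, g.val x (D.top x v) ((frame D x).vec (Sum.inr i)) = 0 := fun i ↦
    D.val_of_mem (D.top_mem v) ((frame D x).vec_inr_mem i)
  have h' : ∀ a, g.val x (D.top x v) ((frame D x).vec (Sum.inl a)) =
      g.val x v ((frame D x).vec (Sum.inl a)) := fun a ↦ by
    rw [D.val_top_comm, D.top_of_mem ((frame D x).vec_inl_mem a)]
  simp only [Fintype.sum_sum_type, h, h', mul_zero, zero_smul, Finset.sum_const_zero, add_zero,
    map_sum, map_smul, smul_eq_mul]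
  exact Finset.sum_congr rfl fun a _ ↦ (mul_assoc _ _ _).symm

theorem sum_val_frameBot_sq (x : M) (v : TangentSpace (𝓡 (n + p)) x) :
    ∑ i, eps g (frameBot D x i) * (g.val x v (frameBot D x i) * g.val x v (frameBot D x i)) =
      g.val x (D.bot x v) (D.bot x v) := by
  conv_rhs => enter [2]; rw [← (frame D x).expand (D.bot x v)]
  have h : ∀ a, g.val x (D.bot x v) ((frame D x).vec (Sum.inl a)) = 0 := fun a ↦
    D.val_of_mem' (D.bot_mem v) ((frame D x).vec_inl_mem a)
  have h' : ∀ i, g.val x (D.bot x v) ((frame D x).vec (Sum.inr i)) =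
      g.val x v ((frame D x).vec (Sum.inr i)) := fun i ↦ by
    rw [D.val_bot_comm, D.bot_of_mem ((frame D x).vec_inr_mem i)]
  simp only [Fintype.sum_sum_type, h, h', mul_zero, zero_smul, Finset.sum_const_zero, zero_add,
    map_sum, map_smul, smul_eq_mul]
  exact Finset.sum_congr rfl fun a _ ↦ (mul_assoc _ _ _).symm

theorem val_self_eq (x : M) (v : TangentSpace (𝓡 (n + p)) x) :
    g.val x v v = g.val x (D.top x v) (D.top x v) + g.val x (D.bot x v) (D.bot x v) := by
  conv_lhs => rw [← D.top_add_bot v]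
  simp only [map_add, _root_.add_apply, D.val_of_mem (D.top_mem v) (D.bot_mem v),
    D.val_of_mem' (D.bot_mem v) (D.top_mem v)]
  ring

theorem val_curvature_semiSymmetric {U : Π y : M, TangentSpace (𝓡 (n + p)) y} {x : M}
    (hU : SmoothAt U x) {u v : TangentSpace (𝓡 (n + p)) x} (h : g.val x u v = 0) :
    g.val x (curvature (connectionOf g (semiSymmetricContorsion g U)) x u v u) v =
      g.val x (curvature (leviCivita g) x u v u) v -
        (eps g v * g.val x (leviCivita g U x u) u + eps g u * g.val x (leviCivita g U x v) v -
          eps g v * (g.val x (U x) u * g.val x (U x) u) -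
          eps g u * (g.val x (U x) v * g.val x (U x) v) +
          eps g u * eps g v * g.val x (U x) (U x)) := by
  have h' : g.val x v u = 0 := by rw [g.symm, h]
  rw [curvature_semiSymmetric g hU]
  simp only [map_add, map_sub, map_smul, _root_.add_apply, _root_.sub_apply, _root_.smul_apply,
    smul_eq_mul, h, h']
  unfold eps
  ring

/-- A summand that depends on one index only is counted once for each value of the other; this is
the source of the weights `p` and `n`. -/
theorem sum_sum_separated {n p : ℕ} (K : Fin n → Fin p → ℝ) (A A' : Fin n → ℝ) (B B' : Fin p → ℝ)
    (c : ℝ) : ∑ a, ∑ i, (K a i - 2 * (A a + B i - A' a - B' i + c)) = ∑ a, ∑ i, K a i -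
      2 * (p * ∑ a, A a + n * ∑ i, B i - p * ∑ a, A' a - n * ∑ i, B' i + n * p * c) := by
  simp only [Finset.sum_sub_distrib, Finset.sum_add_distrib, ← Finset.mul_sum, Finset.sum_const,
    Finset.card_univ, Fintype.card_fin, nsmul_eq_mul]
  ring

/-- The two curvature terms contribute equally, which cancels the prefactor `1/2`. The quadratic
part is `np⟨U,U⟩ - p⟨U^⊤,U^⊤⟩ - n⟨U^⊥,U^⊥⟩`, and splitting `⟨U,U⟩` gives the coefficients `p(n-1)`
and `n(p-1)`. -/
theorem mixedScalarCurvature_semiSymmetric {U : Π y : M, TangentSpace (𝓡 (n + p)) y} {x : M}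
    (hU : SmoothAt U x) :
    mixedScalarCurvature D (connectionOf g (semiSymmetricContorsion g U)) x =
      mixedScalarCurvature D (leviCivita g) x -
        (p * traceTop D x (leviCivita g U x) + n * traceBot D x (leviCivita g U x) +
          p * (n - 1) * g.val x (D.top x (U x)) (D.top x (U x)) +
          n * (p - 1) * g.val x (D.bot x (U x)) (D.bot x (U x))) := by
  have hE : ∀ a, eps g (frameTop D x a) * eps g (frameTop D x a) = 1 := fun a ↦
    (frame D x).eps_mul_eps _
  have hF : ∀ i, eps g (frameBot D x i) * eps g (frameBot D x i) = 1 := fun a ↦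
    (frame D x).eps_mul_eps _
  have h0 : ∀ a i, g.val x (frameTop D x a) (frameBot D x i) = 0 := fun a i ↦
    D.val_of_mem ((frame D x).vec_inl_mem a) ((frame D x).vec_inr_mem i)
  have h0' : ∀ a i, g.val x (frameBot D x i) (frameTop D x a) = 0 := fun a i ↦
    D.val_of_mem' ((frame D x).vec_inr_mem i) ((frame D x).vec_inl_mem a)
  have key : ∀ a i, eps g (frameTop D x a) * eps g (frameBot D x i) *
      (g.val x (curvature (connectionOf g (semiSymmetricContorsion g U)) x (frameTop D x a)
        (frameBot D x i) (frameTop D x a)) (frameBot D x i) +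
      g.val x (curvature (connectionOf g (semiSymmetricContorsion g U)) x (frameBot D x i)
        (frameTop D x a) (frameBot D x i)) (frameTop D x a)) =
      eps g (frameTop D x a) * eps g (frameBot D x i) *
      (g.val x (curvature (leviCivita g) x (frameTop D x a)
        (frameBot D x i) (frameTop D x a)) (frameBot D x i) +
      g.val x (curvature (leviCivita g) x (frameBot D x i)
        (frameTop D x a) (frameBot D x i)) (frameTop D x a)) -
      2 * (eps g (frameTop D x a) * g.val x (leviCivita g U x (frameTop D x a)) (frameTop D x a) +
        eps g (frameBot D x i) * g.val x (leviCivita g U x (frameBot D x i)) (frameBot D x i) -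
        eps g (frameTop D x a) *
          (g.val x (U x) (frameTop D x a) * g.val x (U x) (frameTop D x a)) -
        eps g (frameBot D x i) *
          (g.val x (U x) (frameBot D x i) * g.val x (U x) (frameBot D x i)) +
        g.val x (U x) (U x)) := fun a i ↦ by
    rw [val_curvature_semiSymmetric hU (h0 a i), val_curvature_semiSymmetric hU (h0' a i)]
    -- The signs of the frame square to one, so each product of three or four signs collapses to at
    -- most one.
    linear_combination (exp := 1)
      -2 * (eps g (frameTop D x a) * g.val x (leviCivita g U x (frameTop D x a)) (frameTop D x a) -
        eps g (frameTop D x a) *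
          (g.val x (U x) (frameTop D x a) * g.val x (U x) (frameTop D x a))) * hF i -
      2 * (eps g (frameBot D x i) * g.val x (leviCivita g U x (frameBot D x i)) (frameBot D x i) -
        eps g (frameBot D x i) *
          (g.val x (U x) (frameBot D x i) * g.val x (U x) (frameBot D x i))) * hE a -
      2 * g.val x (U x) (U x) * hE a * eps g (frameBot D x i) * eps g (frameBot D x i) -
      2 * g.val x (U x) (U x) * hF i
  unfold mixedScalarCurvature
  simp only [key]
  rw [sum_sum_separated, sum_val_frameTop_sq, sum_val_frameBot_sq, val_self_eq (D := D) x (U x)]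
  unfold traceTop traceBot
  ring

/-- Only integrability over `Ω` of this term, which does not depend on `U`, is at stake. The double
frame sum is rewritten through coordinate fields and their duals, projected to the two
distributions, so that the irregular choice of frames disappears. -/
theorem contMDiffAt_mixedScalarCurvature (x : M) :
    ContMDiffAt (𝓡 (n + p)) 𝓘(ℝ, ℝ) ∞ (mixedScalarCurvature D (leviCivita g)) x := by
  have hx := mem_chart_source (EuclideanSpace ℝ (Fin (n + p))) x
  let b := coordField (n + p) (M := M) x
  let c := dualCoordField g x
  have key : ∀ y ∈ dom (n + p) x, mixedScalarCurvature D (leviCivita g) y = (1 / 2) * (∑ k, ∑ l,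
      (g.val y (curvatureField g (fun z ↦ D.top z (b k z)) (fun z ↦ D.bot z (b l z))
          (fun z ↦ D.top z (c k z)) y) (D.bot y (c l y)) +
        g.val y (curvatureField g (fun z ↦ D.bot z (b l z)) (fun z ↦ D.top z (b k z))
          (fun z ↦ D.bot z (c l z)) y) (D.top y (c k y)))) := by
    intro y hy
    have hbt : ∀ k, SmoothAt (fun z ↦ D.top z (b k z)) y := fun k ↦
      D.smoothAt_top (smoothAt_coordField hy k)
    have hbb : ∀ k, SmoothAt (fun z ↦ D.bot z (b k z)) y := fun k ↦
      D.smoothAt_bot (smoothAt_coordField hy k)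
    have hct : ∀ k, SmoothAt (fun z ↦ D.top z (c k z)) y := fun k ↦
      D.smoothAt_top (smoothAt_dualCoordField g hy k)
    have hcb : ∀ k, SmoothAt (fun z ↦ D.bot z (c k z)) y := fun k ↦
      D.smoothAt_bot (smoothAt_dualCoordField g hy k)
    -- The contraction over the orthogonal complement is done first, with the vector `E_a` fixed;
    -- the one over the distribution follows in `e2`.
    have e1 : ∀ a, ∑ i, eps g (frameBot D y i) *
        (g.val y (curvature (leviCivita g) y (frameTop D y a) (frameBot D y i) (frameTop D y a))
          (frameBot D y i) + g.val y (curvature (leviCivita g) y (frameBot D y i) (frameTop D y a)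
          (frameBot D y i)) (frameTop D y a)) = _ := fun a ↦
      (frame D y).sum_bot_eq hy (LinearMap.mk₂ ℝ (fun v w ↦
        g.val y (curvature (leviCivita g) y (frameTop D y a) v (frameTop D y a)) w +
        g.val y (curvature (leviCivita g) y v (frameTop D y a) w) (frameTop D y a))
        (by intros; simp only [curvature_add_mid, curvature_add_left, map_add, _root_.add_apply]; ring)
        (by intros; simp only [curvature_smul_mid, curvature_smul_left, map_smul, _root_.smul_apply,
              smul_eq_mul]; ring)
        (by intros; simp only [curvature_add_right, map_add, _root_.add_apply]; ring)
        (by intros; simp only [curvature_smul_right, map_smul, _root_.smul_apply, smul_eq_mul]; ring))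
    have e2 : ∀ l, ∑ a, eps g (frameTop D y a) *
        (g.val y (curvature (leviCivita g) y (frameTop D y a) (D.bot y (b l y)) (frameTop D y a))
          (D.bot y (c l y)) + g.val y (curvature (leviCivita g) y (D.bot y (b l y)) (frameTop D y a)
          (D.bot y (c l y))) (frameTop D y a)) = _ := fun l ↦
      (frame D y).sum_top_eq hy (LinearMap.mk₂ ℝ (fun v w ↦
        g.val y (curvature (leviCivita g) y v (D.bot y (b l y)) w) (D.bot y (c l y)) +
        g.val y (curvature (leviCivita g) y (D.bot y (b l y)) v (D.bot y (c l y))) w)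
        (by intros; simp only [curvature_add_mid, curvature_add_left, map_add, _root_.add_apply]; ring)
        (by intros; simp only [curvature_smul_mid, curvature_smul_left, map_smul, _root_.smul_apply,
              smul_eq_mul]; ring)
        (by intros; simp only [curvature_add_right, map_add, _root_.add_apply]; ring)
        (by intros; simp only [curvature_smul_right, map_smul, _root_.smul_apply, smul_eq_mul]; ring))
    simp only [LinearMap.mk₂_apply] at e1 e2
    unfold mixedScalarCurvature
    congr 1
    simp only [mul_assoc, ← Finset.mul_sum, e1]
    simp only [Finset.mul_sum]
    rw [Finset.sum_comm]
    conv_rhs => rw [Finset.sum_comm]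
    refine Finset.sum_congr rfl fun l _ ↦ (e2 l).trans (Finset.sum_congr rfl fun k _ ↦ ?_)
    rw [← curvature_eq_curvatureField g (hbt k) (hbb l) (hct k),
      ← curvature_eq_curvatureField g (hbb l) (hbt k) (hcb l)]
  have hbt : ∀ k, SmoothAt (fun z ↦ D.top z (b k z)) x := fun k ↦
    D.smoothAt_top (smoothAt_coordField hx k)
  have hbb : ∀ k, SmoothAt (fun z ↦ D.bot z (b k z)) x := fun k ↦
    D.smoothAt_bot (smoothAt_coordField hx k)
  have hct : ∀ k, SmoothAt (fun z ↦ D.top z (c k z)) x := fun k ↦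
    D.smoothAt_top (smoothAt_dualCoordField g hx k)
  have hcb : ∀ k, SmoothAt (fun z ↦ D.bot z (c k z)) x := fun k ↦
    D.smoothAt_bot (smoothAt_dualCoordField g hx k)
  refine ContMDiffAt.congr_of_eventuallyEq ?_ ((dom_mem_nhds hx : dom (n + p) x ∈ 𝓝 x) |>
    fun h ↦ Filter.mem_of_superset h key)
  refine contMDiffAt_const.mul (contMDiffAt_finsetSum fun k _ ↦ contMDiffAt_finsetSum fun l _ ↦ ?_)
  exact (contMDiffAt_metric g (smoothAt_curvatureField g (hbt k) (hbb l) (hct k)) (hcb l)).add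
    (contMDiffAt_metric g (smoothAt_curvatureField g (hbb l) (hbt k) (hcb l)) (hct k))

end MixedScalarCurvature

/-! ### Derivatives in charts -/

section ChartDerivative

variable {m : ℕ} {M : Type*} [TopologicalSpace M] [ChartedSpace (EuclideanSpace ℝ (Fin m)) M]
  [IsManifold (𝓡 m) ∞ M]

/-- The chain rule at an arbitrary point of the chart, not only its centre: there the differential
of the inverse chart is `ofChart x q`. -/
theorem hasFDerivAt_comp_chart_symm {F : Type*} [NormedAddCommGroup F] [NormedSpace ℝ F] {f : M → F}
    {x q : M} (hq : q ∈ dom m x) (hf : MDifferentiableAt (𝓡 m) 𝓘(ℝ, F) f q) :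
    HasFDerivAt (f ∘ (chartAt (EuclideanSpace ℝ (Fin m)) x).symm)
      (mvfderiv (𝓡 m) f q ∘L ofChart x q) (chartAt (EuclideanSpace ℝ (Fin m)) x q) := by
  set c := extChartAt (𝓡 m) x with hcdef
  have hqc : q ∈ c.source := by rw [extChartAt_source]; exact hq
  have hc : c.symm (c q) = q := c.left_inv hqc
  have h1 := TangentBundle.symmL_trivializationAt (I := 𝓡 m) (x₀ := x) (x := q) hq
  rw [ModelWithCorners.range_eq_univ, mfderivWithin_univ] at h1
  have hcs : MDifferentiableAt 𝓘(ℝ, EuclideanSpace ℝ (Fin m)) (𝓡 m) c.symm (c q) :=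
    ((contMDiffOn_extChartAt_symm (n := ∞) x).contMDiffAt
      (extChartAt_target_mem_nhds' (c.map_source hqc))).mdifferentiableAt (by simp)
  have hf' : MDifferentiableAt (𝓡 m) 𝓘(ℝ, F) f (c.symm (c q)) := by rwa [hc]
  have h2 := mfderiv_comp (c q) hf' hcs
  have h3 := (MDifferentiableAt.comp (c q) hf' hcs).differentiableAt.hasFDerivAt
  rw [← mfderiv_eq_fderiv, h2] at h3
  have h4 : ofChart x q = mfderiv 𝓘(ℝ, EuclideanSpace ℝ (Fin m)) (𝓡 m) c.symm (c q) := h1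
  rw [h4]
  have h5 : mfderiv (𝓡 m) 𝓘(ℝ, F) f (c.symm (c q)) = mvfderiv (𝓡 m) f q := by rw [hc]; rfl
  rw [h5] at h3
  exact h3

theorem hasFDerivAt_chart_transition {x y q : M} (hx : q ∈ dom m x) (hy : q ∈ dom m y) :
    HasFDerivAt (chartAt (EuclideanSpace ℝ (Fin m)) x ∘
        (chartAt (EuclideanSpace ℝ (Fin m)) y).symm)
      (inChart x q ∘L ofChart y q) (chartAt (EuclideanSpace ℝ (Fin m)) y q) := by
  have h := hasFDerivAt_comp_chart_symm (F := EuclideanSpace ℝ (Fin m)) (f := extChartAt (𝓡 m) x)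
    hy (mdifferentiableAt_extChartAt hx)
  have h1 := TangentBundle.continuousLinearMapAt_trivializationAt (I := 𝓡 m) (x₀ := x) (x := q) hx
  have h2 : inChart x q = mvfderiv (𝓡 m) (extChartAt (𝓡 m) x) q := h1
  rw [h2]
  exact h

variable (g : PseudoRiemannianMetric m M)

theorem density_eq (x y : M) :
    density g x y = Real.sqrt |(gram g fun k ↦ coordField m x k y).det| := rfl

theorem density_pos {x y : M} (hy : y ∈ dom m x) : 0 < density g x y := by
  rw [density_eq]
  exact Real.sqrt_pos.mpr (abs_pos.mpr (gram_coordField_det_ne_zero hy))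

/-- The Gram matrices of two coordinate frames are related by `G_y = Jᵀ G_x J` with `J` the Jacobian
of the change of charts; the square root of the absolute determinant scales by `|det J|`. -/
theorem density_transition {x y q : M} (hx : q ∈ dom m x) :
    density g y q = |(inChart (m := m) x q ∘L ofChart (m := m) y q).det| * density g x q := by
  set A := inChart (m := m) x q ∘L ofChart (m := m) y q
  let b := (EuclideanSpace.basisFun (Fin m) ℝ).toBasis
  let J := LinearMap.toMatrix b b A.toLinearMap
  have hJ : ∀ l k, J l k = inChart x q (coordField m y k q) l := fun l k ↦ by
    simp only [J, LinearMap.toMatrix_apply]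
    simp [b, A, coordField]
  have h1 : (gram g fun k ↦ coordField m y k q) =
      J.transpose * (gram g fun k ↦ coordField m x k q) * J := by
    ext k l
    have hk := sum_coordField hx (coordField m y k q)
    have hl := sum_coordField hx (coordField m y l q)
    conv_lhs => rw [gram, Matrix.of_apply, ← hk, ← hl]
    simp only [map_sum, map_smul, _root_.sum_apply, _root_.smul_apply, smul_eq_mul, Matrix.mul_apply,
      Matrix.transpose_apply, hJ, Finset.sum_mul, Finset.mul_sum]
    exact Finset.sum_congr rfl fun i _ ↦ Finset.sum_congr rfl fun j _ ↦ by
      rw [gram, Matrix.of_apply]; ring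
  have h2 : A.det = J.det := (LinearMap.det_toMatrix b A.toLinearMap).symm
  rw [density_eq, density_eq, h1, Matrix.det_mul, Matrix.det_mul, Matrix.det_transpose, h2,
    show J.det * (gram g fun k ↦ coordField m x k q).det * J.det =
      J.det ^ 2 * (gram g fun k ↦ coordField m x k q).det by ring, abs_mul, abs_pow,
    Real.sqrt_mul (by positivity), Real.sqrt_sq (abs_nonneg _)]

theorem contMDiffAt_gram_det {x y : M} (hy : y ∈ dom m x) :
    ContMDiffAt (𝓡 m) 𝓘(ℝ, ℝ) ∞ (fun z ↦ (gram g fun k ↦ coordField m x k z).det) y :=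
  contMDiffAt_matrix_det fun _ _ ↦ contMDiffAt_metric g (smoothAt_coordField hy _)
    (smoothAt_coordField hy _)

theorem continuousOn_density (x : M) : ContinuousOn (density g x) (dom m x) := fun _ hy ↦
  (Real.continuous_sqrt.continuousAt.comp
    (contMDiffAt_gram_det g hy).continuousAt.abs).continuousWithinAt

theorem continuousOn_density_symm (x : M) :
    ContinuousOn (fun z ↦ density g x ((chartAt (EuclideanSpace ℝ (Fin m)) x).symm z))
      (chartAt (EuclideanSpace ℝ (Fin m)) x).target :=
  (continuousOn_density g x).comp (chartAt (EuclideanSpace ℝ (Fin m)) x).continuousOn_symm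
    fun _ hz ↦ (chartAt (EuclideanSpace ℝ (Fin m)) x).map_target hz

end ChartDerivative

/-! ### The volume measure -/

section Volume

variable {m : ℕ} {M : Type*} [TopologicalSpace M] [ChartedSpace (EuclideanSpace ℝ (Fin m)) M]
  [IsManifold (𝓡 m) ∞ M] (g : PseudoRiemannianMetric m M) [MeasurableSpace M] [BorelSpace M]

theorem measurableSet_target (x : M) :
    MeasurableSet (chartAt (EuclideanSpace ℝ (Fin m)) x).target :=
  (chartAt (EuclideanSpace ℝ (Fin m)) x).open_target.measurableSet

theorem measurableSet_target_inter (x : M) {A : Set M} (hA : MeasurableSet A) :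
    MeasurableSet ((chartAt (EuclideanSpace ℝ (Fin m)) x).target ∩
      (chartAt (EuclideanSpace ℝ (Fin m)) x).symm ⁻¹' A) := by
  set c := chartAt (EuclideanSpace ℝ (Fin m)) x
  have h : Measurable (c.target.domRestrict c.symm) :=
    (continuousOn_iff_continuous_domRestrict.mp c.continuousOn_symm).measurable
  have h2 := (measurableSet_target x : MeasurableSet c.target).subtype_image (h hA)
  convert h2 using 1
  ext z
  simp [Set.domRestrict]
  tauto

theorem aemeasurable_chart_symm (x : M) : AEMeasurable (chartAt (EuclideanSpace ℝ (Fin m)) x).symm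
    (volume.restrict (chartAt (EuclideanSpace ℝ (Fin m)) x).target) :=
  (chartAt (EuclideanSpace ℝ (Fin m)) x).continuousOn_symm.aemeasurable (measurableSet_target x)

theorem aemeasurable_density (x : M) : AEMeasurable (fun z ↦ ENNReal.ofReal
      (density g x ((chartAt (EuclideanSpace ℝ (Fin m)) x).symm z)))
    (volume.restrict (chartAt (EuclideanSpace ℝ (Fin m)) x).target) :=
  ((continuousOn_density_symm g x).aemeasurable (measurableSet_target x)).ennreal_ofReal

theorem chartVolume_apply (x : M) {A : Set M} (hA : MeasurableSet A) :
    chartVolume g x A = ∫⁻ z in (chartAt (EuclideanSpace ℝ (Fin m)) x).target ∩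
      (chartAt (EuclideanSpace ℝ (Fin m)) x).symm ⁻¹' A,
        ENNReal.ofReal (density g x ((chartAt (EuclideanSpace ℝ (Fin m)) x).symm z)) := by
  set c := chartAt (EuclideanSpace ℝ (Fin m)) x
  have hac := withDensity_absolutelyContinuous (volume.restrict c.target) fun z ↦ ENNReal.ofReal
      (density g x (c.symm z))
  have hm := aemeasurable_chart_symm (m := m) x
  unfold chartVolume
  rw [Measure.map_apply_of_aemeasurable (hm.mono_ac hac) hA,
    withDensity_apply₀ _ (hm.nullMeasurableSet_preimage hA),
    Measure.restrict_restrict₀ (hm.nullMeasurableSet_preimage hA), inter_comm]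

/-- Change of variables for the transition map: the Jacobian factor is exactly the one relating the
two densities. -/
theorem chartVolume_eq_of_subset {x y : M} {A : Set M} (hA : MeasurableSet A) (hx : A ⊆ dom m x)
    (hy : A ⊆ dom m y) : chartVolume g x A = chartVolume g y A := by
  set c := chartAt (EuclideanSpace ℝ (Fin m)) x
  set d := chartAt (EuclideanSpace ℝ (Fin m)) y
  rw [chartVolume_apply g x hA, chartVolume_apply g y hA]
  have him : (c ∘ d.symm) '' (d.target ∩ d.symm ⁻¹' A) = c.target ∩ c.symm ⁻¹' A := by
    ext z
    constructor
    · rintro ⟨w, ⟨_, hw⟩, rfl⟩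
      exact ⟨c.map_source (hx hw), by
        rw [mem_preimage, Function.comp_apply, c.left_inv (hx hw)]; exact hw⟩
    · rintro ⟨hz, hz'⟩
      refine ⟨d (c.symm z), ⟨d.map_source (hy hz'), ?_⟩, ?_⟩
      · rw [mem_preimage, d.left_inv (hy hz')]; exact hz'
      · rw [Function.comp_apply, d.left_inv (hy hz'), c.right_inv hz]
  have hinj : InjOn (c ∘ d.symm) (d.target ∩ d.symm ⁻¹' A) := by
    rintro z ⟨hz, hz'⟩ w ⟨hw, hw'⟩ h
    exact d.symm.injOn hz hw (c.injOn (hx hz') (hx hw') h)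
  change ∫⁻ z in c.target ∩ c.symm ⁻¹' A, _ = ∫⁻ z in d.target ∩ d.symm ⁻¹' A, _
  rw [← him, lintegral_image_eq_lintegral_abs_det_fderiv_mul volume
    (measurableSet_target_inter y hA)
    (f' := fun z ↦ inChart (m := m) x (d.symm z) ∘L ofChart (m := m) y (d.symm z)) (fun z hz ↦ ?_) hinj]
  · refine setLIntegral_congr_fun (measurableSet_target_inter y hA) fun z hz ↦ ?_
    have hz' := hz.2
    rw [mem_preimage] at hz'
    simp only [Function.comp_apply]
    rw [c.left_inv (hx hz'), ← ENNReal.ofReal_mul (abs_nonneg _), ← density_transition g (hx hz')]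
  · have hz' : d.symm z ∈ A := hz.2
    have h := hasFDerivAt_chart_transition (hx hz') (hy hz')
    change HasFDerivAt (c ∘ d.symm) _ (d (d.symm z)) at h
    rw [d.right_inv hz.1] at h
    exact h.hasFDerivWithinAt

theorem chartVolume_compl (x : M) : chartVolume g x (dom m x)ᶜ = 0 := by
  set c := chartAt (EuclideanSpace ℝ (Fin m)) x
  rw [chartVolume_apply g x c.open_source.measurableSet.compl]
  have h : c.target ∩ c.symm ⁻¹' (dom m x)ᶜ = ∅ := by
    ext z
    simp only [mem_inter_iff, mem_preimage, mem_compl_iff, mem_empty_iff_false, iff_false, not_and,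
      not_not]
    exact fun hz ↦ c.map_target hz
  change ∫⁻ z in c.target ∩ c.symm ⁻¹' (dom m x)ᶜ, _ = 0
  rw [h, setLIntegral_empty]

variable [SecondCountableTopology M] [Nonempty M]

/-- On each piece of the disjoint cover the measure may be replaced by that of the chart at `x`;
countable additivity reassembles the pieces. From here on the choice of the cover is irrelevant. -/
theorem volumeMeasure_apply_of_subset {x : M} {A : Set M} (hA : MeasurableSet A)
    (hx : A ⊆ dom m x) : volumeMeasure g A = chartVolume g x A := by
  obtain hu := (exists_chart_cover m M).choose_spec
  set u := (exists_chart_cover m M).choose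
  have hms : ∀ k, MeasurableSet (disjointed (fun j ↦ dom m (u j)) k) := fun k ↦
    MeasurableSet.disjointed (fun j ↦ (chartAt _ (u j)).open_source.measurableSet) k
  have h1 : volumeMeasure g A =
      ∑' k, chartVolume g (u k) (A ∩ disjointed (fun j ↦ dom m (u j)) k) := by
    unfold volumeMeasure
    rw [Measure.sum_apply _ hA]
    exact tsum_congr fun k ↦ Measure.restrict_apply hA
  have h2 : ∀ k, chartVolume g (u k) (A ∩ disjointed (fun j ↦ dom m (u j)) k) =
      chartVolume g x (A ∩ disjointed (fun j ↦ dom m (u j)) k) := fun k ↦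
    chartVolume_eq_of_subset g (hA.inter (hms k))
      (inter_subset_right.trans (disjointed_subset _ k)) (inter_subset_left.trans hx)
  rw [h1, tsum_congr h2, ← measure_iUnion (fun i j hij ↦ (disjoint_disjointed
    (fun j ↦ dom m (u j)) hij).mono inter_subset_right inter_subset_right)
    (fun k ↦ hA.inter (hms k)), ← inter_iUnion, iUnion_disjointed, hu, inter_univ]

theorem volumeMeasure_restrict (x : M) : (volumeMeasure g).restrict (dom m x) = chartVolume g x := by
  ext A hA
  have hd : MeasurableSet (dom m x) := (chartAt _ x).open_source.measurableSet
  rw [Measure.restrict_apply hA, volumeMeasure_apply_of_subset g (hA.inter hd) inter_subset_right]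
  refine le_antisymm (measure_mono inter_subset_left) ?_
  calc chartVolume g x A ≤ chartVolume g x (A ∩ dom m x) + chartVolume g x (A \ dom m x) := by
        rw [measure_inter_add_sdiff _ hd]
    _ ≤ chartVolume g x (A ∩ dom m x) + chartVolume g x (dom m x)ᶜ := by
        gcongr; exact fun z hz ↦ hz.2
    _ = _ := by rw [chartVolume_compl, add_zero]

theorem integral_volumeMeasure_of_support {x : M} {f : M → ℝ} (hf : ContinuousOn f (dom m x))
    (hs : ∀ y ∉ dom m x, f y = 0) :
    ∫ y, f y ∂(volumeMeasure g) = ∫ z in (chartAt (EuclideanSpace ℝ (Fin m)) x).target,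
      density g x ((chartAt (EuclideanSpace ℝ (Fin m)) x).symm z) *
        f ((chartAt (EuclideanSpace ℝ (Fin m)) x).symm z) := by
  set c := chartAt (EuclideanSpace ℝ (Fin m)) x
  have hd : MeasurableSet (dom m x) := c.open_source.measurableSet
  have hac := withDensity_absolutelyContinuous (volume.restrict c.target) fun z ↦ ENNReal.ofReal
      (density g x (c.symm z))
  have hfm : AEStronglyMeasurable f (chartVolume g x) := by
    rw [← volumeMeasure_restrict g x]
    exact hf.aestronglyMeasurable hd
  rw [← setIntegral_eq_integral_of_forall_compl_eq_zero hs, volumeMeasure_restrict g x]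
  unfold chartVolume at hfm ⊢
  rw [integral_map ((aemeasurable_chart_symm x).mono_ac hac) hfm,
    integral_withDensity_eq_integral_toReal_smul₀ (aemeasurable_density g x) (by simp)]
  refine integral_congr_ae (Eventually.of_forall fun z ↦ ?_)
  simp only [smul_eq_mul]
  rw [ENNReal.toReal_ofReal (show 0 ≤ density g x (c.symm z) from Real.sqrt_nonneg _)]

instance isLocallyFiniteMeasure_volumeMeasure : IsLocallyFiniteMeasure (volumeMeasure g) := by
  refine ⟨fun x ↦ ?_⟩
  set c := chartAt (EuclideanSpace ℝ (Fin m)) x with hcdef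
  have hx : x ∈ c.source := mem_chart_source _ x
  obtain ⟨K, hK, hKn, hKt⟩ : ∃ K : Set (EuclideanSpace ℝ (Fin m)), IsCompact K ∧ K ∈ 𝓝 (c x) ∧
      K ⊆ c.target := by
    obtain ⟨K, hK, hKt, hKc⟩ := LocallyCompactSpace.local_compact_nhds (c x) c.target
      (c.open_target.mem_nhds (c.map_source hx))
    exact ⟨K, hKc, hK, hKt⟩
  have hU : c.source ∩ c ⁻¹' (interior K) ∈ 𝓝 x :=
    (c.isOpen_inter_preimage isOpen_interior).mem_nhds ⟨hx, mem_interior_iff_mem_nhds.mpr hKn⟩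
  refine ⟨_, hU, ?_⟩
  have hUm : MeasurableSet (c.source ∩ c ⁻¹' (interior K)) :=
    (c.isOpen_inter_preimage isOpen_interior).measurableSet
  rw [volumeMeasure_apply_of_subset g hUm inter_subset_left, chartVolume_apply g x hUm]
  -- A compact neighbourhood inside the chart has finite Lebesgue measure and bounded density, hence
  -- finite volume.
  obtain ⟨C, hC⟩ := hK.exists_bound_of_continuousOn ((continuousOn_density_symm g x).mono hKt)
  have hsub : c.target ∩ c.symm ⁻¹' (c.source ∩ c ⁻¹' interior K) ⊆ K := fun z hz ↦ by
    have := interior_subset hz.2.2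
    rwa [c.right_inv hz.1] at this
  calc _ ≤ ∫⁻ z in K, ENNReal.ofReal C := by
        refine (lintegral_mono_set hsub).trans (setLIntegral_mono measurable_const fun z hz ↦ ?_)
        exact ENNReal.ofReal_le_ofReal ((le_abs_self _).trans (hC z hz))
    _ < ⊤ := by
        rw [setLIntegral_const]
        exact ENNReal.mul_lt_top ENNReal.ofReal_lt_top hK.measure_lt_top

/-- The density is strictly positive on its chart. This is what lets a nonnegative continuous
function with zero integral be identically zero. -/
instance isOpenPosMeasure_volumeMeasure : (volumeMeasure g).IsOpenPosMeasure := by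
  refine ⟨fun U hU hne h0 ↦ ?_⟩
  obtain ⟨x, hx⟩ := hne
  set c := chartAt (EuclideanSpace ℝ (Fin m)) x with hcdef
  have hxs : x ∈ c.source := mem_chart_source _ x
  have hUo : IsOpen (U ∩ c.source) := hU.inter c.open_source
  have h1 : volumeMeasure g (U ∩ c.source) = 0 := measure_mono_null inter_subset_left h0
  have hV : IsOpen (c.target ∩ c.symm ⁻¹' (U ∩ c.source)) :=
    c.isOpen_inter_preimage_symm hUo
  rw [volumeMeasure_apply_of_subset g hUo.measurableSet inter_subset_right,
    chartVolume_apply g x hUo.measurableSet, lintegral_eq_zero_iff'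
      ((aemeasurable_density g x).mono_measure (Measure.restrict_mono_set _ inter_subset_left)),
    Filter.EventuallyEq, ae_restrict_iff' hV.measurableSet] at h1
  have h2 : volume (c.target ∩ c.symm ⁻¹' (U ∩ c.source)) = 0 := by
    refine measure_mono_null (fun z hz ↦ ?_) h1
    intro h
    have h3 := h hz
    simp only [Pi.zero_apply, ENNReal.ofReal_eq_zero] at h3
    exact absurd (density_pos g hz.2.2) (not_lt.mpr h3)
  refine hV.measure_ne_zero volume ⟨c x, c.map_source hxs, ?_⟩ h2
  rw [mem_preimage, c.left_inv hxs]
  exact ⟨hx, hxs⟩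

end Volume

/-! ### The divergence theorem -/

/-- Jacobi's formula for the derivative of a determinant. -/
theorem hasFDerivAt_det {ι : Type*} [Fintype ι] [DecidableEq ι] {E : Type*} [NormedAddCommGroup E]
    [NormedSpace ℝ E] {A : E → Matrix ι ι ℝ} {A' : ι → ι → E →L[ℝ] ℝ} {z : E}
    (h : ∀ i j, HasFDerivAt (fun z ↦ A z i j) (A' i j) z) :
    HasFDerivAt (fun z ↦ (A z).det) (∑ i, ∑ j, (A z).adjugate i j • A' j i) z := by
  simp only [Matrix.det_apply']
  have h1 : HasFDerivAt (fun z ↦ ∑ σ : Equiv.Perm ι, ((σ.sign : ℤ) : ℝ) * ∏ i, A z (σ i) i)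
      (∑ σ : Equiv.Perm ι, ((σ.sign : ℤ) : ℝ) •
        ∑ i, (∏ j ∈ Finset.univ.erase i, A z (σ j) j) • A' (σ i) i) z :=
    HasFDerivAt.fun_sum fun σ _ ↦ (HasFDerivAt.finsetProd fun i _ ↦ h (σ i) i).const_mul _
  convert h1 using 1
  ext v
  have h2 : ∀ i, ∑ j, (A z).adjugate i j * A' j i v =
      ∑ σ : Equiv.Perm ι, ((σ.sign : ℤ) : ℝ) *
        ((∏ j ∈ Finset.univ.erase i, A z (σ j) j) * A' (σ i) i v) := by
    intro i
    -- The derivative of the determinant in its column `i` is the determinant with that column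
    -- replaced by its derivative, which Cramer's rule expresses through the adjugate.
    have h3 := congrFun (Matrix.cramer_eq_adjugate_mulVec (A z) fun j ↦ A' j i v) i
    rw [Matrix.cramer_apply, Matrix.det_apply'] at h3
    rw [Matrix.mulVec, dotProduct] at h3
    rw [← h3]
    refine Finset.sum_congr rfl fun σ _ ↦ ?_
    congr 1
    rw [← Finset.mul_prod_erase _ _ (Finset.mem_univ i), Matrix.updateCol_self, mul_comm]
    congr 1
    exact Finset.prod_congr rfl fun j hj ↦ by
      rw [Matrix.updateCol_ne (Finset.ne_of_mem_erase hj)]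
  simp only [_root_.sum_apply, _root_.smul_apply, smul_eq_mul, h2, Finset.mul_sum]
  rw [Finset.sum_comm]

section Divergence

variable {m : ℕ} {M : Type*} [TopologicalSpace M] [ChartedSpace (EuclideanSpace ℝ (Fin m)) M]
  [IsManifold (𝓡 m) ∞ M] (g : PseudoRiemannianMetric m M)

theorem cov_sum
    (cov : CovariantDerivative (𝓡 m) (EuclideanSpace ℝ (Fin m)) (TangentSpace (𝓡 m) : M → Type _))
    {ι : Type*} (s : Finset ι) {X : ι → Π y : M, TangentSpace (𝓡 m) y} {x : M}
    (hX : ∀ i ∈ s, SmoothAt (X i) x) : cov (fun y ↦ ∑ i ∈ s, X i y) x = ∑ i ∈ s, cov (X i) x := by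
  classical
  induction s using Finset.induction_on with
  | empty =>
    have : (fun y : M ↦ ∑ i ∈ (∅ : Finset ι), X i y) = 0 := by funext y; simp
    rw [this, cov.zero]
    simp
  | insert a s ha ih =>
    have hs := fun i hi ↦ hX i (Finset.mem_insert_of_mem hi)
    rw [Finset.sum_insert ha, ← ih hs]
    ext1 u
    refine Eq.trans ?_ (cov_add cov (SmoothAt.diffAt (hX a (Finset.mem_insert_self a s)))
      (SmoothAt.diffAt (smoothAlong_sum s contMDiffAt_id hs)) u)
    simp only [Finset.sum_insert ha]

theorem val_coordField_dualCoordField {x y : M} (hy : y ∈ dom m x) (k l : Fin m) :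
    g.val y (coordField m x k y) (dualCoordField g x l y) = if l = k then 1 else 0 := by
  rw [g.symm]
  exact val_dualFamily (gram_coordField_det_ne_zero hy) l k

theorem trace_eq_sum {x y : M} (hy : y ∈ dom m x)
    (A : TangentSpace (𝓡 m) y →L[ℝ] TangentSpace (𝓡 m) y) :
    LinearMap.trace ℝ _ A.toLinearMap =
      ∑ k, g.val y (A (coordField m x k y)) (dualCoordField g x k y) := by
  let b := Module.Basis.mk (linearIndependent_coordField hy) (span_coordField hy).ge
  have hb : ∀ l, b l = coordField m x l y := fun l ↦ Module.Basis.mk_apply _ _ l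
  rw [LinearMap.trace_eq_matrix_trace ℝ b, Matrix.trace]
  refine Finset.sum_congr rfl fun l _ ↦ ?_
  rw [Matrix.diag_apply, LinearMap.toMatrix_apply, hb, ContinuousLinearMap.coe_coe]
  conv_lhs => rw [← sum_val_dualCoordField_smul g hy (A (coordField m x l y))]
  simp only [← hb, map_sum, map_smul, Module.Basis.repr_self, Finsupp.coe_finsetSum,
    Finset.sum_apply, Finsupp.smul_apply, Finsupp.single_apply, smul_eq_mul]
  rw [Finset.sum_eq_single l (fun k _ hk ↦ by rw [if_neg hk, mul_zero]) (by simp), if_pos rfl,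
    mul_one]

theorem contMDiffAt_trace_leviCivita {V : Π y : M, TangentSpace (𝓡 m) y} {x : M}
    (hV : SmoothAt V x) : ContMDiffAt (𝓡 m) 𝓘(ℝ, ℝ) ∞
      (fun y ↦ LinearMap.trace ℝ _ (leviCivita g V y).toLinearMap) x := by
  have hx := mem_chart_source (EuclideanSpace ℝ (Fin m)) x
  have h : ContMDiffAt (𝓡 m) 𝓘(ℝ, ℝ) ∞ (fun y ↦ ∑ k, g.val y
      (leviCivita g V y (coordField m x k y)) (dualCoordField g x k y)) x :=
    contMDiffAt_finsetSum fun k _ ↦ contMDiffAt_metric g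
      (smoothAt_leviCivita g (smoothAt_coordField hx k) hV) (smoothAt_dualCoordField g hx k)
  refine h.congr_of_eventuallyEq ?_
  filter_upwards [dom_mem_nhds hx] with y hy
  exact trace_eq_sum g hy _

theorem leviCivita_coordField_comm {x y : M} (hy : y ∈ dom m x) (k l : Fin m) :
    leviCivita g (coordField m x l) y (coordField m x k y) =
      leviCivita g (coordField m x k) y (coordField m x l y) := by
  have h := leviCivita_torsion g (smoothAt_coordField hy k).diffAt (smoothAt_coordField hy l).diffAt
  rw [sub_eq_iff_eq_add] at h
  rw [h]
  have h0 : VectorField.mlieBracket (𝓡 m) (coordField m x k) (coordField m x l) y = 0 :=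
    mlieBracket_ofChart hy _ _
  rw [h0, zero_add]

/-- The components of a vector field in the chart at `x`. -/
def component (x : M) (V : Π y : M, TangentSpace (𝓡 m) y) (k : Fin m) (y : M) : ℝ :=
  inChart x y (V y) k

theorem contMDiffAt_component {V : Π y : M, TangentSpace (𝓡 m) y} {x y : M} (hy : y ∈ dom m x)
    (hV : SmoothAt V y) (k : Fin m) :
    ContMDiffAt (𝓡 m) 𝓘(ℝ, ℝ) ∞ (component x V k) y :=
  (EuclideanSpace.proj k : EuclideanSpace ℝ (Fin m) →L[ℝ] ℝ).contMDiff.contMDiffAt.comp y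
    (SmoothAlong.inChart hV hy)

/-- The formula `div V = ∑ (∂_k V^k + V^k Γ^l_{kl})`. The lower indices come out in the other order
and are exchanged because coordinate fields commute and `∇` has no torsion. -/
theorem trace_leviCivita_eq {V : Π y : M, TangentSpace (𝓡 m) y} {x y : M} (hy : y ∈ dom m x)
    (hV : SmoothAt V y) :
    LinearMap.trace ℝ _ (leviCivita g V y).toLinearMap =
      ∑ k, (mvfderiv (𝓡 m) (component x V k) y (coordField m x k y) + component x V k y *
        ∑ l, g.val y (leviCivita g (coordField m x l) y (coordField m x k y))
          (dualCoordField g x l y)) := by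
  have hc := contMDiffAt_component hy hV
  have h1 : leviCivita g V y =
      leviCivita g (fun z ↦ ∑ k, component x V k z • coordField m x k z) y :=
    cov_congr _ hV.diffAt (by
      filter_upwards [dom_mem_nhds hy] with z hz using (sum_coordField hz (V z)).symm)
  rw [trace_eq_sum g hy, h1, cov_sum (leviCivita g) _
    (X := fun k z ↦ component x V k z • coordField m x k z)
    fun k _ ↦ SmoothAlong.smul (hc k) (smoothAt_coordField hy k)]
  have h2 : ∀ k u, leviCivita g (fun z ↦ component x V k z • coordField m x k z) y u = _ :=
    fun k u ↦ cov_smul (leviCivita g) ((hc k).mdifferentiableAt (by simp))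
      (smoothAt_coordField hy k).diffAt u
  simp only [_root_.sum_apply, h2, map_sum, map_add, map_smul, _root_.add_apply,
    _root_.smul_apply, smul_eq_mul, val_coordField_dualCoordField g hy, Finset.sum_add_distrib,
    mul_ite, mul_one, mul_zero, Finset.sum_ite_eq, Finset.mem_univ, if_true]
  rw [add_comm]
  congr 1
  rw [Finset.sum_comm]
  simp only [Finset.mul_sum]
  refine Finset.sum_congr rfl fun k _ ↦ Finset.sum_congr rfl fun l _ ↦ ?_
  rw [leviCivita_coordField_comm g hy]

theorem contMDiffAt_density {x y : M} (hy : y ∈ dom m x) :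
    ContMDiffAt (𝓡 m) 𝓘(ℝ, ℝ) ∞ (density g x) y := by
  have h := contMDiffAt_gram_det g hy
  have h0 : |(gram g fun k ↦ coordField m x k y).det| ≠ 0 :=
    abs_ne_zero.mpr (gram_coordField_det_ne_zero hy)
  have h1 : ContDiffAt ℝ ∞ (fun t : ℝ ↦ Real.sqrt |t|) (gram g fun k ↦ coordField m x k y).det :=
    (Real.contDiffAt_sqrt h0).comp _ (contDiffAt_abs (gram_coordField_det_ne_zero hy))
  exact ContMDiffAt.comp (g := fun t : ℝ ↦ Real.sqrt |t|) y h1.contMDiffAt h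

/-- In this form one expression covers both signs of `t`, as is needed for an indefinite metric. -/
theorem hasDerivAt_sqrt_abs {t : ℝ} (ht : t ≠ 0) :
    HasDerivAt (fun t : ℝ ↦ Real.sqrt |t|) (Real.sqrt |t| / (2 * t)) t := by
  have h := (hasDerivAt_abs ht).sqrt (abs_ne_zero.mpr ht)
  convert h using 1
  have h0 : 0 < Real.sqrt |t| := Real.sqrt_pos.mpr (abs_pos.mpr ht)
  have h1 := Real.mul_self_sqrt (abs_nonneg t)
  rcases lt_or_gt_of_ne ht with h' | h'
  · simp only [sign_neg h', SignType.coe_neg_one]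
    rw [abs_of_neg h'] at *
    field_simp
    nlinarith
  · simp only [sign_pos h', SignType.coe_one]
    rw [abs_of_pos h'] at *
    field_simp
    nlinarith

/-- Jacobi's formula gives `∂_u √|det G| = (1/2) √|det G| tr(G⁻¹ ∂_u G)`. Metric compatibility
splits `∂_u G` into two terms with equal trace against the symmetric `G⁻¹`, so the half disappears
and the contracted Christoffel symbols remain. -/
theorem mvfderiv_density {x y : M} (hy : y ∈ dom m x) (u : TangentSpace (𝓡 m) y) :
    mvfderiv (𝓡 m) (density g x) y u = density g x y *
      ∑ l, g.val y (leviCivita g (coordField m x l) y u) (dualCoordField g x l y) := by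
  set c := chartAt (EuclideanSpace ℝ (Fin m)) x with hcdef
  set G : M → Matrix (Fin m) (Fin m) ℝ := fun z ↦ gram g fun k ↦ coordField m x k z with hG
  have hdet : (G y).det ≠ 0 := gram_coordField_det_ne_zero hy
  have hcy : c.symm (c y) = y := c.left_inv hy
  have hGs : ∀ i j, ContMDiffAt (𝓡 m) 𝓘(ℝ, ℝ) ∞ (fun z ↦ G z i j) y := fun i j ↦
    contMDiffAt_metric g (smoothAt_coordField hy i) (smoothAt_coordField hy j)
  have h1 : ∀ i j, HasFDerivAt (fun z ↦ G (c.symm z) i j)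
      (mvfderiv (𝓡 m) (fun z ↦ G z i j) y ∘L ofChart x y) (c y) := fun i j ↦
    hasFDerivAt_comp_chart_symm hy ((hGs i j).mdifferentiableAt (by simp))
  have h2 := hasFDerivAt_det (A := fun z ↦ G (c.symm z)) h1
  have h3 : HasDerivAt (fun t : ℝ ↦ Real.sqrt |t|) _ (G (c.symm (c y))).det :=
    hasDerivAt_sqrt_abs (by rw [hcy]; exact hdet)
  have h4 := h3.comp_hasFDerivAt (c y) h2
  have h5 := hasFDerivAt_comp_chart_symm hy
    ((contMDiffAt_density g hy).mdifferentiableAt (by simp))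
  have h6 := DFunLike.congr_fun (h5.unique h4) (inChart x y u)
  simp only [ContinuousLinearMap.comp_apply, _root_.smul_apply, _root_.sum_apply, smul_eq_mul,
    ofChart_inChart hy, hcy] at h6
  rw [h6]
  have h7 : ∀ i j, mvfderiv (𝓡 m) (fun z ↦ G z i j) y u =
      g.val y (leviCivita g (coordField m x i) y u) (coordField m x j y) +
        g.val y (coordField m x i y) (leviCivita g (coordField m x j) y u) := fun i j ↦
    leviCivita_metric g (smoothAt_coordField hy i).diffAt (smoothAt_coordField hy j).diffAt u
  have hsym : ∀ i j, (G y).adjugate i j = (G y).adjugate j i := fun i j ↦ by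
    have : (G y).transpose = G y := by
      ext k l
      exact g.symm y _ _
    conv_lhs => rw [← this, ← Matrix.adjugate_transpose, Matrix.transpose_apply]
  have h8 : ∑ i, ∑ j, (G y).adjugate i j * mvfderiv (𝓡 m) (fun z ↦ G z j i) y u =
      2 * ∑ i, ∑ j, (G y).adjugate i j *
        g.val y (leviCivita g (coordField m x i) y u) (coordField m x j y) := by
    simp only [h7, mul_add, Finset.sum_add_distrib, two_mul]
    congr 1
    · rw [Finset.sum_comm]
      exact Finset.sum_congr rfl fun i _ ↦ Finset.sum_congr rfl fun j _ ↦ by rw [hsym]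
    · exact Finset.sum_congr rfl fun i _ ↦ Finset.sum_congr rfl fun j _ ↦ by rw [g.symm]
  have h9 : ∑ l, g.val y (leviCivita g (coordField m x l) y u) (dualCoordField g x l y) =
      (G y).det⁻¹ * ∑ i, ∑ j, (G y).adjugate i j *
        g.val y (leviCivita g (coordField m x i) y u) (coordField m x j y) := by
    simp only [dualCoordField, dualFamily, map_sum, map_smul, smul_eq_mul, Finset.mul_sum,
      Matrix.inv_def, Ring.inverse_eq_inv', Matrix.smul_apply, mul_assoc]
    rfl
  rw [h8, h9]
  have h10 : Real.sqrt |(G y).det| = density g x y := rfl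
  rw [h10]
  field_simp

/-- The coordinate formula for the divergence. -/
theorem sum_mvfderiv_density_mul {V : Π y : M, TangentSpace (𝓡 m) y} {x y : M} (hy : y ∈ dom m x)
    (hV : SmoothAt V y) :
    ∑ k, mvfderiv (𝓡 m) (fun z ↦ density g x z * component x V k z) y (coordField m x k y) =
      density g x y * LinearMap.trace ℝ _ (leviCivita g V y).toLinearMap := by
  rw [trace_leviCivita_eq g hy hV, Finset.mul_sum]
  refine Finset.sum_congr rfl fun k _ ↦ ?_
  have h := mvfderiv_mul ((contMDiffAt_density g hy).mdifferentiableAt (by simp))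
    ((contMDiffAt_component hy hV k).mdifferentiableAt (by simp))
  have h' := DFunLike.congr_fun h (coordField m x k y)
  refine Eq.trans h' ?_
  simp only [_root_.add_apply, _root_.smul_apply, smul_eq_mul, mvfderiv_density g hy]
  ring

/-- Locality of the connection: near `x` the field agrees with the field `0 • V`, which is smooth
everywhere and equal to the zero section. -/
theorem leviCivita_of_eventually_zero {V : Π y : M, TangentSpace (𝓡 m) y} {x : M}
    (h : ∀ᶠ y in 𝓝 x, V y = 0) : leviCivita g V x = 0 := by
  have h0 : SmoothAt (fun y : M ↦ (0 : ℝ) • V y) x := by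
    simp only [zero_smul]
    exact contMDiff_zeroSection ℝ _ |>.contMDiffAt
  have h1 : leviCivita g (fun y ↦ (0 : ℝ) • V y) x = leviCivita g V x :=
    cov_congr _ h0.diffAt (by filter_upwards [h] with y hy; rw [hy, smul_zero])
  rw [← h1]
  have h2 : (fun y : M ↦ (0 : ℝ) • V y) = 0 := by funext y; simp
  rw [h2, (leviCivita g).zero]
  rfl

/-- Integration by parts against the constant function 1. -/
theorem integral_fderiv_eq_zero {E : Type*} [NormedAddCommGroup E] [NormedSpace ℝ E]
    [FiniteDimensional ℝ E] [MeasurableSpace E] [BorelSpace E] (μ : Measure E) [μ.IsAddHaarMeasure]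
    {F : E → ℝ} (hF : ContDiff ℝ 1 F) (hc : HasCompactSupport F) (v : E) :
    ∫ z, fderiv ℝ F z v ∂μ = 0 := by
  have h1 : Continuous fun z ↦ fderiv ℝ F z v :=
    (hF.continuous_fderiv (by simp)).clm_apply continuous_const
  have h2 : HasCompactSupport fun z ↦ fderiv ℝ F z v := hc.fderiv_apply ℝ v
  have h := integral_mul_fderiv_eq_neg_fderiv_mul_of_integrable (μ := μ) (f := F)
    (g := fun _ ↦ (1 : ℝ)) (v := v)
    (by simpa using h1.integrable_of_hasCompactSupport h2) (by simp)
    (by simpa using hF.continuous.integrable_of_hasCompactSupport hc)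
    (fun z _ ↦ (hF.differentiable (by simp)).differentiableAt) (by simp)
  simpa using h

variable [T2Space M] [SecondCountableTopology M] [Nonempty M] [MeasurableSpace M] [BorelSpace M]

/-- Read in the chart, the density times the divergence is `∑ ∂_k(density · V^k)`, a sum of
derivatives of compactly supported functions on Euclidean space. -/
theorem integral_divergence_eq_zero_of_subset {V : Π y : M, TangentSpace (𝓡 m) y} {x : M}
    (hV : ∀ y, SmoothAt V y) {K : Set M} (hK : IsCompact K) (hKx : K ⊆ dom m x)
    (h0 : ∀ y ∉ K, V y = 0) :
    ∫ y, LinearMap.trace ℝ _ (leviCivita g V y).toLinearMap ∂(volumeMeasure g) = 0 := by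
  classical
  set c := chartAt (EuclideanSpace ℝ (Fin m)) x with hcdef
  have hout : ∀ y ∉ K, leviCivita g V y = 0 := fun y hy ↦
    leviCivita_of_eventually_zero g (by
      filter_upwards [hK.isClosed.isOpen_compl.mem_nhds hy] with z hz using h0 z hz)
  rw [integral_volumeMeasure_of_support g (x := x)
    (fun y _ ↦ (contMDiffAt_trace_leviCivita g (hV y)).continuousAt.continuousWithinAt)
    (fun y hy ↦ by rw [hout y fun h ↦ hy (hKx h)]; simp)]
  let f : Fin m → M → ℝ := fun k z ↦ density g x z * component x V k z
  -- Extension by zero from the chart image to the whole space is still differentiable, because the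
  -- support lies in the compact image of `K`, away from the boundary of the chart.
  let F : Fin m → EuclideanSpace ℝ (Fin m) → ℝ := fun k ↦
    c.target.indicator fun z ↦ f k (c.symm z)
  have hKc : IsCompact (c '' K) := hK.image_of_continuousOn (c.continuousOn.mono hKx)
  have hF0 : ∀ k, ∀ z ∉ c '' K, F k z = 0 := by
    intro k z hz
    by_cases hzt : z ∈ c.target
    · have : c.symm z ∉ K := fun h ↦ hz ⟨_, h, c.right_inv hzt⟩
      simp [F, f, component, indicator_of_mem hzt, h0 _ this]
    · simp [F, indicator_of_notMem hzt]
  have hloc : ∀ k, ∀ z ∈ c.target, F k =ᶠ[𝓝 z] f k ∘ c.symm := by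
    intro k z hz
    filter_upwards [c.open_target.mem_nhds hz] with w hw
    simp [F, indicator_of_mem hw]
  have hf : ∀ k, ∀ y ∈ dom m x, ContMDiffAt (𝓡 m) 𝓘(ℝ, ℝ) ∞ (f k) y := fun k y hy ↦
    (contMDiffAt_density g hy).mul (contMDiffAt_component hy (hV y) k)
  have hFd : ∀ k, ContDiff ℝ 1 (F k) := by
    intro k
    refine contDiff_iff_contDiffAt.mpr fun z ↦ ?_
    by_cases hz : z ∈ c.target
    · have h1 : ContMDiffAt 𝓘(ℝ, EuclideanSpace ℝ (Fin m)) 𝓘(ℝ, ℝ) ∞ (f k ∘ c.symm) z :=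
        (hf k _ (c.map_target hz)).comp z
          ((contMDiffOn_chart_symm (I := 𝓡 m)).contMDiffAt (c.open_target.mem_nhds hz))
      exact ((contMDiffAt_iff_contDiffAt.mp h1).of_le (by simp)).congr_of_eventuallyEq (hloc k z hz)
    · have hz' : z ∉ c '' K := fun ⟨y, hy, h⟩ ↦ hz (h ▸ c.map_source (hKx hy))
      refine (contDiffAt_const (c := (0 : ℝ))).congr_of_eventuallyEq ?_
      filter_upwards [hKc.isClosed.isOpen_compl.mem_nhds hz'] with w hw using hF0 k w hw
  have hFc : ∀ k, HasCompactSupport (F k) := fun k ↦ HasCompactSupport.intro hKc (hF0 k)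
  have hmain : ∀ z ∈ c.target, density g x (c.symm z) *
      LinearMap.trace ℝ _ (leviCivita g V (c.symm z)).toLinearMap =
        ∑ k, fderiv ℝ (F k) z (EuclideanSpace.single k 1) := by
    intro z hz
    have hz' := c.map_target hz
    rw [← sum_mvfderiv_density_mul g hz' (hV _)]
    refine Finset.sum_congr rfl fun k _ ↦ ?_
    have h1 := hasFDerivAt_comp_chart_symm hz' ((hf k _ hz').mdifferentiableAt (by simp))
    change HasFDerivAt (f k ∘ c.symm) _ (c (c.symm z)) at h1
    rw [c.right_inv hz] at h1
    rw [(h1.congr_of_eventuallyEq (hloc k z hz)).fderiv]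
    rfl
  change ∫ z in c.target, density g x (c.symm z) *
    LinearMap.trace ℝ _ (leviCivita g V (c.symm z)).toLinearMap = 0
  rw [setIntegral_congr_fun c.open_target.measurableSet hmain,
    setIntegral_eq_integral_of_forall_compl_eq_zero, integral_finsetSum]
  · exact Finset.sum_eq_zero fun k _ ↦ integral_fderiv_eq_zero volume (hFd k) (hFc k) _
  · exact fun k _ ↦ (((hFd k).continuous_fderiv (by simp)).clm_apply
      continuous_const).integrable_of_hasCompactSupport ((hFc k).fderiv_apply ℝ _)
  · intro z hz
    have hz' : z ∉ c '' K := fun ⟨y, hy, h⟩ ↦ hz (h ▸ c.map_source (hKx hy))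
    refine Finset.sum_eq_zero fun k _ ↦ ?_
    have : F k =ᶠ[𝓝 z] fun _ ↦ (0 : ℝ) := by
      filter_upwards [hKc.isClosed.isOpen_compl.mem_nhds hz'] with w hw using hF0 k w hw
    rw [this.fderiv_eq]
    simp

/-- The divergence theorem for compactly supported vector fields. -/
theorem integral_divergence_eq_zero {V : Π y : M, TangentSpace (𝓡 m) y}
    (hV : ∀ y, SmoothAt V y) {K : Set M} (hK : IsCompact K) (h0 : ∀ y ∉ K, V y = 0) :
    ∫ y, LinearMap.trace ℝ _ (leviCivita g V y).toLinearMap ∂(volumeMeasure g) = 0 := by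
  have : LocallyCompactSpace M := ChartedSpace.locallyCompactSpace (EuclideanSpace ℝ (Fin m)) M
  obtain ⟨ρ, hρ⟩ := SmoothPartitionOfUnity.exists_isSubordinate_chartAt_source (𝓡 m) M
  -- Local finiteness leaves only finitely many cut-offs that meet the support of `V`, so `V` is a
  -- finite sum of fields each supported in one chart.
  have hfin : {i | (Function.support (ρ i) ∩ K).Nonempty}.Finite :=
    ρ.locallyFinite.finite_nonempty_inter_compact hK
  set s := hfin.toFinset
  have hVs : V = fun y ↦ ∑ i ∈ s, ρ i y • V y := by
    funext y
    by_cases hy : y ∈ K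
    · have h1 : ∑ᶠ i, ρ i y = ∑ i ∈ s, ρ i y := finsum_eq_sum_of_support_subset _ fun i hi ↦ by
        simp only [s, Finite.coe_toFinset, mem_ofPred_eq]
        exact ⟨y, hi, hy⟩
      rw [← Finset.sum_smul, ← h1, ρ.sum_eq_one (mem_univ y), one_smul]
    · simp [h0 y hy]
  have hsm : ∀ i y, SmoothAt (fun y ↦ ρ i y • V y) y := fun i y ↦
    SmoothAlong.smul ((ρ i).contMDiff y) (hV y)
  have hK' : ∀ i, ∀ y ∉ K ∩ tsupport (ρ i), ρ i y • V y = 0 := fun i y hy ↦ by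
    by_cases h : y ∈ K
    · rw [image_eq_zero_of_notMem_tsupport fun h' ↦ hy ⟨h, h'⟩, zero_smul]
    · rw [h0 y h, smul_zero]
  have hint : ∀ i, Integrable (fun y ↦ LinearMap.trace ℝ _
      (leviCivita g (fun y ↦ ρ i y • V y) y).toLinearMap) (volumeMeasure g) := fun i ↦ by
    refine Continuous.integrable_of_hasCompactSupport (continuous_iff_continuousAt.mpr fun y ↦
      (contMDiffAt_trace_leviCivita g (hsm i y)).continuousAt)
      (HasCompactSupport.intro hK fun y hy ↦ ?_)
    rw [leviCivita_of_eventually_zero g]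
    · simp
    · filter_upwards [hK.isClosed.isOpen_compl.mem_nhds hy] with z hz
      rw [h0 z hz, smul_zero]
  have hsum : ∀ y, LinearMap.trace ℝ _ (leviCivita g V y).toLinearMap =
      ∑ i ∈ s, LinearMap.trace ℝ _ (leviCivita g (fun y ↦ ρ i y • V y) y).toLinearMap := by
    intro y
    conv_lhs => rw [hVs]
    rw [cov_sum (leviCivita g) s (X := fun i y ↦ ρ i y • V y) fun i _ ↦ hsm i y]
    simp only [trace_eq_sum g (mem_chart_source (EuclideanSpace ℝ (Fin m)) y), _root_.sum_apply,
      map_sum]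
    rw [Finset.sum_comm]
  simp only [hsum]
  rw [integral_finsetSum _ fun i _ ↦ hint i]
  exact Finset.sum_eq_zero fun i _ ↦ integral_divergence_eq_zero_of_subset g (hsm i)
    (hK.inter_right (isClosed_tsupport _)) (inter_subset_right.trans (hρ i)) (hK' i)

end Divergence

/-! ### The Lagrangian along smooth families of tensors -/

section Lagrangian

variable {m : ℕ} {M : Type*} [TopologicalSpace M] [ChartedSpace (EuclideanSpace ℝ (Fin m)) M]
  [IsManifold (𝓡 m) ∞ M]
  {EN : Type*} [NormedAddCommGroup EN] [NormedSpace ℝ EN] {HN : Type*} [TopologicalSpace HN]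
  {J : ModelWithCorners ℝ EN HN} {N : Type*} [TopologicalSpace N] [ChartedSpace HN N]

omit [IsManifold (𝓡 m) ∞ M] in
theorem bilin_eq_sum_smulRightL (A : EuclideanSpace ℝ (Fin m) →L[ℝ] EuclideanSpace ℝ (Fin m) →L[ℝ]
    EuclideanSpace ℝ (Fin m)) :
    A = ∑ k, ∑ l, ((ContinuousLinearMap.smulRightL ℝ (EuclideanSpace ℝ (Fin m)) _
        (EuclideanSpace.proj k : EuclideanSpace ℝ (Fin m) →L[ℝ] ℝ)) ∘L
      (ContinuousLinearMap.smulRightL ℝ (EuclideanSpace ℝ (Fin m)) (EuclideanSpace ℝ (Fin m))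
        (EuclideanSpace.proj l : EuclideanSpace ℝ (Fin m) →L[ℝ] ℝ)))
      (A (EuclideanSpace.single k 1) (EuclideanSpace.single l 1)) := by
  ext1 u
  ext1 v
  conv_lhs => rw [← (EuclideanSpace.basisFun (Fin m) ℝ).sum_repr u,
    ← (EuclideanSpace.basisFun (Fin m) ℝ).sum_repr v]
  simp only [EuclideanSpace.basisFun_apply, EuclideanSpace.basisFun_repr, map_sum, map_smul,
    _root_.sum_apply, _root_.smul_apply, Finset.smul_sum]
  rw [Finset.sum_comm]
  refine Finset.sum_congr rfl fun k _ ↦ Finset.sum_congr rfl fun l _ ↦ ?_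
  simp [smul_smul, mul_comm]

/-- A Lagrangian is smooth along a family of tensors with smooth components in a chart. -/
theorem IsLagrangian.contMDiffAt {L : Tensor12Bundle m M → ℝ} (hL : IsLagrangian L) {b : N → M}
    {T : Π q : N, Tensor12 (m := m) (b q)} {q₀ : N} (hb : ContMDiffAt J (𝓡 m) ∞ b q₀)
    (hT : ∀ k l : Fin m, ContMDiffAt J (𝓡 m) ∞ (fun q ↦ inChart (b q₀) (b q)
      (T q (ofChart (b q₀) (b q) (EuclideanSpace.single k 1))
        (ofChart (b q₀) (b q) (EuclideanSpace.single l 1)))) q₀) :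
    ContMDiffAt J 𝓘(ℝ, ℝ) ∞ (fun q ↦ L ⟨b q, T q⟩) q₀ := by
  refine ContMDiffAt.comp (g := L) q₀ (hL _) ?_
  refine (contMDiffAt_hom_bundle (F₁ := EuclideanSpace ℝ (Fin m))
    (E₁ := (TangentSpace (𝓡 m) : M → Type _))
    (F₂ := EuclideanSpace ℝ (Fin m) →L[ℝ] EuclideanSpace ℝ (Fin m))
    (E₂ := fun x : M ↦ TangentSpace (𝓡 m) x →L[ℝ] TangentSpace (𝓡 m) x) (IB := 𝓡 m)
    (fun q ↦ (⟨b q, T q⟩ : Tensor12Bundle m M))).mpr ⟨hb, ?_⟩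
  -- Smoothness of the coordinate expression of the tensor is reduced to its values on basis
  -- vectors, which is what `hT` controls.
  rw [funext fun q ↦ bilin_eq_sum_smulRightL (ContinuousLinearMap.inCoordinates _ _ _ _ _ _ _ _ _)]
  refine contMDiffAt_finsetSum fun k _ ↦ contMDiffAt_finsetSum fun l _ ↦ ?_
  refine ContMDiffAt.comp (g := fun c ↦ ((ContinuousLinearMap.smulRightL ℝ (EuclideanSpace ℝ (Fin m)) _
        (EuclideanSpace.proj k : EuclideanSpace ℝ (Fin m) →L[ℝ] ℝ)) ∘L
      (ContinuousLinearMap.smulRightL ℝ (EuclideanSpace ℝ (Fin m)) (EuclideanSpace ℝ (Fin m))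
        (EuclideanSpace.proj l : EuclideanSpace ℝ (Fin m) →L[ℝ] ℝ))) c) q₀
    (ContinuousLinearMap.contMDiff _ _) ((hT k l).congr_of_eventuallyEq ?_)
  filter_upwards [hb.continuousAt.preimage_mem_nhds
    (dom_mem_nhds (mem_chart_source (EuclideanSpace ℝ (Fin m)) (b q₀)))] with q hq
  rw [inCoordinates_apply_eq₂ hq hq hq]
  simp only [inChart, ofChart]
  rw [Trivialization.linearMapAt_apply, if_pos (by exact hq), Trivialization.continuousLinearMapAt_apply_of_mem (R := ℝ) _ hq,
   Trivialization.symmL_apply (R := ℝ) _ hq, Trivialization.symmL_apply (R := ℝ) _ hq]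

/-- The (1,2)-tensor at `x` with given components in the chart at `x`. -/
def tensorOfChart (x : M) (A : EuclideanSpace ℝ (Fin m) →L[ℝ] EuclideanSpace ℝ (Fin m) →L[ℝ]
    EuclideanSpace ℝ (Fin m)) : Tensor12 (m := m) x :=
  (LinearMap.mk₂ ℝ (fun u v ↦ ofChart x x (A (inChart x x u) (inChart x x v)))
    (by simp) (by simp) (by simp) (by simp)).toContinuousBilinearMap

/-- The components of a (1,2)-tensor at `x` in the chart at `x`. -/
def tensorInChart (x : M) : Tensor12 (m := m) x →ₗ[ℝ]
    (EuclideanSpace ℝ (Fin m) →L[ℝ] EuclideanSpace ℝ (Fin m) →L[ℝ] EuclideanSpace ℝ (Fin m)) where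
  toFun T := (LinearMap.mk₂ ℝ (fun u v ↦ inChart x x (T (ofChart x x u) (ofChart x x v)))
    (by simp) (by simp) (by simp) (by simp)).toContinuousBilinearMap
  map_add' S T := by ext u v : 2; simp
  map_smul' c T := by ext u v : 2; simp

theorem tensorOfChart_tensorInChart (x : M) (T : Tensor12 (m := m) x) :
    tensorOfChart x (tensorInChart x T) = T := by
  ext u v : 2
  change ofChart x x (inChart x x (T (ofChart x x (inChart x x u)) (ofChart x x (inChart x x v)))) = _
  simp only [ofChart_inChart_self]

theorem IsLagrangian.contDiff_tensorOfChart {L : Tensor12Bundle m M → ℝ} (hL : IsLagrangian L)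
    (x : M) : ContDiff ℝ ∞ (fun A ↦ L ⟨x, tensorOfChart x A⟩) := by
  rw [← contMDiff_iff_contDiff]
  intro A₀
  refine hL.contMDiffAt (b := fun _ ↦ x) contMDiffAt_const fun k l ↦ ?_
  have hx := mem_chart_source (EuclideanSpace ℝ (Fin m)) x
  have : ∀ A, inChart x x (tensorOfChart x A (ofChart x x (EuclideanSpace.single k 1))
      (ofChart x x (EuclideanSpace.single l 1))) =
      A (EuclideanSpace.single k 1) (EuclideanSpace.single l 1) := fun A ↦ by
    change inChart x x (ofChart x x (A (inChart x x (ofChart x x _))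
      (inChart x x (ofChart x x _)))) = _
    simp only [inChart_ofChart hx]
  simp only [this]
  exact (contMDiffAt_id.clm_apply contMDiffAt_const).clm_apply contMDiffAt_const

/-- The derivative of a Lagrangian in the fiber over `x`. -/
def fiberDeriv (L : Tensor12Bundle m M → ℝ) (x : M) (T : Tensor12 (m := m) x) :
    Tensor12 (m := m) x →ₗ[ℝ] ℝ :=
  (fderiv ℝ (fun A ↦ L ⟨x, tensorOfChart x A⟩) (tensorInChart x T)).toLinearMap ∘ₗ tensorInChart x

omit [IsManifold (𝓡 m) ∞ M] in
theorem hasDerivAt_comp_of_contDiff {F : Type*} [NormedAddCommGroup F] [NormedSpace ℝ F] {f : F → ℝ}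
    (hf : ContDiff ℝ ∞ f) {c : ℝ → F} {c' : F} {t : ℝ} (hc : HasDerivAt c c' t) :
    HasDerivAt (fun s ↦ f (c s)) (fderiv ℝ f (c t) c') t :=
  (hf.differentiable (by simp) (c t)).hasFDerivAt.comp_hasDerivAt t hc

theorem hasDerivAt_add_smul {F : Type*} [NormedAddCommGroup F] [NormedSpace ℝ F] (u v : F) (t : ℝ) :
    HasDerivAt (fun s : ℝ ↦ u + s • v) v t := by
  simpa using ((hasDerivAt_id t).smul_const v).const_add u

/-- The chain rule inside one fibre, carried out in the normed space of components in the chart at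
`x`. -/
theorem IsLagrangian.hasDerivAt_comp {L : Tensor12Bundle m M → ℝ} (hL : IsLagrangian L) {x : M}
    {T : ℝ → Tensor12 (m := m) x} {S : Tensor12 (m := m) x} {t : ℝ}
    (hT : HasDerivAt (fun s ↦ tensorInChart x (T s)) (tensorInChart x S) t) :
    HasDerivAt (fun s ↦ L ⟨x, T s⟩) (fiberDeriv L x (T t) S) t := by
  have h := hasDerivAt_comp_of_contDiff (hL.contDiff_tensorOfChart x) hT
  simp only [tensorOfChart_tensorInChart] at h
  exact h

/-- Identifies the directional derivatives used in the spin tensor with one linear form on tensors,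
which provides their linearity in the direction. -/
theorem IsLagrangian.deriv_add_smul {L : Tensor12Bundle m M → ℝ} (hL : IsLagrangian L) {x : M}
    (T S : Tensor12 (m := m) x) :
    deriv (fun t : ℝ ↦ L ⟨x, T + t • S⟩) 0 = fiberDeriv L x T S := by
  have h := hL.hasDerivAt_comp (T := fun t ↦ T + t • S) (S := S) (t := 0) (x := x) (by
    simp only [map_add, map_smul]
    exact hasDerivAt_add_smul (tensorInChart x T) (tensorInChart x S) 0)
  have e : T + (0 : ℝ) • S = T := by ext u v : 2; simp
  rw [h.deriv, e]

/-- The value `ξ, η ↦ ⟨w, η⟩ ξ - ⟨ξ, η⟩ w` at `x` of a semi-symmetric contorsion tensor. -/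
def semiSymmetricTensor (g : PseudoRiemannianMetric m M) (x : M) :
    TangentSpace (𝓡 m) x →ₗ[ℝ] Tensor12 (m := m) x where
  toFun w := semiSymmetricContorsion g (fun y ↦ localExt w y) x
  map_add' v w := by
    ext u z : 2
    simp [semiSymmetricContorsion]
    module
  map_smul' c v := by
    ext u z : 2
    simp [semiSymmetricContorsion, mul_smul, smul_sub, smul_comm c]

variable (g : PseudoRiemannianMetric m M)

theorem semiSymmetricTensor_apply {x : M} (w u v : TangentSpace (𝓡 m) x) :
    semiSymmetricTensor g x w u v = g.val x w v • u - g.val x u v • w := by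
  simp [semiSymmetricTensor, semiSymmetricContorsion]

theorem semiSymmetricContorsion_eq (U : Π y : M, TangentSpace (𝓡 m) y) (x : M) :
    semiSymmetricContorsion g U x = semiSymmetricTensor g x (U x) := by
  ext u v : 2
  rw [semiSymmetricTensor_apply]
  rfl

theorem IsLagrangian.contMDiffAt_semiSymmetricTensor {L : Tensor12Bundle m M → ℝ}
    (hL : IsLagrangian L) {b : N → M} {w : Π q : N, TangentSpace (𝓡 m) (b q)} {q₀ : N}
    (hw : SmoothAlong J b w q₀) :
    ContMDiffAt J 𝓘(ℝ, ℝ) ∞ (fun q ↦ L ⟨b q, semiSymmetricTensor g (b q) (w q)⟩) q₀ := by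
  have hx := mem_chart_source (EuclideanSpace ℝ (Fin m)) (b q₀)
  have hc : ∀ k : Fin m, SmoothAlong J b
      (fun q ↦ ofChart (b q₀) (b q) (EuclideanSpace.single k 1)) q₀ := fun k ↦
    smoothAlong_ofChart hx hw.base contMDiffAt_const
  refine hL.contMDiffAt hw.base fun k l ↦ ?_
  simp only [semiSymmetricTensor_apply]
  exact SmoothAlong.inChart (SmoothAlong.sub (SmoothAlong.smul (contMDiffAt_metric g hw (hc l)) (hc k))
    (SmoothAlong.smul (contMDiffAt_metric g (hc k) (hc l)) hw)) hx

/-- The derivative of a smooth function in a real parameter is smooth. -/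
theorem contMDiffAt_deriv_fst {ψ : ℝ × M → ℝ} {q₀ : ℝ × M}
    (hψ : ContMDiffAt (𝓘(ℝ, ℝ).prod (𝓡 m)) 𝓘(ℝ, ℝ) ∞ ψ q₀) :
    ContMDiffAt (𝓘(ℝ, ℝ).prod (𝓡 m)) 𝓘(ℝ, ℝ) ∞ (fun q ↦ deriv (fun s ↦ ψ (s, q.2)) q.1) q₀ := by
  have : IsManifold (𝓡 m) 1 M := inferInstance
  have h := ContMDiffAt.mfderiv (I := 𝓘(ℝ, ℝ)) (I' := 𝓘(ℝ, ℝ)) (J := 𝓘(ℝ, ℝ).prod (𝓡 m)) (n := ∞) (m := ∞)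
    (f := fun (q : ℝ × M) (s : ℝ) ↦ ψ (s, q.2)) (g := Prod.fst) (x₀ := q₀)
    (ContMDiffAt.comp (g := ψ) (f := fun r : (ℝ × M) × ℝ ↦ (r.2, r.1.2)) (q₀, q₀.1) hψ
      -- The point of `M` is treated as a parameter and the real variable as the variable of
      -- differentiation; the partial derivative is smooth in both jointly.
      (contMDiffAt_snd.prodMk (contMDiffAt_snd.comp _ contMDiffAt_fst)))
    contMDiffAt_fst (by simp)
  have h1 : ContMDiffAt (𝓘(ℝ, ℝ).prod (𝓡 m)) 𝓘(ℝ, ℝ →L[ℝ] ℝ) ∞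
      (fun q : ℝ × M ↦ fderiv ℝ (fun s ↦ ψ (s, q.2)) q.1) q₀ := by
    refine h.congr_of_eventuallyEq (Eventually.of_forall fun q ↦ ?_)
    simp only [mfderiv_eq_fderiv]
    exact (congrFun (inTangentCoordinates_model_space (I := 𝓘(ℝ, ℝ)) (I' := 𝓘(ℝ, ℝ)) (N := ℝ × M) Prod.fst
      (fun x ↦ ψ (x.1, x.2)) (fun x ↦ fderiv ℝ (fun s ↦ ψ (s, x.2)) x.1) q₀) q).symm
  exact h1.clm_apply (contMDiffAt_const (c := (1 : ℝ)))

end Lagrangian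

/-! ### The spin tensor and semi-symmetric directions -/

section Spin

variable {n p : ℕ} {M : Type*} [TopologicalSpace M]
  [ChartedSpace (EuclideanSpace ℝ (Fin (n + p))) M] [IsManifold (𝓡 (n + p)) ∞ M]
  {g : PseudoRiemannianMetric (n + p) M} (D : NondegenerateDistribution g)

/-- Expanding the identity and the metric in the frame writes the semi-symmetric direction through
the same elementary tensors that occur in the contraction `s(·,·)`, with the opposite sign. -/
theorem semiSymmetricTensor_eq_sum {x : M} (V : TangentSpace (𝓡 (n + p)) x) :
    semiSymmetricTensor g x V = ∑ l, eps g ((frame D x).vec l) •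
      (elementaryTensor g ((frame D x).vec l) V ((frame D x).vec l) -
        elementaryTensor g ((frame D x).vec l) ((frame D x).vec l) V) := by
  ext u v : 2
  have h1 := (frame D x).expand u
  have h2 := congrArg (fun z ↦ g.val x z v) ((frame D x).expand u)
  simp only [map_sum, map_smul, _root_.sum_apply, _root_.smul_apply, smul_eq_mul] at h2
  simp only [semiSymmetricTensor_apply, _root_.sum_apply, _root_.smul_apply, _root_.sub_apply,
    elementaryTensor, ContinuousLinearMap.smulRight_apply, smul_sub, Finset.sum_sub_distrib,
    smul_smul]
  rw [← h2, Finset.sum_smul]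
  congr 1
  · conv_lhs => rw [← h1, Finset.smul_sum]
    refine Finset.sum_congr rfl fun l _ ↦ ?_
    rw [smul_smul, g.symm x u]
    ring_nf
  · refine Finset.sum_congr rfl fun l _ ↦ ?_
    rw [g.symm x u]

/-- The spin tensor is given by its frame components only; linearity of the fibre derivative extends
the pairing from frame vectors to every `Z`. -/
theorem val_spinTensor {L : Tensor12Bundle (n + p) M → ℝ} (hL : IsLagrangian L)
    (T : Π x : M, Tensor12 (m := n + p) x) {x : M} (X Y Z : TangentSpace (𝓡 (n + p)) x) :
    g.val x (spinTensor D L T x X Y) Z = 2 * fiberDeriv L x (T x) (elementaryTensor g X Y Z) := by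
  have h : elementaryTensor g X Y Z = ∑ l, (eps g ((frame D x).vec l) *
      g.val x Z ((frame D x).vec l)) • elementaryTensor g X Y ((frame D x).vec l) := by
    ext u v : 2
    conv_lhs => rw [← (frame D x).expand Z]
    simp only [elementaryTensor, ContinuousLinearMap.smulRight_apply, _root_.sum_apply,
      _root_.smul_apply, Finset.smul_sum, smul_smul]
    refine Finset.sum_congr rfl fun l _ ↦ ?_
    ring_nf
  rw [h]
  simp only [spinTensor, hL.deriv_add_smul, map_sum, map_smul, _root_.sum_apply, _root_.smul_apply,
    smul_eq_mul, Finset.mul_sum]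
  refine Finset.sum_congr rfl fun l _ ↦ ?_
  rw [g.symm x Z]
  ring

/-- The contraction of the spin tensor represents the derivative of the Lagrangian along
semi-symmetric contorsion tensors. -/
theorem val_spinVector {L : Tensor12Bundle (n + p) M → ℝ} (hL : IsLagrangian L)
    (T : Π x : M, Tensor12 (m := n + p) x) {x : M} (V : TangentSpace (𝓡 (n + p)) x) :
    g.val x (spinVector D L T x) V = -2 * fiberDeriv L x (T x) (semiSymmetricTensor g x V) := by
  -- The definition of the spin vector evaluates the middle slot on frame vectors only, so `V` has
  -- to be expanded there as well.
  have h : ∀ l, elementaryTensor g ((frame D x).vec l) V ((frame D x).vec l) =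
      ∑ k, (eps g ((frame D x).vec k) * g.val x V ((frame D x).vec k)) •
        elementaryTensor g ((frame D x).vec l) ((frame D x).vec k) ((frame D x).vec l) := by
    intro l
    ext u v : 2
    conv_lhs => rw [← (frame D x).expand V]
    simp only [elementaryTensor, ContinuousLinearMap.smulRight_apply, _root_.sum_apply,
      _root_.smul_apply, smul_smul, map_sum, map_smul, Finset.sum_smul, smul_eq_mul,
      Finset.smul_sum]
    refine Finset.sum_congr rfl fun k _ ↦ ?_
    ring_nf
  rw [semiSymmetricTensor_eq_sum D]
  simp only [h]
  simp only [spinVector, map_sum, map_smul, map_sub, _root_.sum_apply, _root_.smul_apply,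
    _root_.sub_apply, smul_eq_mul, val_spinTensor D hL, Finset.mul_sum]
  refine Finset.sum_congr rfl fun l _ ↦ ?_
  simp only [mul_sub, Finset.mul_sum]
  have e : ∀ k, g.val x ((frame D x).vec k) V = g.val x V ((frame D x).vec k) := fun k ↦ g.symm _ _ _
  simp only [e]
  have e' : ∀ A B A' B' : ℝ, A' = -A → B' = -B → B - A = A' - B' := by
    intros; subst_vars; ring
  refine e' _ _ _ _ ?_ (by ring)
  rw [← Finset.sum_neg_distrib]
  exact Finset.sum_congr rfl fun k _ ↦ by ring

end Spin

/-! ### The variation of the action -/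

section Variation

variable {n p : ℕ} {M : Type*} [TopologicalSpace M]
  [ChartedSpace (EuclideanSpace ℝ (Fin (n + p))) M] [IsManifold (𝓡 (n + p)) ∞ M]
  {EN : Type*} [NormedAddCommGroup EN] [NormedSpace ℝ EN] {HN : Type*} [TopologicalSpace HN]
  {J : ModelWithCorners ℝ EN HN} {N : Type*} [TopologicalSpace N] [ChartedSpace HN N]
  {g : PseudoRiemannianMetric (n + p) M} (D : NondegenerateDistribution g)
  (a Λ : ℝ) (L : Tensor12Bundle (n + p) M → ℝ)

/-- The part of the integrand of the action on semi-symmetric connections that depends on the value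
of the vector field only. -/
def potential (x : M) (w : TangentSpace (𝓡 (n + p)) x) : ℝ :=
  -(1 / (2 * a)) * ((p - n) * (g.val x (meanCurvaturePerp D x) w - g.val x (meanCurvature D x) w) +
    p * (n - 1) * g.val x (D.top x w) (D.top x w) +
    n * (p - 1) * g.val x (D.bot x w) (D.bot x w)) + L ⟨x, semiSymmetricTensor g x w⟩

/-- The weighted vector field whose divergence is the remaining part of the integrand. -/
def weighted (U : Π x : M, TangentSpace (𝓡 (n + p)) x) (x : M) : TangentSpace (𝓡 (n + p)) x :=
  (p : ℝ) • D.top x (U x) + (n : ℝ) • D.bot x (U x)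

/-- The difference of the two sides of the Euler-Lagrange equations. -/
def eulerField (U : Π x : M, TangentSpace (𝓡 (n + p)) x) (x : M) : TangentSpace (𝓡 (n + p)) x :=
  ((2 * p * (n - 1) : ℝ) • D.top x (U x) - (n - p : ℝ) • meanCurvaturePerp D x) +
    ((2 * n * (p - 1) : ℝ) • D.bot x (U x) - (p - n : ℝ) • meanCurvature D x) +
    a • spinVector D L (semiSymmetricContorsion g U) x

variable {L}

theorem smoothAt_weighted {U : Π x : M, TangentSpace (𝓡 (n + p)) x} {x : M} (hU : SmoothAt U x) :
    SmoothAt (weighted D U) x :=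
  SmoothAlong.add (SmoothAlong.const_smul _ (D.smoothAt_top hU))
    (SmoothAlong.const_smul _ (D.smoothAt_bot hU))

/-- All derivatives of `U` are collected in one divergence, by the weighted trace formula with
weights `p` and `n`; the remainder sees only the value of `U` at the point. -/
theorem integrand_eq {U : Π x : M, TangentSpace (𝓡 (n + p)) x} {x : M} (hU : SmoothAt U x) :
    1 / (2 * a) * (mixedScalarCurvature D (connectionOf g (semiSymmetricContorsion g U)) x - 2 * Λ) +
        L ⟨x, semiSymmetricContorsion g U x⟩ =
      1 / (2 * a) * (mixedScalarCurvature D (leviCivita g) x - 2 * Λ) -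
        1 / (2 * a) * LinearMap.trace ℝ _ (leviCivita g (weighted D U) x).toLinearMap +
        potential D a L x (U x) := by
  rw [mixedScalarCurvature_semiSymmetric hU, traceTop_traceBot_leviCivita D hU,
    semiSymmetricContorsion_eq]
  unfold potential weighted
  ring

theorem contMDiffAt_potential (hL : IsLagrangian L) {b : N → M}
    {w : Π q : N, TangentSpace (𝓡 (n + p)) (b q)} {q₀ : N} (hw : SmoothAlong J b w q₀) :
    ContMDiffAt J 𝓘(ℝ, ℝ) ∞ (fun q ↦ potential D a L (b q) (w q)) q₀ := by
  have hH := contMDiffAt_metric g ((smoothAt_meanCurvature D (b q₀)).comp hw.base) hw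
  have hH' := contMDiffAt_metric g ((smoothAt_meanCurvaturePerp D (b q₀)).comp hw.base) hw
  have ht := contMDiffAt_metric g (D.smoothAlong_top hw) (D.smoothAlong_top hw)
  have hb := contMDiffAt_metric g (D.smoothAlong_bot hw) (D.smoothAlong_bot hw)
  exact (contMDiffAt_const.mul (((contMDiffAt_const.mul (hH'.sub hH)).add
    (contMDiffAt_const.mul ht)).add (contMDiffAt_const.mul hb))).add
    (hL.contMDiffAt_semiSymmetricTensor g hw)

theorem hasDerivAt_linear {F : Type*} [NormedAddCommGroup F] [NormedSpace ℝ F] {x : M}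
    (ℓ : TangentSpace (𝓡 (n + p)) x →ₗ[ℝ] F) {w : ℝ → TangentSpace (𝓡 (n + p)) x}
    {v : TangentSpace (𝓡 (n + p)) x} {t : ℝ}
    (hw : HasDerivAt (fun s ↦ inChart x x (w s)) (inChart x x v) t) :
    HasDerivAt (fun s ↦ ℓ (w s)) (ℓ v) t := by
  have h := (LinearMap.toContinuousLinearMap
    (ℓ ∘ₗ (ofChart x x).toLinearMap)).hasFDerivAt.comp_hasDerivAt t hw
  simpa [Function.comp_def, ofChart_inChart_self] using h

/-- The field `eulerField` is, up to the factor `-1/(2𝔞)`, the fibrewise gradient of the potential.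
The quadratic terms double and the mean curvature terms are linear. -/
theorem hasDerivAt_potential (hL : IsLagrangian L) (ha : a ≠ 0)
    {U : Π x : M, TangentSpace (𝓡 (n + p)) x} {x : M} {w : ℝ → TangentSpace (𝓡 (n + p)) x}
    {v : TangentSpace (𝓡 (n + p)) x} (hw : HasDerivAt (fun s ↦ inChart x x (w s)) (inChart x x v) 0)
    (h0 : w 0 = U x) :
    HasDerivAt (fun s ↦ potential D a L x (w s))
      (-(1 / (2 * a)) * g.val x (eulerField D a L U x) v) 0 := by
  have hq : ∀ P : TangentSpace (𝓡 (n + p)) x →ₗ[ℝ] TangentSpace (𝓡 (n + p)) x,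
      HasDerivAt (fun s ↦ g.val x (P (w s)) (P (w s))) (2 * g.val x (P (U x)) (P v)) 0 := fun P ↦ by
    let B : EuclideanSpace ℝ (Fin (n + p)) →L[ℝ] EuclideanSpace ℝ (Fin (n + p)) →L[ℝ] ℝ :=
      (LinearMap.mk₂ ℝ (fun u u' ↦ g.val x (P (ofChart x x u)) (P (ofChart x x u')))
        (by simp) (by simp) (by simp) (by simp)).toContinuousBilinearMap
    have hB : ∀ u u', B (inChart x x u) (inChart x x u') = g.val x (P u) (P u') := fun u u' ↦ by
      change g.val x (P (ofChart x x (inChart x x u))) (P (ofChart x x (inChart x x u'))) = _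
      simp only [ofChart_inChart_self]
    have h := (B.hasFDerivAt.comp_hasDerivAt (0 : ℝ) hw).clm_apply hw
    simp only [hB, Function.comp_apply, h0] at h
    rw [g.symm x (P v), ← two_mul] at h
    exact h
  have hT : HasDerivAt (fun s ↦ L ⟨x, semiSymmetricTensor g x (w s)⟩)
      (fiberDeriv L x (semiSymmetricTensor g x (w 0)) (semiSymmetricTensor g x v)) 0 := by
    have h := hasDerivAt_linear (F := EuclideanSpace ℝ (Fin (n + p)) →L[ℝ]
      EuclideanSpace ℝ (Fin (n + p)) →L[ℝ] EuclideanSpace ℝ (Fin (n + p))) ((tensorInChart (m := n + p) x).comp (semiSymmetricTensor g x)) hw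
    exact hL.hasDerivAt_comp h
  have hH := hasDerivAt_linear (g.val x (meanCurvature D x)).toLinearMap hw
  have hH' := hasDerivAt_linear (g.val x (meanCurvaturePerp D x)).toLinearMap hw
  have h := (((((hH'.sub hH).const_mul ((p : ℝ) - n)).add
    ((hq (D.top x)).const_mul ((p : ℝ) * (n - 1)))).add
    ((hq (D.bot x)).const_mul ((n : ℝ) * (p - 1)))).const_mul (-(1 / (2 * a)))).add hT
  refine h.congr_deriv ?_
  have hs := val_spinVector D hL (semiSymmetricContorsion g U) v
  rw [semiSymmetricContorsion_eq, ← h0] at hs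
  -- The factor `-2` in `val_spinVector` matches the common prefactor once `𝔞` is cancelled, which
  -- requires `𝔞 ≠ 0`.
  have hs' : fiberDeriv L x (semiSymmetricTensor g x (w 0)) (semiSymmetricTensor g x v) =
      -(1 / (2 * a)) * (a * g.val x (spinVector D L (semiSymmetricContorsion g U) x) v) := by
    rw [hs]; field_simp
  rw [hs']
  simp only [eulerField, map_add, map_sub, map_smul, _root_.add_apply, _root_.sub_apply,
    _root_.smul_apply, smul_eq_mul, D.val_top_left (U x) v, D.val_bot_left (U x) v,
    ContinuousLinearMap.coe_coe]
  ring

/-- Only the spin vector is not evidently smooth, being defined through the chosen frames. Its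
product with a coordinate field `b` is `-2` times the derivative at `s = 0` of the Lagrangian on the
tensors of `U + s b`, which is jointly smooth in `s` and the point. -/
theorem smoothAt_eulerField (hL : IsLagrangian L) {U : Π x : M, TangentSpace (𝓡 (n + p)) x}
    (hU : ∀ y, SmoothAt U y) (x : M) : SmoothAt (eulerField D a L U) x := by
  have hspin : SmoothAt (spinVector D L (semiSymmetricContorsion g U)) x := by
    refine smoothAt_of_val g fun k ↦ ?_
    have hx := mem_chart_source (EuclideanSpace ℝ (Fin (n + p))) x
    let b : Π y : M, TangentSpace (𝓡 (n + p)) y := coordField (n + p) x k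
    have h1 : SmoothAlong (𝓘(ℝ, ℝ).prod (𝓡 (n + p))) (fun q : ℝ × M ↦ q.2)
        (fun q ↦ U q.2 + q.1 • b q.2) (0, x) :=
      SmoothAlong.add (SmoothAt.comp (b := fun q : ℝ × M ↦ q.2) (hU x) contMDiffAt_snd)
        (SmoothAlong.smul contMDiffAt_fst
          (SmoothAt.comp (b := fun q : ℝ × M ↦ q.2) (smoothAt_coordField hx k) contMDiffAt_snd))
    have h2 := contMDiffAt_deriv_fst (hL.contMDiffAt_semiSymmetricTensor g h1)
    have h3 := ContMDiffAt.comp (I' := 𝓘(ℝ, ℝ).prod (𝓡 (n + p))) (f := fun y : M ↦ ((0 : ℝ), y)) x h2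
      (contMDiffAt_const.prodMk contMDiffAt_id)
    refine (contMDiffAt_const (c := (-2 : ℝ)) |>.mul h3).congr_of_eventuallyEq
      (Eventually.of_forall fun y ↦ ?_)
    change _ = -2 * deriv (fun s : ℝ ↦ L ⟨y, semiSymmetricTensor g y (U y + s • b y)⟩) 0
    simp only [map_add, map_smul]
    rw [val_spinVector D hL, semiSymmetricContorsion_eq, hL.deriv_add_smul]
  have hU' := hU x
  exact SmoothAlong.add (SmoothAlong.add
    (SmoothAlong.sub (SmoothAlong.const_smul _ (D.smoothAt_top hU'))
      (SmoothAlong.const_smul _ (smoothAt_meanCurvaturePerp D x)))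
    (SmoothAlong.sub (SmoothAlong.const_smul _ (D.smoothAt_bot hU'))
      (SmoothAlong.const_smul _ (smoothAt_meanCurvature D x)))) (SmoothAlong.const_smul _ hspin)

/-- The two Euler-Lagrange equations are the components of one equation. -/
theorem eulerField_eq_zero_iff (U : Π x : M, TangentSpace (𝓡 (n + p)) x) (x : M) :
    eulerField D a L U x = 0 ↔
      (2 * p * (n - 1) : ℝ) • D.top x (U x) - (n - p : ℝ) • meanCurvaturePerp D x =
          (-a) • D.top x (spinVector D L (semiSymmetricContorsion g U) x) ∧
      (2 * n * (p - 1) : ℝ) • D.bot x (U x) - (p - n : ℝ) • meanCurvature D x =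
          (-a) • D.bot x (spinVector D L (semiSymmetricContorsion g U) x) := by
  have e1 : D.top x (eulerField D a L U x) =
      (2 * p * (n - 1) : ℝ) • D.top x (U x) - (n - p : ℝ) • meanCurvaturePerp D x +
        a • D.top x (spinVector D L (semiSymmetricContorsion g U) x) := by
    simp only [eulerField, map_add, map_sub, map_smul, D.top_of_mem (D.top_mem (U x)),
      D.top_of_mem (meanCurvaturePerp_mem D x), D.top_of_mem_perp (D.bot_mem (U x)),
      D.top_of_mem_perp (meanCurvature_mem D x)]
    module
  have e2 : D.bot x (eulerField D a L U x) =
      (2 * n * (p - 1) : ℝ) • D.bot x (U x) - (p - n : ℝ) • meanCurvature D x +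
        a • D.bot x (spinVector D L (semiSymmetricContorsion g U) x) := by
    simp only [eulerField, map_add, map_sub, map_smul, D.bot_of_mem (D.bot_mem (U x)),
      D.bot_of_mem (meanCurvature_mem D x), D.bot_of_mem_space (D.top_mem (U x)),
      D.bot_of_mem_space (meanCurvaturePerp_mem D x)]
    module
  rw [neg_smul, neg_smul, ← add_eq_zero_iff_eq_neg, ← add_eq_zero_iff_eq_neg, ← e1, ← e2]
  refine ⟨fun h ↦ by rw [h, map_zero, map_zero]; exact ⟨rfl, rfl⟩, fun ⟨h1, h2⟩ ↦ ?_⟩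
  rw [← D.top_add_bot (eulerField D a L U x), h1, h2, add_zero]

/-! ### First variation and the fundamental lemma -/

section Integral

variable [T2Space M] [SecondCountableTopology M] [Nonempty M] [MeasurableSpace M] [BorelSpace M]

/-- The difference of the two weighted fields vanishes off `K`, so its divergence integrates to zero
and the two actions differ only through the potential. Compactness of the closure of `Ω` makes every
piece integrable, so the integral may be split. -/
theorem mixedAction_sub (hL : IsLagrangian L) {U W : Π x : M, TangentSpace (𝓡 (n + p)) x}
    (hU : ∀ x, SmoothAt U x) (hW : ∀ x, SmoothAt W x) {Ω K : Set M}
    (hΩc : IsCompact (closure Ω)) (hKΩ : K ⊆ Ω) (hK : IsCompact K) (hUW : ∀ x ∉ K, W x = U x) :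
    mixedAction D a Λ L Ω (semiSymmetricContorsion g W) =
      mixedAction D a Λ L Ω (semiSymmetricContorsion g U) +
        ((∫ x in Ω, potential D a L x (W x) ∂(volumeMeasure g)) -
          ∫ x in Ω, potential D a L x (U x) ∂(volumeMeasure g)) := by
  have hint : ∀ f : M → ℝ, (∀ x, ContMDiffAt (𝓡 (n + p)) 𝓘(ℝ, ℝ) ∞ f x) →
      IntegrableOn f Ω (volumeMeasure g) := fun f hf ↦
    ((continuous_iff_continuousAt.mpr fun x ↦ (hf x).continuousAt).continuousOn.integrableOn_compact
      hΩc).mono_set subset_closure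
  let A : M → ℝ := fun x ↦ 1 / (2 * a) * (mixedScalarCurvature D (leviCivita g) x - 2 * Λ)
  let tr : (Π x : M, TangentSpace (𝓡 (n + p)) x) → M → ℝ := fun V x ↦
    LinearMap.trace ℝ _ (leviCivita g (weighted D V) x).toLinearMap
  have hA := hint A fun x ↦
    contMDiffAt_const.mul ((contMDiffAt_mixedScalarCurvature x).sub contMDiffAt_const)
  have htr : ∀ V, (∀ x, SmoothAt V x) → IntegrableOn (fun x ↦ 1 / (2 * a) * tr V x) Ω
      (volumeMeasure g) := fun V hV ↦ hint _ fun x ↦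
    contMDiffAt_const.mul (contMDiffAt_trace_leviCivita g (smoothAt_weighted D (hV x)))
  have hpot : ∀ V, (∀ x, SmoothAt V x) → IntegrableOn (fun x ↦ potential D a L x (V x)) Ω
      (volumeMeasure g) := fun V hV ↦ hint _ fun x ↦
    contMDiffAt_potential D a hL (b := id) (w := V) (hV x)
  have hact : ∀ V, (∀ x, SmoothAt V x) → mixedAction D a Λ L Ω (semiSymmetricContorsion g V) =
      (∫ x in Ω, A x ∂(volumeMeasure g)) - 1 / (2 * a) * (∫ x in Ω, tr V x ∂(volumeMeasure g)) +
        ∫ x in Ω, potential D a L x (V x) ∂(volumeMeasure g) := fun V hV ↦ by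
    have hd : IntegrableOn (fun x ↦ A x - 1 / (2 * a) * tr V x) Ω (volumeMeasure g) :=
      hA.sub (htr V hV)
    rw [← integral_const_mul, ← integral_sub hA (htr V hV), ← integral_add hd (hpot V hV)]
    exact integral_congr_ae (Eventually.of_forall fun x ↦ integrand_eq D a Λ (hV x))
  have hdiv : ∫ x in Ω, tr W x ∂(volumeMeasure g) = ∫ x in Ω, tr U x ∂(volumeMeasure g) := by
    have hs : ∀ V, (∀ x, SmoothAt V x) → IntegrableOn (tr V) Ω (volumeMeasure g) := fun V hV ↦
      hint _ fun x ↦ contMDiffAt_trace_leviCivita g (smoothAt_weighted D (hV x))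
    rw [← sub_eq_zero, ← integral_sub (hs W hW) (hs U hU)]
    let Y : Π x : M, TangentSpace (𝓡 (n + p)) x := fun x ↦ weighted D W x - weighted D U x
    have hY : ∀ x, SmoothAt Y x := fun x ↦
      SmoothAlong.sub (smoothAt_weighted D (hW x)) (smoothAt_weighted D (hU x))
    have hY0 : ∀ x ∉ K, Y x = 0 := fun x hx ↦ by simp only [Y, weighted, hUW x hx, sub_self]
    have e : ∀ x, tr W x - tr U x = LinearMap.trace ℝ _ (leviCivita g Y x).toLinearMap := fun x ↦ by
      have : leviCivita g Y x = leviCivita g (weighted D W) x - leviCivita g (weighted D U) x := by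
        ext1 u
        exact cov_sub (leviCivita g) (smoothAt_weighted D (hW x)) (smoothAt_weighted D (hU x)) u
      rw [this]
      exact (map_sub (LinearMap.trace ℝ (TangentSpace (𝓡 (n + p)) x)) _ _).symm
    simp only [e]
    -- The divergence vanishes outside `Ω` because `K ⊆ Ω`, so the integral over `Ω` is the integral
    -- over `M`, where the divergence theorem applies.
    rw [setIntegral_eq_integral_of_forall_compl_eq_zero,
      integral_divergence_eq_zero g hY hK hY0]
    intro x hx
    rw [leviCivita_of_eventually_zero g]
    · simp
    · filter_upwards [hK.isClosed.isOpen_compl.mem_nhds fun h ↦ hx (hKΩ h)] with y hy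
      exact hY0 y hy
  rw [hact W hW, hact U hU, hdiv]
  ring

/-- The first variation formula. -/
theorem hasDerivAt_mixedAction (hL : IsLagrangian L) (ha : a ≠ 0)
    {U : Π x : M, TangentSpace (𝓡 (n + p)) x} {W : ℝ → Π x : M, TangentSpace (𝓡 (n + p)) x}
    {Ω K : Set M} {ε : ℝ} (hΩ : IsOpen Ω) (hΩc : IsCompact (closure Ω)) (hε : 0 < ε)
    (hW : ContMDiffOn (𝓘(ℝ, ℝ).prod (𝓡 (n + p))) (𝓡 (n + p)).tangent ∞
      (fun q : ℝ × M ↦ TotalSpace.mk' (EuclideanSpace ℝ (Fin (n + p))) q.2 (W q.1 q.2))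
      (Ioo (-ε) ε ×ˢ univ)) (h0 : W 0 = U) (hKΩ : K ⊆ Ω) (hK : IsCompact K)
    (hUW : ∀ t ∈ Ioo (-ε) ε, ∀ x ∉ K, W t x = U x) {v : Π x : M, TangentSpace (𝓡 (n + p)) x}
    (hv : ∀ x, HasDerivAt (fun s ↦ inChart x x (W s x)) (inChart x x (v x)) 0) :
    HasDerivAt (fun t ↦ mixedAction D a Λ L Ω (semiSymmetricContorsion g (W t)))
      (∫ x in Ω, -(1 / (2 * a)) * g.val x (eulerField D a L U x) (v x) ∂(volumeMeasure g)) 0 := by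
  have hWs : ∀ q : ℝ × M, q.1 ∈ Ioo (-ε) ε → SmoothAlong (𝓘(ℝ, ℝ).prod (𝓡 (n + p)))
      (fun q : ℝ × M ↦ q.2) (fun q ↦ W q.1 q.2) q := fun q hq ↦
    hW.contMDiffAt ((isOpen_Ioo.prod isOpen_univ).mem_nhds ⟨hq, mem_univ _⟩)
  have hWt : ∀ t ∈ Ioo (-ε) ε, ∀ x, SmoothAt (W t) x := fun t ht x ↦
    ContMDiffAt.comp (I' := 𝓘(ℝ, ℝ).prod (𝓡 (n + p))) (f := fun y : M ↦ (t, y)) x (hWs (t, x) ht)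
      (contMDiffAt_const.prodMk contMDiffAt_id)
  have h0ε : (0 : ℝ) ∈ Ioo (-ε) ε := ⟨by linarith, hε⟩
  have hU : ∀ x, SmoothAt U x := fun x ↦ h0 ▸ hWt 0 h0ε x
  let ψ : ℝ × M → ℝ := fun q ↦ potential D a L q.2 (W q.1 q.2)
  have hψ : ∀ q : ℝ × M, q.1 ∈ Ioo (-ε) ε →
      ContMDiffAt (𝓘(ℝ, ℝ).prod (𝓡 (n + p))) 𝓘(ℝ, ℝ) ∞ ψ q := fun q hq ↦
    contMDiffAt_potential D a hL (hWs q hq)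
  let ψ' : ℝ × M → ℝ := fun q ↦ deriv (fun s ↦ ψ (s, q.2)) q.1
  have hψ' : ∀ q : ℝ × M, q.1 ∈ Ioo (-ε) ε → ContinuousAt ψ' q := fun q hq ↦
    (contMDiffAt_deriv_fst (hψ q hq)).continuousAt
  have hcont : ∀ (f : ℝ × M → ℝ) (t : ℝ), t ∈ Ioo (-ε) ε → (∀ q : ℝ × M, q.1 ∈ Ioo (-ε) ε →
      ContinuousAt f q) → Continuous fun x ↦ f (t, x) := fun f t ht hf ↦
    continuous_iff_continuousAt.mpr fun x ↦
      (hf (t, x) ht).comp (f := fun y ↦ (t, y)) (by fun_prop)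
  -- Halving the parameter interval makes it compact, so the parameter derivative is bounded by a
  -- constant on its product with the closure of `Ω`; this is the dominating function.
  have hsub : Icc (-(ε / 2)) (ε / 2) ⊆ Ioo (-ε) ε := fun t ht ↦
    ⟨by linarith [ht.1], by linarith [ht.2]⟩
  obtain ⟨C, hC⟩ := (isCompact_Icc.prod hΩc).exists_bound_of_continuousOn
    (f := ψ') fun q hq ↦ (hψ' q (hsub hq.1)).continuousWithinAt
  have hfin : volumeMeasure g Ω < ⊤ :=
    (measure_mono subset_closure).trans_lt hΩc.measure_lt_top
  have key := hasDerivAt_integral_of_dominated_loc_of_deriv_le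
    (μ := (volumeMeasure g).restrict Ω) (x₀ := (0 : ℝ)) (F := fun t x ↦ ψ (t, x))
    (F' := fun t x ↦ ψ' (t, x)) (bound := fun _ ↦ C) (s := Icc (-(ε / 2)) (ε / 2))
    (Icc_mem_nhds (by linarith) (by linarith))
    (by
      filter_upwards [isOpen_Ioo.mem_nhds h0ε] with t ht
      exact (hcont ψ t ht fun q hq ↦ (hψ q hq).continuousAt).aestronglyMeasurable)
    (((hcont ψ 0 h0ε fun q hq ↦ (hψ q hq).continuousAt).continuousOn.integrableOn_compact
      hΩc).mono_set subset_closure)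
    (hcont ψ' 0 h0ε hψ').aestronglyMeasurable
    (by
      filter_upwards [ae_restrict_mem hΩ.measurableSet] with x hx t ht
      exact hC (t, x) ⟨ht, subset_closure hx⟩)
    (integrableOn_const hfin.ne)
    (Eventually.of_forall fun x t ht ↦ by
      have h1 : ContMDiffAt 𝓘(ℝ, ℝ) 𝓘(ℝ, ℝ) ∞ (fun s ↦ ψ (s, x)) t :=
        ContMDiffAt.comp (g := ψ) (I' := 𝓘(ℝ, ℝ).prod (𝓡 (n + p))) (f := fun s : ℝ ↦ (s, x)) t
          (hψ (t, x) (hsub ht)) (contMDiffAt_id.prodMk contMDiffAt_const)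
      exact (h1.contDiffAt.differentiableAt (by simp)).hasDerivAt)
  have hder : ∀ x, ψ' (0, x) = -(1 / (2 * a)) * g.val x (eulerField D a L U x) (v x) := fun x ↦
    (hasDerivAt_potential D a hL ha (hv x) (congrFun h0 x)).deriv
  have key2 := key.2
  simp only [hder] at key2
  -- Near `t = 0` the action is its value at `U` plus the increment of the integrated potential, so
  -- the two have the same derivative.
  refine ((key2.sub_const (∫ x in Ω, ψ (0, x) ∂(volumeMeasure g))).const_add
    (mixedAction D a Λ L Ω (semiSymmetricContorsion g U))).congr_of_eventuallyEq ?_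
  filter_upwards [isOpen_Ioo.mem_nhds h0ε] with t ht
  have h := mixedAction_sub D a Λ hL hU (hWt t ht) hΩc hKΩ hK (hUW t ht)
  rw [h]
  simp only [ψ, h0]

theorem isCritical_of_eulerField_eq_zero (hL : IsLagrangian L) (ha : a ≠ 0)
    {U : Π x : M, TangentSpace (𝓡 (n + p)) x} (h : ∀ x, eulerField D a L U x = 0) :
    IsCriticalAmongSemiSymmetric D a Λ L U := by
  rintro Ω ε W hΩ hΩc hε hW h0 ⟨K, hKΩ, hK, hUW⟩
  -- Smoothness of the family supplies a velocity at each point. No regularity of it in `x` is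
  -- needed, since it is paired with zero.
  have hv : ∀ x, ∃ v : TangentSpace (𝓡 (n + p)) x,
      HasDerivAt (fun s ↦ inChart x x (W s x)) (inChart x x v) 0 := fun x ↦ by
    have hx := mem_chart_source (EuclideanSpace ℝ (Fin (n + p))) x
    have h1 : SmoothAlong 𝓘(ℝ, ℝ) (fun _ : ℝ ↦ x) (fun s ↦ W s x) 0 :=
      ContMDiffAt.comp (I' := 𝓘(ℝ, ℝ).prod (𝓡 (n + p))) (f := fun s : ℝ ↦ (s, x)) 0
        (hW.contMDiffAt ((isOpen_Ioo.prod isOpen_univ).mem_nhds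
          ⟨⟨by linarith, hε⟩, mem_univ _⟩)) (contMDiffAt_id.prodMk contMDiffAt_const)
    have h2 := (SmoothAlong.inChart h1 hx).contDiffAt.differentiableAt (by simp) |>.hasDerivAt
    exact ⟨ofChart x x _, by rw [inChart_ofChart hx]; exact h2⟩
  choose v hv using hv
  refine (hasDerivAt_mixedAction D a Λ hL ha hΩ hΩc hε hW h0 hKΩ hK hUW hv).congr_deriv ?_
  simp [h]

/-- The fundamental lemma of the calculus of variations, applied to the linear family `U + tV` with
a test field adapted to an indefinite metric. -/
theorem eulerField_eq_zero_of_isCritical (hL : IsLagrangian L) (ha : a ≠ 0)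
    {U : Π x : M, TangentSpace (𝓡 (n + p)) x} (hU : ∀ x, SmoothAt U x)
    (h : IsCriticalAmongSemiSymmetric D a Λ L U) (x : M) : eulerField D a L U x = 0 := by
  have : LocallyCompactSpace M :=
    ChartedSpace.locallyCompactSpace (EuclideanSpace ℝ (Fin (n + p))) M
  have hx := mem_chart_source (EuclideanSpace ℝ (Fin (n + p))) x
  let ρ : SmoothBumpFunction (𝓡 (n + p)) x := Classical.arbitrary _
  let b : Fin (n + p) → Π y : M, TangentSpace (𝓡 (n + p)) y := coordField (n + p) x
  let E : Π y : M, TangentSpace (𝓡 (n + p)) y := eulerField D a L U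
  -- Cutting off `E` itself would not do: `⟨E,E⟩` can change sign or vanish where `E ≠ 0`. Here
  -- `⟨E,V⟩` is `ρ` times a sum of squares, which detects `E` since the coordinate fields span.
  let V : Π y : M, TangentSpace (𝓡 (n + p)) y := fun y ↦ ρ y • ∑ k, g.val y (E y) (b k y) • b k y
  let f : M → ℝ := fun y ↦ ρ y * ∑ k, g.val y (E y) (b k y) * g.val y (E y) (b k y)
  have hE : ∀ y, SmoothAt E y := smoothAt_eulerField D a hL hU
  have hVz : ∀ y ∉ tsupport ρ, V y = 0 := fun y hy ↦ by
    simp only [V, image_eq_zero_of_notMem_tsupport hy, zero_smul]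
  have hV : ∀ y, SmoothAt V y := fun y ↦ by
    by_cases hy : y ∈ dom (n + p) x
    · refine SmoothAlong.smul (ρ.contMDiff y) (smoothAlong_sum _ contMDiffAt_id fun k _ ↦ ?_)
      exact SmoothAlong.smul (contMDiffAt_metric g (hE y) (smoothAt_coordField hy k))
        (smoothAt_coordField hy k)
    · refine (contMDiff_zeroSection ℝ (TangentSpace (𝓡 (n + p)) : M → Type _)
        |>.contMDiffAt).congr_of_eventuallyEq ?_
      filter_upwards [(isClosed_tsupport ρ).isOpen_compl.mem_nhds fun h' ↦
        hy (ρ.tsupport_subset_chartAt_source h')] with z hz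
      rw [hVz z hz]
      rfl
  have hfV : ∀ y, g.val y (E y) (V y) = f y := fun y ↦ by
    simp only [V, f, map_smul, map_sum, smul_eq_mul]
  obtain ⟨Ω, hΩ, hKΩ, hΩc⟩ := exists_isOpen_superset_and_isCompact_closure ρ.hasCompactSupport
  let W : ℝ → Π y : M, TangentSpace (𝓡 (n + p)) y := fun t y ↦ U y + t • V y
  have hW : ∀ q : ℝ × M, SmoothAlong (𝓘(ℝ, ℝ).prod (𝓡 (n + p))) (fun q : ℝ × M ↦ q.2)
      (fun q ↦ W q.1 q.2) q := fun q ↦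
    SmoothAlong.add (SmoothAt.comp (b := fun q : ℝ × M ↦ q.2) (hU q.2) contMDiffAt_snd)
      (SmoothAlong.smul contMDiffAt_fst
        (SmoothAt.comp (b := fun q : ℝ × M ↦ q.2) (hV q.2) contMDiffAt_snd))
  have hW0 : W 0 = U := by funext y; simp [W]
  have hWK : ∀ t ∈ Ioo (-1 : ℝ) 1, ∀ y ∉ tsupport ρ, W t y = U y := fun t _ y hy ↦ by
    simp only [W, hVz y hy, smul_zero, add_zero]
  have hWs : ContMDiffOn (𝓘(ℝ, ℝ).prod (𝓡 (n + p))) (𝓡 (n + p)).tangent ∞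
      (fun q : ℝ × M ↦ TotalSpace.mk' (EuclideanSpace ℝ (Fin (n + p))) q.2 (W q.1 q.2))
      (Ioo (-1) 1 ×ˢ univ) := fun q _ ↦ (hW q).contMDiffWithinAt
  have h1 := h Ω 1 W hΩ hΩc one_pos hWs hW0 ⟨tsupport ρ, hKΩ, ρ.hasCompactSupport, hWK⟩
  have h2 := hasDerivAt_mixedAction D a Λ hL ha (v := V) hΩ hΩc one_pos hWs hW0 hKΩ
    ρ.hasCompactSupport hWK fun y ↦ by
      simp only [W, map_add, map_smul]
      exact hasDerivAt_add_smul (inChart y y (U y)) (inChart y y (V y)) 0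
  have h3 : ∫ y, f y ∂(volumeMeasure g) = 0 := by
    have h4 := h2.unique h1
    rw [integral_const_mul] at h4
    have h5 := (mul_eq_zero.mp h4).resolve_left (by simp [ha])
    rw [← h5, setIntegral_eq_integral_of_forall_compl_eq_zero]
    · exact integral_congr_ae (Eventually.of_forall fun y ↦ (hfV y).symm)
    · intro y hy
      rw [hVz y fun h' ↦ hy (hKΩ h'), map_zero]
  have hfc : Continuous f := continuous_iff_continuousAt.mpr fun y ↦ by
    rw [← funext hfV]
    exact (contMDiffAt_metric g (hE y) (hV y)).continuousAt
  have hf0 : 0 ≤ f := fun y ↦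
    mul_nonneg ρ.nonneg (Finset.sum_nonneg fun k _ ↦ mul_self_nonneg _)
  -- The function `f` is continuous, nonnegative and compactly supported with zero integral, and the
  -- volume charges open sets, so `f` vanishes.
  have hfx : f x = 0 := by
    by_contra hne
    exact (hfc.integral_pos_of_hasCompactSupport_nonneg_nonzero
      (ρ.hasCompactSupport.mul_right) hf0 hne).ne' h3
  have h6 : ∀ k, g.val x (E x) (b k x) = 0 := fun k ↦ by
    -- At its centre the bump function equals 1, so every square in the sum vanishes there.
    simp only [f, ρ.eq_one, one_mul] at hfx
    exact mul_self_eq_zero.mp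
      ((Finset.sum_eq_zero_iff_of_nonneg fun k _ ↦ mul_self_nonneg _).mp hfx k (Finset.mem_univ k))
  rw [← sum_val_smul_dualCoordField g hx (eulerField D a L U x)]
  exact Finset.sum_eq_zero fun k _ ↦ by rw [show g.val x _ _ = 0 from h6 k, zero_smul]

end Integral

end Variation

end MixedEH

end

/-! ### The proposition -/

open MixedEH in
theorem mainTheorem12 {n p : ℕ} (hn : 1 ≤ n) (hp : 1 ≤ p)
    {M : Type*} [TopologicalSpace M] [T2Space M] [SecondCountableTopology M] [ConnectedSpace M]
    [ChartedSpace (EuclideanSpace ℝ (Fin (n + p))) M] [IsManifold (𝓡 (n + p)) ∞ M]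
    [MeasurableSpace M] [BorelSpace M]
    (g : PseudoRiemannianMetric (n + p) M) (D : NondegenerateDistribution g)
    (a Λ : ℝ) (ha : a ≠ 0) (L : Tensor12Bundle (n + p) M → ℝ) (hL : IsLagrangian L) :
    (∀ U : Π x : M, TangentSpace (𝓡 (n + p)) x,
      ContMDiff (𝓡 (n + p)) (𝓡 (n + p)).tangent ∞
        (fun x ↦ TotalSpace.mk' (EuclideanSpace ℝ (Fin (n + p))) x (U x)) →
      (IsCriticalAmongSemiSymmetric D a Λ L U ↔
        ∀ x : M,
          (2 * p * (n - 1) : ℝ) • D.top x (U x) - (n - p : ℝ) • meanCurvaturePerp D x =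
              (-a) • D.top x (spinVector D L (semiSymmetricContorsion g U) x) ∧
          (2 * n * (p - 1) : ℝ) • D.bot x (U x) - (p - n : ℝ) • meanCurvature D x =
              (-a) • D.bot x (spinVector D L (semiSymmetricContorsion g U) x))) ∧
    (n = 1 → p = 1 → ∀ U : Π x : M, TangentSpace (𝓡 (n + p)) x,
      ContMDiff (𝓡 (n + p)) (𝓡 (n + p)).tangent ∞
        (fun x ↦ TotalSpace.mk' (EuclideanSpace ℝ (Fin (n + p))) x (U x)) →
      (∀ (x : M) (X Y : TangentSpace (𝓡 (n + p)) x),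
        spinTensor D L (semiSymmetricContorsion g U) x X Y = 0) →
      IsCriticalAmongSemiSymmetric D a Λ L U) := by
  have hcrit : ∀ U : Π x : M, TangentSpace (𝓡 (n + p)) x,
      ContMDiff (𝓡 (n + p)) (𝓡 (n + p)).tangent ∞
        (fun x ↦ TotalSpace.mk' (EuclideanSpace ℝ (Fin (n + p))) x (U x)) →
      (IsCriticalAmongSemiSymmetric D a Λ L U ↔ ∀ x, eulerField D a L U x = 0) := fun U hU ↦
    ⟨fun h ↦ eulerField_eq_zero_of_isCritical D a Λ hL ha (fun x ↦ hU x) h,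
      fun h ↦ isCritical_of_eulerField_eq_zero D a Λ hL ha h⟩
  refine ⟨fun U hU ↦ (hcrit U hU).trans (forall_congr' (eulerField_eq_zero_iff D a U)), ?_⟩
  intro h1 h2 U hU hs
  refine (hcrit U hU).mpr fun x ↦ (eulerField_eq_zero_iff D a U x).mpr ?_
  have hsv : spinVector D L (semiSymmetricContorsion g U) x = 0 := by
    simp [spinVector, hs]
  -- With `n = p = 1` the factors `n - 1`, `p - 1` and `n - p` are all zero, so both equations read
  -- `0 = 0` once the spin vector vanishes.
  subst h1 h2
  simp [hsv]
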